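/- **Setting.** For $n\ge 0$ let $\mathrm{Cob}(n)$ be the additive Bar-Natan category: objects are formally $q$-graded Temperley–Lieb diagrams $q^i a$ with $2n$ boundary points (circles allowed); morphisms are $\mathbb Z[\alpha]$-linear combinations of dotted orientable cobordisms, modulo the local relations: a sphere with $0,1,2,3$ dots equals $0,1,0,\alpha$, and the cylinder over a circle is the sum of the two pairs of discs having one dot on one of the discs. A cobordism $C\colon q^iA\to q^jB$ has degree $\chi(C)-n+(j-i)$, where each dot contributes $-2$; $\alpha$ has degree $-4$. The product $\otimes$ is vertical stacking of diagrams and gluing of cobordisms; $e_i$ ($0<i<n$) are the standard generators. $\mathrm{Kom}(n)$ is the category of complexes of finite direct sums of objects of $\mathrm{Cob}(n)$, bounded below in homological degree, with differentials $d_k\colon P_k\to P_{k+1}$; $P\simeq 0$ means homotopy equivalence through maps and homotopies of degree $0$. A complex $P\in\mathrm{Kom}(n)$ is a *universal projector* if 1. $P_k=0$ for $k<0$, all summands of $P_k$ with $k>0$ have $q$-degree $\ge 0$, and every $d_k$ is a matrix of degree zero maps; 2. $P_0\cong 1$ (by a degree zero isomorphism), and $P_k\not\cong 1\oplus D$ (by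 isomorphisms of any degree) for all $k>0$ and all finite direct sums $D$ of objects of $\mathrm{Cob}(n)$; 3. $P\otimes e_i\simeq 0$ and $e_i\otimes P\simeq 0$ for all $0<i<n$. **Theorem (third projector).** In $\mathrm{Mat}(\mathrm{Cob}(3))$ consider the sequence $$1\xrightarrow{A}q(e_1\oplus e_2)\xrightarrow{B}q^2(e_1e_2\oplus e_2e_1)\xrightarrow{C}q^4(e_1e_2\oplus e_2e_1)\xrightarrow{D}q^5(e_1\oplus e_2)\xrightarrow{E}q^7(e_1\oplus e_2)\xrightarrow{B}q^8(e_1e_2\oplus e_2e_1)\xrightarrow{C}\cdots$$ starting in homological degree $0$, and from homological degree $1$ on periodic of period $4$ up to the shift $q^6$, with maps $B,C,D,E$ repeated. The matrices, acting on column vectors, are $$A=\begin{pmatrix}s_1\\ s_2\end{pmatrix},\quad B=\begin{pmatrix}b_{00}&-b_{01}\\-b_{10}&b_{11}\end{pmatrix},\quad C=\begin{pmatrix}u+l&c_{01}\\c_{10}&u+l\end{pmatrix},\quad D=\begin{pmatrix}b_{00}^*&-b_{10}^*\\-b_{01}^*&b_{11}^*\end{pmatrix},\quad E=\begin{pmatrix}u+l&\epsilon_{01}\\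 \epsilon_{10}&u+l\end{pmatrix}.$$ Here $s_i\colon 1\to e_i$ is the saddle; $b_{00}\colon e_1\to e_1e_2$, $b_{01}\colon e_2\to e_1e_2$, $b_{10}\colon e_1\to e_2e_1$, $b_{11}\colon e_2\to e_2e_1$ are the saddles $1\to e_j$ applied in the second or first factor, and $b^*$ is $b$ turned upside down; $u$ and $l$ are the identity cobordism with a dot on the upper, respectively the lower, turnback (the arc joining two upper, respectively two lower, boundary points); $c_{01}\colon e_2e_1\to e_1\to e_1e_2$, $c_{10}\colon e_1e_2\to e_2\to e_2e_1$, $\epsilon_{01}\colon e_2\to 1\to e_1$ and $\epsilon_{10}\colon e_1\to 1\to e_2$ are the indicated compositions of two saddles. Then this sequence is a chain complex $P_3$ (consecutive maps compose to zero), and $P_3$ is a universal projector. In particular $e_i\otimes P_3\simeq 0\simeq P_3\otimes e_i$ for $i=1,2$. -/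

import Mathlib

open CategoryTheory CategoryTheory.Limits

/-! ## Temperley-Lieb diagrams -/

/-- Temperley-Lieb diagrams with `2 n` boundary points, as vertical stackings of the identity
diagram, the identity diagram together with a disjoint circle, and the generators
`e_1, …, e_{n-1}` (here `e i`, with `i` counted from `0`). -/
inductive TLDiagram (n : ℕ) : Type
  | one : TLDiagram n
  | circle : TLDiagram n
  | e (i : Fin (n - 1)) : TLDiagram n
  | stack (a b : TLDiagram n) : TLDiagram n

namespace TLDiagram

variable {n : ℕ}

/-- The left one of the two strands on which `e i` acts. -/
def left (i : Fin (n - 1)) : Fin n := ⟨i.val, by omega⟩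

/-- The right one of the two strands on which `e i` acts. -/
def right (i : Fin (n - 1)) : Fin n := ⟨i.val + 1, by omega⟩

/-- Sample points on a diagram: at least one on every component, and all boundary points. -/
def Site : TLDiagram n → Type
  | one => Fin n
  | circle => Fin n ⊕ Unit
  | e _ => Fin n ⊕ Fin n
  | stack a b => a.Site ⊕ b.Site

/-- The `j`-th boundary point on the upper line. -/
def top : (a : TLDiagram n) → Fin n → a.Site
  | one, j => j
  | circle, j => Sum.inl j
  | e _, j => Sum.inl j
  | stack a _, j => Sum.inl (a.top j)

/-- The `j`-th boundary point on the lower line. -/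
def bot : (a : TLDiagram n) → Fin n → a.Site
  | one, j => j
  | circle, j => Sum.inl j
  | e _, j => Sum.inr j
  | stack _ b, j => Sum.inr (b.bot j)

/-- Two sample points joined by a piece of the diagram. In `e i` all strands are vertical except
for two, which join the two upper, respectively the two lower, points at `left i` and `right i`.
In `stack a b` the lower line of `a` is glued to the upper line of `b`. -/
def Adj : (a : TLDiagram n) → a.Site → a.Site → Prop
  | one, _, _ => False
  | circle, _, _ => False
  | e i, x, y =>
      (∃ j, j ≠ left i ∧ j ≠ right i ∧ x = Sum.inl j ∧ y = Sum.inr j) ∨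
      (x = Sum.inl (left i) ∧ y = Sum.inl (right i)) ∨
      (x = Sum.inr (left i) ∧ y = Sum.inr (right i))
  | stack a _, Sum.inl x, Sum.inl y => a.Adj x y
  | stack _ b, Sum.inr x, Sum.inr y => b.Adj x y
  | stack a b, Sum.inl x, Sum.inr y => ∃ j, x = a.bot j ∧ y = b.top j
  | stack _ _, Sum.inr _, Sum.inl _ => False

/-- The set of connected components of a diagram (arcs and circles). -/
abbrev Comp (a : TLDiagram n) : Type := Quot a.Adj

end TLDiagram

/-! ## Dotted surfaces -/

/-- The combinatorial type of a dotted surface with corners `C` whose boundary consists of the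
diagram `a`, the diagram `b`, and one vertical interval over each of the `2 n` boundary points.

* `X` is the set of connected components of `C`;
* `src` and `tgt` send a point of `a`, respectively of `b`, to its component in `C`;
* `chi c` is the topological degree `χ(c) - m(c)` of the component `c`, with `χ(c)` its Euler
  characteristic and `2 * m(c)` the number of vertical intervals in its boundary (`m(c)` is then
  the number of arcs of `a`, and also of `b`, in `c`). Because an arc has Euler characteristic `1`
  and a circle `0`, this number is additive under gluing along diagrams and also
  under gluing along vertical intervals;
* `dots c` is the number of dots on `c`. -/
structure PreSurface {n : ℕ} (a b : TLDiagram n) : Type 1 where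
  X : Type
  src : a.Site → X
  tgt : b.Site → X
  src_adj : ∀ x y, a.Adj x y → src x = src y
  tgt_adj : ∀ x y, b.Adj x y → tgt x = tgt y
  top_eq : ∀ j, src (a.top j) = tgt (b.top j)
  bot_eq : ∀ j, src (a.bot j) = tgt (b.bot j)
  chi : X →₀ ℤ
  dots : X →₀ ℕ

namespace PreSurface

variable {n : ℕ} {a b c d : TLDiagram n}

/-- Two combinatorial types describe surfaces that are homeomorphic relative to the boundary. -/
def Equivalent (S T : PreSurface a b) : Prop :=
  ∃ φ : S.X ≃ T.X, (∀ x, φ (S.src x) = T.src x) ∧ (∀ x, φ (S.tgt x) = T.tgt x) ∧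
    S.chi.mapDomain φ = T.chi ∧ S.dots.mapDomain φ = T.dots

theorem Equivalent.refl (S : PreSurface a b) : Equivalent S S :=
  ⟨Equiv.refl _, fun _ => rfl, fun _ => rfl, Finsupp.mapDomain_id, Finsupp.mapDomain_id⟩

theorem Equivalent.symm {S T : PreSurface a b} : Equivalent S T → Equivalent T S := by
  rintro ⟨φ, h1, h2, h3, h4⟩
  refine ⟨φ.symm, fun x => ?_, fun x => ?_, ?_, ?_⟩
  · rw [← h1, φ.symm_apply_apply]
  · rw [← h2, φ.symm_apply_apply]
  · rw [← h3, ← Finsupp.mapDomain_comp, φ.symm_comp_self, Finsupp.mapDomain_id]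
  · rw [← h4, ← Finsupp.mapDomain_comp, φ.symm_comp_self, Finsupp.mapDomain_id]

theorem Equivalent.trans {S T U : PreSurface a b} :
    Equivalent S T → Equivalent T U → Equivalent S U := by
  rintro ⟨φ, h1, h2, h3, h4⟩ ⟨ψ, k1, k2, k3, k4⟩
  refine ⟨φ.trans ψ, fun x => ?_, fun x => ?_, ?_, ?_⟩
  · simp [h1, k1]
  · simp [h2, k2]
  · rw [Equiv.coe_trans, Finsupp.mapDomain_comp, h3, k3]
  · rw [Equiv.coe_trans, Finsupp.mapDomain_comp, h4, k4]

instance setoid (a b : TLDiagram n) : Setoid (PreSurface a b) where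
  r := Equivalent
  iseqv := ⟨Equivalent.refl, Equivalent.symm, Equivalent.trans⟩

/-- The surface upside down, as a surface from `b` to `a`. -/
def reverse (S : PreSurface a b) : PreSurface b a where
  X := S.X
  src := S.tgt
  tgt := S.src
  src_adj := S.tgt_adj
  tgt_adj := S.src_adj
  top_eq j := (S.top_eq j).symm
  bot_eq j := (S.bot_eq j).symm
  chi := S.chi
  dots := S.dots

/-- The components of `S` and `T` that meet along the diagram `b`. -/
inductive CompGlue (S : PreSurface a b) (T : PreSurface b c) : S.X ⊕ T.X → S.X ⊕ T.X → Prop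
  | glue (x : b.Site) : CompGlue S T (Sum.inl (S.tgt x)) (Sum.inr (T.src x))

/-- Composition: gluing two surfaces along the diagram `b`. -/
noncomputable def comp (S : PreSurface a b) (T : PreSurface b c) : PreSurface a c where
  X := Quot (CompGlue S T)
  src x := Quot.mk _ (Sum.inl (S.src x))
  tgt x := Quot.mk _ (Sum.inr (T.tgt x))
  src_adj x y h := by rw [S.src_adj x y h]
  tgt_adj x y h := by rw [T.tgt_adj x y h]
  top_eq j := by rw [S.top_eq, ← T.top_eq]; exact Quot.sound (.glue _)
  bot_eq j := by rw [S.bot_eq, ← T.bot_eq]; exact Quot.sound (.glue _)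
  chi := S.chi.mapDomain (fun x => Quot.mk _ (Sum.inl x)) +
    T.chi.mapDomain (fun x => Quot.mk _ (Sum.inr x))
  dots := S.dots.mapDomain (fun x => Quot.mk _ (Sum.inl x)) +
    T.dots.mapDomain (fun x => Quot.mk _ (Sum.inr x))

/-- The components of `S` and `T` that meet along one of the `n` vertical intervals over the line
where the diagrams are stacked. -/
inductive TensorGlue (S : PreSurface a b) (T : PreSurface c d) : S.X ⊕ T.X → S.X ⊕ T.X → Prop
  | glue (j : Fin n) : TensorGlue S T (Sum.inl (S.src (a.bot j))) (Sum.inr (T.src (c.top j)))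

/-- The product `S ⊗ T`: gluing two surfaces along the `n` vertical intervals over the line where
the diagrams are stacked. -/
noncomputable def tensor (S : PreSurface a b) (T : PreSurface c d) :
    PreSurface (a.stack c) (b.stack d) where
  X := Quot (TensorGlue S T)
  src x := Quot.mk _ (Sum.map S.src T.src x)
  tgt x := Quot.mk _ (Sum.map S.tgt T.tgt x)
  src_adj := by
    rintro (x | x) (y | y) h
    · exact congrArg (fun z => Quot.mk _ (Sum.inl z)) (S.src_adj x y h)
    · obtain ⟨j, rfl, rfl⟩ := h
      exact Quot.sound (.glue j)
    · exact h.elim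
    · exact congrArg (fun z => Quot.mk _ (Sum.inr z)) (T.src_adj x y h)
  tgt_adj := by
    rintro (x | x) (y | y) h
    · exact congrArg (fun z => Quot.mk _ (Sum.inl z)) (S.tgt_adj x y h)
    · obtain ⟨j, rfl, rfl⟩ := h
      change Quot.mk _ (Sum.inl (S.tgt (b.bot j))) = Quot.mk _ (Sum.inr (T.tgt (d.top j)))
      rw [← S.bot_eq, ← T.top_eq]
      exact Quot.sound (.glue j)
    · exact h.elim
    · exact congrArg (fun z => Quot.mk _ (Sum.inr z)) (T.tgt_adj x y h)
  top_eq j := congrArg (fun z => Quot.mk _ (Sum.inl z)) (S.top_eq j)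
  bot_eq j := congrArg (fun z => Quot.mk _ (Sum.inr z)) (T.bot_eq j)
  chi := S.chi.mapDomain (fun x => Quot.mk _ (Sum.inl x)) +
    T.chi.mapDomain (fun x => Quot.mk _ (Sum.inr x))
  dots := S.dots.mapDomain (fun x => Quot.mk _ (Sum.inl x)) +
    T.dots.mapDomain (fun x => Quot.mk _ (Sum.inr x))

/-- The union of the cylinders over the components of a diagram, seen as an isotopy from `a` to
`b`. Every component is a disc or an annulus and has topological degree `0`. -/
noncomputable def cylinder (φ : a.Comp ≃ b.Comp)
    (htop : ∀ j, φ (Quot.mk _ (a.top j)) = Quot.mk _ (b.top j))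
    (hbot : ∀ j, φ (Quot.mk _ (a.bot j)) = Quot.mk _ (b.bot j)) : PreSurface a b where
  X := b.Comp
  src x := φ (Quot.mk _ x)
  tgt x := Quot.mk _ x
  src_adj _ _ h := congrArg φ (Quot.sound h)
  tgt_adj _ _ h := Quot.sound h
  top_eq := htop
  bot_eq := hbot
  chi := 0
  dots := 0

/-- The identity cobordism. -/
noncomputable def id (a : TLDiagram n) : PreSurface a a :=
  cylinder (Equiv.refl _) (fun _ => rfl) (fun _ => rfl)

/-- The identity cobordism with one dot on the component over the point `p`. -/
noncomputable def dot (a : TLDiagram n) (p : a.Site) : PreSurface a a :=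
  { id a with dots := Finsupp.single (Quot.mk _ p) 1 }

/-- The strands `left i` and `right i` get connected. -/
inductive SaddleGlue (i : Fin (n - 1)) : Fin n → Fin n → Prop
  | glue : SaddleGlue i (TLDiagram.left i) (TLDiagram.right i)

/-- The saddle from `1` to `e i`. Its components are vertical discs over the strands on which
`e i` does not act, and one disc with four vertical intervals and four arcs, of topological degree
`1 - 2 = -1`. -/
noncomputable def saddle (i : Fin (n - 1)) : PreSurface TLDiagram.one (TLDiagram.e i) where
  X := Quot (SaddleGlue i)
  src x := Quot.mk _ x
  tgt x := Quot.mk _ (Sum.elim (fun j => j) (fun j => j) x)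
  src_adj _ _ h := h.elim
  tgt_adj := by
    rintro x y (⟨j, _, _, rfl, rfl⟩ | ⟨rfl, rfl⟩ | ⟨rfl, rfl⟩)
    · rfl
    · exact Quot.sound .glue
    · exact Quot.sound .glue
  top_eq _ := rfl
  bot_eq _ := rfl
  chi := Finsupp.single (Quot.mk _ (TLDiagram.left i)) (-1)
  dots := 0

/-- The birth of a circle: a disc bounding the circle, next to the identity of `1`. -/
noncomputable def birth (n : ℕ) :
    PreSurface (TLDiagram.one : TLDiagram n) (TLDiagram.circle : TLDiagram n) where
  X := Fin n ⊕ Unit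
  src x := Sum.inl x
  tgt x := x
  src_adj _ _ h := h.elim
  tgt_adj _ _ h := h.elim
  top_eq _ := rfl
  bot_eq _ := rfl
  chi := Finsupp.single (Sum.inr ()) 1
  dots := 0

/-- A circle merges with the component of the diagram `a` through the point `p`; the component
where this happens has topological degree `-1`. -/
noncomputable def merge (a : TLDiagram n) (p : a.Site) :
    PreSurface (TLDiagram.circle.stack a) a where
  X := a.Comp
  src := Sum.elim (Sum.elim (fun j => Quot.mk _ (a.top j)) (fun _ => Quot.mk _ p))
    (fun x => Quot.mk _ x)
  tgt x := Quot.mk _ x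
  src_adj := by
    rintro (x | x) (y | y) h
    · exact h.elim
    · obtain ⟨j, rfl, rfl⟩ := h
      rfl
    · exact h.elim
    · exact Quot.sound h
  tgt_adj _ _ h := Quot.sound h
  top_eq _ := rfl
  bot_eq _ := rfl
  chi := Finsupp.single (Quot.mk _ p) (-1)
  dots := 0

/-- A criterion for equivalence: mutually inverse maps. -/
theorem Equivalent.of_maps {S T : PreSurface a b} (φ : S.X → T.X) (ψ : T.X → S.X)
    (h : ∀ x, ψ (φ x) = x) (h' : ∀ x, φ (ψ x) = x)
    (h1 : ∀ x, φ (S.src x) = T.src x) (h2 : ∀ x, φ (S.tgt x) = T.tgt x)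
    (h3 : S.chi.mapDomain φ = T.chi) (h4 : S.dots.mapDomain φ = T.dots) : Equivalent S T :=
  ⟨⟨φ, ψ, h, h'⟩, h1, h2, h3, h4⟩

theorem comp_congr {S S' : PreSurface a b} {T T' : PreSurface b c} :
    Equivalent S S' → Equivalent T T' → Equivalent (S.comp T) (S'.comp T') := by
  rintro ⟨φ, h1, h2, h3, h4⟩ ⟨ψ, k1, k2, k3, k4⟩
  refine ⟨Quot.congr (Equiv.sumCongr φ ψ) ?_, ?_, ?_, ?_, ?_⟩
  · intro x y
    constructor
    · rintro ⟨z⟩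
      simp only [Equiv.sumCongr_apply, Sum.map_inl, Sum.map_inr, h2, k1]
      exact .glue z
    · intro h
      generalize hx : Equiv.sumCongr φ ψ x = x' at h
      generalize hy : Equiv.sumCongr φ ψ y = y' at h
      obtain ⟨z⟩ := h
      have hx' : x = Sum.inl (S.tgt z) := by
        apply (Equiv.sumCongr φ ψ).injective; rw [hx]; simp [h2]
      have hy' : y = Sum.inr (T.src z) := by
        apply (Equiv.sumCongr φ ψ).injective; rw [hy]; simp [k1]
      rw [hx', hy']
      exact .glue z
  · intro x
    exact congrArg (fun z => Quot.mk _ (Sum.inl z)) (h1 x)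
  · intro x
    exact congrArg (fun z => Quot.mk _ (Sum.inr z)) (k2 x)
  · simp only [comp, ← h3, ← k3, Finsupp.mapDomain_add, ← Finsupp.mapDomain_comp]
    rfl
  · simp only [comp, ← h4, ← k4, Finsupp.mapDomain_add, ← Finsupp.mapDomain_comp]
    rfl

theorem tensor_congr {S S' : PreSurface a b} {T T' : PreSurface c d} :
    Equivalent S S' → Equivalent T T' → Equivalent (S.tensor T) (S'.tensor T') := by
  rintro ⟨φ, h1, h2, h3, h4⟩ ⟨ψ, k1, k2, k3, k4⟩
  refine ⟨Quot.congr (Equiv.sumCongr φ ψ) ?_, ?_, ?_, ?_, ?_⟩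
  · intro x y
    constructor
    · rintro ⟨z⟩
      simp only [Equiv.sumCongr_apply, Sum.map_inl, Sum.map_inr, h1, k1]
      exact .glue z
    · intro h
      generalize hx : Equiv.sumCongr φ ψ x = x' at h
      generalize hy : Equiv.sumCongr φ ψ y = y' at h
      obtain ⟨z⟩ := h
      have hx' : x = Sum.inl (S.src (a.bot z)) := by
        apply (Equiv.sumCongr φ ψ).injective; rw [hx]; simp [h1]
      have hy' : y = Sum.inr (T.src (c.top z)) := by
        apply (Equiv.sumCongr φ ψ).injective; rw [hy]; simp [k1]
      rw [hx', hy']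
      exact .glue z
  · rintro (x | x)
    · exact congrArg (fun z => Quot.mk _ (Sum.inl z)) (h1 x)
    · exact congrArg (fun z => Quot.mk _ (Sum.inr z)) (k1 x)
  · rintro (x | x)
    · exact congrArg (fun z => Quot.mk _ (Sum.inl z)) (h2 x)
    · exact congrArg (fun z => Quot.mk _ (Sum.inr z)) (k2 x)
  · simp only [tensor, ← h3, ← k3, Finsupp.mapDomain_add, ← Finsupp.mapDomain_comp]
    rfl
  · simp only [tensor, ← h4, ← k4, Finsupp.mapDomain_add, ← Finsupp.mapDomain_comp]
    rfl

theorem id_comp (S : PreSurface a b) : Equivalent ((id a).comp S) S := by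
  refine Equivalent.of_maps (Quot.lift (Sum.elim (Quot.lift S.src S.src_adj) (fun x => x)) ?_)
    (fun x => Quot.mk _ (Sum.inr x)) ?_ (fun _ => rfl) (fun _ => rfl) (fun _ => rfl) ?_ ?_
  · rintro _ _ ⟨x⟩
    rfl
  · rintro ⟨x | x⟩
    · obtain ⟨x⟩ := x
      exact (Quot.sound (.glue (S := id a) (T := S) x)).symm
    · rfl
  · simp only [comp, id, cylinder, Finsupp.mapDomain_zero, zero_add, ← Finsupp.mapDomain_comp]
    exact Finsupp.mapDomain_id
  · simp only [comp, id, cylinder, Finsupp.mapDomain_zero, zero_add, ← Finsupp.mapDomain_comp]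
    exact Finsupp.mapDomain_id

theorem comp_id (S : PreSurface a b) : Equivalent (S.comp (id b)) S := by
  refine Equivalent.of_maps (Quot.lift (Sum.elim (fun x => x) (Quot.lift S.tgt S.tgt_adj)) ?_)
    (fun x => Quot.mk _ (Sum.inl x)) ?_ (fun _ => rfl) (fun _ => rfl) (fun _ => rfl) ?_ ?_
  · rintro _ _ ⟨x⟩
    rfl
  · rintro ⟨x | x⟩
    · rfl
    · obtain ⟨x⟩ := x
      exact Quot.sound (.glue (S := S) (T := id b) x)
  · simp only [comp, id, cylinder, Finsupp.mapDomain_zero, add_zero, ← Finsupp.mapDomain_comp]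
    exact Finsupp.mapDomain_id
  · simp only [comp, id, cylinder, Finsupp.mapDomain_zero, add_zero, ← Finsupp.mapDomain_comp]
    exact Finsupp.mapDomain_id

theorem comp_assoc (S : PreSurface a b) (T : PreSurface b c) (U : PreSurface c d) :
    Equivalent ((S.comp T).comp U) (S.comp (T.comp U)) := by
  refine Equivalent.of_maps
    (Quot.lift (Sum.elim
      (Quot.lift (Sum.elim (fun x => Quot.mk _ (Sum.inl x))
        (fun x => Quot.mk _ (Sum.inr (Quot.mk _ (Sum.inl x))))) ?_)
      (fun x => Quot.mk _ (Sum.inr (Quot.mk _ (Sum.inr x))))) ?_)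
    (Quot.lift (Sum.elim
      (fun x => Quot.mk _ (Sum.inl (Quot.mk _ (Sum.inl x))))
      (Quot.lift (Sum.elim (fun x => Quot.mk _ (Sum.inl (Quot.mk _ (Sum.inr x))))
        (fun x => Quot.mk _ (Sum.inr x))) ?_)) ?_)
    ?_ ?_ (fun _ => rfl) (fun _ => rfl) ?_ ?_
  · rintro _ _ ⟨x⟩
    exact Quot.sound (.glue (S := S) (T := T.comp U) x)
  · rintro _ _ ⟨x⟩
    exact congrArg (fun z => Quot.mk _ (Sum.inr z)) (Quot.sound (.glue (S := T) (T := U) x))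
  · rintro _ _ ⟨x⟩
    exact Quot.sound (.glue (S := S.comp T) (T := U) x)
  · rintro _ _ ⟨x⟩
    exact congrArg (fun z => Quot.mk _ (Sum.inl z)) (Quot.sound (.glue (S := S) (T := T) x))
  · rintro ⟨x | x⟩
    · obtain ⟨x | x⟩ := x <;> rfl
    · rfl
  · rintro ⟨x | x⟩
    · rfl
    · obtain ⟨x | x⟩ := x <;> rfl
  · simp only [comp, Finsupp.mapDomain_add, ← Finsupp.mapDomain_comp, add_assoc]
    rfl
  · simp only [comp, Finsupp.mapDomain_add, ← Finsupp.mapDomain_comp, add_assoc]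
    rfl

theorem id_tensor_id (a b : TLDiagram n) :
    Equivalent ((id a).tensor (id b)) (id (a.stack b)) := by
  refine Equivalent.of_maps
    (Quot.lift (Sum.elim
      (Quot.lift (fun x => Quot.mk _ (Sum.inl x)) ?_)
      (Quot.lift (fun x => Quot.mk _ (Sum.inr x)) ?_)) ?_)
    (Quot.lift (fun x => Quot.mk _ (Sum.map (Quot.mk _) (Quot.mk _) x)) ?_) ?_ ?_ ?_ ?_ ?_ ?_
  · intro x y h
    exact Quot.sound (r := (a.stack b).Adj) h
  · intro x y h
    exact Quot.sound (r := (a.stack b).Adj) h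
  · rintro _ _ ⟨j⟩
    exact Quot.sound (r := (a.stack b).Adj) ⟨j, rfl, rfl⟩
  · rintro (x | x) (y | y) h
    · exact congrArg (fun z => Quot.mk _ (Sum.inl z)) (Quot.sound h)
    · obtain ⟨j, rfl, rfl⟩ := h
      exact Quot.sound (.glue (S := id a) (T := id b) j)
    · exact h.elim
    · exact congrArg (fun z => Quot.mk _ (Sum.inr z)) (Quot.sound h)
  · rintro ⟨x | x⟩ <;> obtain ⟨x⟩ := x <;> rfl
  · rintro ⟨x | x⟩ <;> rfl
  · rintro (x | x) <;> rfl
  · rintro (x | x) <;> rfl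
  · simp [tensor, id, cylinder]
  · simp [tensor, id, cylinder]

theorem interchange {a' b' c' : TLDiagram n} (S : PreSurface a b) (T : PreSurface b c)
    (S' : PreSurface a' b') (T' : PreSurface b' c') :
    Equivalent ((S.comp T).tensor (S'.comp T')) ((S.tensor S').comp (T.tensor T')) := by
  refine Equivalent.of_maps
    (Quot.lift (Sum.elim
      (Quot.lift (Sum.elim (fun x => Quot.mk _ (Sum.inl (Quot.mk _ (Sum.inl x))))
        (fun x => Quot.mk _ (Sum.inr (Quot.mk _ (Sum.inl x))))) ?_)
      (Quot.lift (Sum.elim (fun x => Quot.mk _ (Sum.inl (Quot.mk _ (Sum.inr x))))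
        (fun x => Quot.mk _ (Sum.inr (Quot.mk _ (Sum.inr x))))) ?_)) ?_)
    (Quot.lift (Sum.elim
      (Quot.lift (Sum.elim (fun x => Quot.mk _ (Sum.inl (Quot.mk _ (Sum.inl x))))
        (fun x => Quot.mk _ (Sum.inr (Quot.mk _ (Sum.inl x))))) ?_)
      (Quot.lift (Sum.elim (fun x => Quot.mk _ (Sum.inl (Quot.mk _ (Sum.inr x))))
        (fun x => Quot.mk _ (Sum.inr (Quot.mk _ (Sum.inr x))))) ?_)) ?_)
    ?_ ?_ ?_ ?_ ?_ ?_
  · rintro _ _ ⟨x⟩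
    exact Quot.sound (.glue (S := S.tensor S') (T := T.tensor T') (Sum.inl x))
  · rintro _ _ ⟨x⟩
    exact Quot.sound (.glue (S := S.tensor S') (T := T.tensor T') (Sum.inr x))
  · rintro _ _ ⟨j⟩
    exact congrArg (fun z => Quot.mk _ (Sum.inl z)) (Quot.sound (.glue (S := S) (T := S') j))
  · rintro _ _ ⟨j⟩
    exact Quot.sound (.glue (S := S.comp T) (T := S'.comp T') j)
  · rintro _ _ ⟨j⟩
    have h1 : Quot.mk (CompGlue S T) (Sum.inl (S.src (a.bot j))) =
        Quot.mk (CompGlue S T) (Sum.inr (T.src (b.bot j))) := by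
      rw [S.bot_eq]; exact Quot.sound (.glue _)
    have h2 : Quot.mk (CompGlue S' T') (Sum.inl (S'.src (a'.top j))) =
        Quot.mk (CompGlue S' T') (Sum.inr (T'.src (b'.top j))) := by
      rw [S'.top_eq]; exact Quot.sound (.glue _)
    change Quot.mk _ (Sum.inl (Quot.mk (CompGlue S T) (Sum.inr (T.src (b.bot j))))) =
      Quot.mk _ (Sum.inr (Quot.mk (CompGlue S' T') (Sum.inr (T'.src (b'.top j)))))
    rw [← h1, ← h2]
    exact Quot.sound (.glue (S := S.comp T) (T := S'.comp T') j)
  · rintro _ _ ⟨x | x⟩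
    · exact congrArg (fun z => Quot.mk _ (Sum.inl z)) (Quot.sound (.glue (S := S) (T := T) x))
    · exact congrArg (fun z => Quot.mk _ (Sum.inr z)) (Quot.sound (.glue (S := S') (T := T') x))
  · rintro ⟨x | x⟩ <;> obtain ⟨x | x⟩ := x <;> rfl
  · rintro ⟨x | x⟩ <;> obtain ⟨x | x⟩ := x <;> rfl
  · rintro (x | x) <;> rfl
  · rintro (x | x) <;> rfl
  · simp only [comp, tensor, Finsupp.mapDomain_add, ← Finsupp.mapDomain_comp]
    rw [add_add_add_comm]
    rfl
  · simp only [comp, tensor, Finsupp.mapDomain_add, ← Finsupp.mapDomain_comp]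
    rw [add_add_add_comm]
    rfl

/-- The topological degree `χ(C) - n`, where every dot contributes `-2`. -/
noncomputable def degree (S : PreSurface a b) : ℤ :=
  S.chi.sum (fun _ m => m) - 2 * S.dots.sum (fun _ k => (k : ℤ))

theorem degree_congr {S T : PreSurface a b} : Equivalent S T → S.degree = T.degree := by
  rintro ⟨φ, _, _, h3, h4⟩
  rw [degree, degree, ← h3, ← h4, Finsupp.sum_mapDomain_index, Finsupp.sum_mapDomain_index] <;>
    simp

end PreSurface

/-- Dotted surfaces with corners between two diagrams, up to homeomorphism relative to the
boundary. -/
def Surface {n : ℕ} (a b : TLDiagram n) : Type 1 := _root_.Quotient (PreSurface.setoid a b)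

namespace Surface

variable {n : ℕ} {a b c d : TLDiagram n}

/-- The class of a combinatorial surface. -/
def mk (S : PreSurface a b) : Surface a b := _root_.Quotient.mk _ S

/-- Gluing along a diagram. -/
noncomputable def comp (S : Surface a b) (T : Surface b c) : Surface a c :=
  _root_.Quotient.map₂ PreSurface.comp
    (fun _ _ h _ _ h' => PreSurface.comp_congr h h') S T

/-- Gluing along vertical intervals. -/
noncomputable def tensor (S : Surface a b) (T : Surface c d) :
    Surface (a.stack c) (b.stack d) :=
  _root_.Quotient.map₂ PreSurface.tensor
    (fun _ _ h _ _ h' => PreSurface.tensor_congr h h') S T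

/-- The topological degree of a surface. -/
noncomputable def degree (S : Surface a b) : ℤ :=
  _root_.Quotient.lift PreSurface.degree (fun _ _ h => PreSurface.degree_congr h) S

/-- The surfaces that can be built from elementary cobordisms: isotopies of diagrams, dots,
saddles, births and deaths of circles, and circles merging with or splitting off from a component.
By Morse theory these are all the dotted orientable cobordisms between two diagrams. -/
inductive IsCobordism : ∀ {a b : TLDiagram n}, Surface a b → Prop
  | cylinder {a b : TLDiagram n} (φ : a.Comp ≃ b.Comp)
      (htop : ∀ j, φ (Quot.mk _ (a.top j)) = Quot.mk _ (b.top j))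
      (hbot : ∀ j, φ (Quot.mk _ (a.bot j)) = Quot.mk _ (b.bot j)) :
      IsCobordism (mk (PreSurface.cylinder φ htop hbot))
  | dot (a : TLDiagram n) (p : a.Site) : IsCobordism (mk (PreSurface.dot a p))
  | saddle (i : Fin (n - 1)) : IsCobordism (mk (PreSurface.saddle i))
  | saddle_reverse (i : Fin (n - 1)) : IsCobordism (mk (PreSurface.saddle i).reverse)
  | birth : IsCobordism (mk (PreSurface.birth n))
  | death : IsCobordism (mk (PreSurface.birth n).reverse)
  | merge (a : TLDiagram n) (p : a.Site) : IsCobordism (mk (PreSurface.merge a p))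
  | split (a : TLDiagram n) (p : a.Site) : IsCobordism (mk (PreSurface.merge a p).reverse)
  | comp {a b c : TLDiagram n} {S : Surface a b} {T : Surface b c} :
      IsCobordism S → IsCobordism T → IsCobordism (S.comp T)
  | tensor {a b c d : TLDiagram n} {S : Surface a b} {T : Surface c d} :
      IsCobordism S → IsCobordism T → IsCobordism (S.tensor T)

end Surface

/-- Dotted cobordisms between two diagrams. -/
def Cobordism {n : ℕ} (a b : TLDiagram n) : Type 1 := {S : Surface a b // S.IsCobordism}

namespace Cobordism

variable {n : ℕ} {a b c d : TLDiagram n}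

/-- The identity cobordism. -/
noncomputable def id (a : TLDiagram n) : Cobordism a a :=
  ⟨Surface.mk (PreSurface.id a), .cylinder _ _ _⟩

/-- Composition of cobordisms, `S` first. -/
noncomputable def comp (S : Cobordism a b) (T : Cobordism b c) : Cobordism a c :=
  ⟨S.1.comp T.1, .comp S.2 T.2⟩

/-- The product `S ⊗ T`. -/
noncomputable def tensor (S : Cobordism a b) (T : Cobordism c d) :
    Cobordism (a.stack c) (b.stack d) :=
  ⟨S.1.tensor T.1, .tensor S.2 T.2⟩

theorem id_comp (S : Cobordism a b) : (id a).comp S = S := by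
  obtain ⟨⟨S⟩, h⟩ := S
  exact Subtype.ext (_root_.Quotient.sound (PreSurface.id_comp S))

theorem comp_id (S : Cobordism a b) : S.comp (id b) = S := by
  obtain ⟨⟨S⟩, h⟩ := S
  exact Subtype.ext (_root_.Quotient.sound (PreSurface.comp_id S))

theorem comp_assoc (S : Cobordism a b) (T : Cobordism b c) (U : Cobordism c d) :
    (S.comp T).comp U = S.comp (T.comp U) := by
  obtain ⟨⟨S⟩, _⟩ := S
  obtain ⟨⟨T⟩, _⟩ := T
  obtain ⟨⟨U⟩, _⟩ := U
  exact Subtype.ext (_root_.Quotient.sound (PreSurface.comp_assoc S T U))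

theorem id_tensor_id (a b : TLDiagram n) : (id a).tensor (id b) = id (a.stack b) :=
  Subtype.ext (_root_.Quotient.sound (PreSurface.id_tensor_id a b))

theorem interchange {a' b' c' : TLDiagram n} (S : Cobordism a b) (T : Cobordism b c)
    (S' : Cobordism a' b') (T' : Cobordism b' c') :
    (S.comp T).tensor (S'.comp T') = (S.tensor S').comp (T.tensor T') := by
  obtain ⟨⟨S⟩, _⟩ := S
  obtain ⟨⟨T⟩, _⟩ := T
  obtain ⟨⟨S'⟩, _⟩ := S'
  obtain ⟨⟨T'⟩, _⟩ := T'
  exact Subtype.ext (_root_.Quotient.sound (PreSurface.interchange S T S' T'))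

/-- The identity of `a` with a dot on the component of `p`. -/
noncomputable def dot (a : TLDiagram n) (p : a.Site) : Cobordism a a :=
  ⟨Surface.mk (PreSurface.dot a p), .dot a p⟩

/-- The saddle `1 → e i`. -/
noncomputable def saddle (i : Fin (n - 1)) : Cobordism .one (.e i) :=
  ⟨Surface.mk (PreSurface.saddle i), .saddle i⟩

/-- The saddle `e i → 1`. -/
noncomputable def saddle' (i : Fin (n - 1)) : Cobordism (.e i) .one :=
  ⟨Surface.mk (PreSurface.saddle i).reverse, .saddle_reverse i⟩

/-- The birth of a circle. -/
noncomputable def birth (n : ℕ) : Cobordism (.one : TLDiagram n) .circle :=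
  ⟨Surface.mk (PreSurface.birth n), .birth⟩

/-- The death of a circle. -/
noncomputable def death (n : ℕ) : Cobordism (.circle : TLDiagram n) .one :=
  ⟨Surface.mk (PreSurface.birth n).reverse, .death⟩

/-- The identity of the diagram `1` with a circle, with a dot on the cylinder over the circle. -/
noncomputable def dotCircle (n : ℕ) : Cobordism (.circle : TLDiagram n) .circle :=
  dot .circle (Sum.inr () : Fin n ⊕ Unit)

/-- Stacking the identity diagram below `a` does not change the components. -/
def stackOne (a : TLDiagram n) : (a.stack .one).Comp ≃ a.Comp where
  toFun := Quot.lift (Sum.elim (Quot.mk _) (fun j => Quot.mk _ (a.bot j))) (by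
    rintro (x | x) (y | y) h
    · exact Quot.sound h
    · obtain ⟨j, rfl, rfl⟩ := h
      rfl
    · exact h.elim
    · exact h.elim)
  invFun := Quot.lift (fun x => Quot.mk _ (Sum.inl x)) (fun x y h =>
    Quot.sound (r := (a.stack .one).Adj) h)
  left_inv := by
    rintro ⟨x | j⟩
    · rfl
    · exact Quot.sound (r := (a.stack .one).Adj) ⟨j, rfl, rfl⟩
  right_inv := by
    rintro ⟨x⟩
    rfl

/-- Stacking the identity diagram above `a` does not change the components. -/
def oneStack (a : TLDiagram n) : ((TLDiagram.one).stack a).Comp ≃ a.Comp where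
  toFun := Quot.lift (Sum.elim (fun j => Quot.mk _ (a.top j)) (Quot.mk _)) (by
    rintro (x | x) (y | y) h
    · exact h.elim
    · obtain ⟨j, rfl, rfl⟩ := h
      rfl
    · exact h.elim
    · exact Quot.sound h)
  invFun := Quot.lift (fun x => Quot.mk _ (Sum.inr x)) (fun x y h =>
    Quot.sound (r := ((TLDiagram.one).stack a).Adj) h)
  left_inv := by
    rintro ⟨j | x⟩
    · have h : ((TLDiagram.one).stack a).Adj (Sum.inl j) (Sum.inr (a.top j)) := ⟨j, rfl, rfl⟩
      exact (Quot.sound h).symm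
    · rfl
  right_inv := by
    rintro ⟨x⟩
    rfl

/-- The saddle `a = a ⊗ 1 → a ⊗ e i`. -/
noncomputable def saddleBelow (a : TLDiagram n) (i : Fin (n - 1)) : Cobordism a (a.stack (.e i)) :=
  comp ⟨Surface.mk (PreSurface.cylinder (stackOne a).symm
      (fun _ => (stackOne a).symm_apply_eq.2 rfl) (fun _ => (stackOne a).symm_apply_eq.2 rfl)),
    .cylinder _ _ _⟩ ((id a).tensor (saddle i))

/-- The saddle `a = 1 ⊗ a → e i ⊗ a`. -/
noncomputable def saddleAbove (i : Fin (n - 1)) (a : TLDiagram n) :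
    Cobordism a ((TLDiagram.e i).stack a) :=
  comp ⟨Surface.mk (PreSurface.cylinder (oneStack a).symm
      (fun _ => (oneStack a).symm_apply_eq.2 rfl) (fun _ => (oneStack a).symm_apply_eq.2 rfl)),
    .cylinder _ _ _⟩ ((saddle i).tensor (id a))

/-- The saddle `a ⊗ e i → a ⊗ 1 = a`. -/
noncomputable def saddleBelow' (a : TLDiagram n) (i : Fin (n - 1)) :
    Cobordism (a.stack (.e i)) a :=
  comp ((id a).tensor (saddle' i)) ⟨Surface.mk (PreSurface.cylinder (stackOne a)
    (fun _ => rfl) (fun _ => rfl)), .cylinder _ _ _⟩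

/-- The saddle `e i ⊗ a → 1 ⊗ a = a`. -/
noncomputable def saddleAbove' (i : Fin (n - 1)) (a : TLDiagram n) :
    Cobordism ((TLDiagram.e i).stack a) a :=
  comp ((saddle' i).tensor (id a)) ⟨Surface.mk (PreSurface.cylinder (oneStack a)
    (fun _ => rfl) (fun _ => rfl)), .cylinder _ _ _⟩

end Cobordism

/-! ## The cobordism category before imposing relations -/

/-- A formally `q`-graded Temperley-Lieb diagram `q ^ shift • diagram`. -/
structure GradedDiagram (n : ℕ) where
  shift : ℤ
  diagram : TLDiagram n

/-- The category of graded diagrams and dotted cobordisms, of arbitrary degree, between them. -/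
noncomputable instance GradedDiagram.category (n : ℕ) : Category.{1} (GradedDiagram n) where
  Hom A B := Cobordism A.diagram B.diagram
  id A := Cobordism.id A.diagram
  comp S T := S.comp T
  id_comp := Cobordism.id_comp
  comp_id := Cobordism.comp_id
  assoc := Cobordism.comp_assoc

namespace GradedDiagram

variable {n : ℕ}

/-- The graded diagram `A ⊗ B`, given by vertical stacking. -/
def stack (A B : GradedDiagram n) : GradedDiagram n := ⟨A.shift + B.shift, A.diagram.stack B.diagram⟩

/-- The functor `A ⊗ -`. -/
noncomputable def tensorLeft (A : GradedDiagram n) : GradedDiagram n ⥤ GradedDiagram n where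
  obj B := A.stack B
  map S := (Cobordism.id A.diagram).tensor S
  map_id B := Cobordism.id_tensor_id A.diagram B.diagram
  map_comp S T := by
    refine Eq.trans ?_ (Cobordism.interchange (Cobordism.id A.diagram) (Cobordism.id A.diagram) S T)
    rw [Cobordism.id_comp]
    rfl

/-- The functor `- ⊗ A`. -/
noncomputable def tensorRight (A : GradedDiagram n) : GradedDiagram n ⥤ GradedDiagram n where
  obj B := B.stack A
  map S := Cobordism.tensor S (Cobordism.id A.diagram)
  map_id B := Cobordism.id_tensor_id B.diagram A.diagram
  map_comp S T := by
    refine Eq.trans ?_ (Cobordism.interchange S T (Cobordism.id A.diagram) (Cobordism.id A.diagram))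
    rw [Cobordism.id_comp]
    rfl

end GradedDiagram

/-! ## The category `Cob(n)` -/

/-- The base ring `ℤ[α]`. -/
abbrev BaseRing : Type := Polynomial ℤ

/-- The parameter `α`. -/
noncomputable abbrev alpha : BaseRing := Polynomial.X

/-- The category with the same objects, and with formal `ℤ[α]`-linear combinations of cobordisms
as morphisms. -/
abbrev PreCob (n : ℕ) : Type := Free BaseRing (GradedDiagram n)

namespace PreCob

variable {n : ℕ}

/-- Cobordisms as linear combinations of cobordisms. -/
noncomputable abbrev incl (n : ℕ) : GradedDiagram n ⥤ PreCob n :=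
  Free.embedding BaseRing (GradedDiagram n)

/-- A single cobordism, with coefficient `1`, as a morphism `q ^ s • a → q ^ t • b`. -/
noncomputable def single (s t : ℤ) {a b : TLDiagram n} (S : Cobordism a b) :
    (incl n).obj ⟨s, a⟩ ⟶ (incl n).obj ⟨t, b⟩ :=
  (incl n).map (X := ⟨s, a⟩) (Y := ⟨t, b⟩) S

/-- The functor `A ⊗ -`, extended linearly. -/
noncomputable def tensorLeft (A : GradedDiagram n) : PreCob n ⥤ PreCob n :=
  Free.lift BaseRing (A.tensorLeft ⋙ incl n)

/-- The functor `- ⊗ A`, extended linearly. -/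
noncomputable def tensorRight (A : GradedDiagram n) : PreCob n ⥤ PreCob n :=
  Free.lift BaseRing (A.tensorRight ⋙ incl n)

open Cobordism in
/-- The smallest congruence, compatible with linear combinations and with gluing, for which
* a sphere with `0`, `1`, `2`, `3` dots equals `0`, `1`, `0`, `α` respectively;
* the cylinder over a circle is the sum of the two pairs of discs with one dot in total. -/
inductive Rel (n : ℕ) : HomRel (PreCob n)
  | sphere (s : ℤ) :
      Rel n (single s s ((birth n).comp (death n))) 0
  | sphere_dot (s : ℤ) :
      Rel n (single s s (((birth n).comp (dotCircle n)).comp (death n))) (𝟙 _)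
  | sphere_dot_dot (s : ℤ) :
      Rel n (single s s ((((birth n).comp (dotCircle n)).comp (dotCircle n)).comp (death n))) 0
  | sphere_dot_dot_dot (s : ℤ) :
      Rel n (single s s (((((birth n).comp (dotCircle n)).comp (dotCircle n)).comp
        (dotCircle n)).comp (death n))) (alpha • 𝟙 _)
  | neck (s : ℤ) :
      Rel n (single s s (Cobordism.id .circle))
        (single s s ((dotCircle n).comp ((death n).comp (birth n))) +
          single s s (((death n).comp (birth n)).comp (dotCircle n)))
  | refl {A B : PreCob n} (f : A ⟶ B) : Rel n f f
  | symm {A B : PreCob n} {f g : A ⟶ B} : Rel n f g → Rel n g f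
  | trans {A B : PreCob n} {f g h : A ⟶ B} : Rel n f g → Rel n g h → Rel n f h
  | add {A B : PreCob n} {f f' g g' : A ⟶ B} : Rel n f f' → Rel n g g' → Rel n (f + g) (f' + g')
  | smul (r : BaseRing) {A B : PreCob n} {f g : A ⟶ B} : Rel n f g → Rel n (r • f) (r • g)
  | comp_left {A B C : PreCob n} (f : A ⟶ B) {g g' : B ⟶ C} : Rel n g g' → Rel n (f ≫ g) (f ≫ g')
  | comp_right {A B C : PreCob n} {f f' : A ⟶ B} (g : B ⟶ C) : Rel n f f' → Rel n (f ≫ g) (f' ≫ g)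
  | tensorLeft (Z : GradedDiagram n) {A B : PreCob n} {f g : A ⟶ B} :
      Rel n f g → Rel n ((tensorLeft Z).map f) ((tensorLeft Z).map g)
  | tensorRight (Z : GradedDiagram n) {A B : PreCob n} {f g : A ⟶ B} :
      Rel n f g → Rel n ((tensorRight Z).map f) ((tensorRight Z).map g)

instance (n : ℕ) : Congruence (Rel n) where
  equivalence := ⟨Rel.refl, Rel.symm, Rel.trans⟩
  comp_left f _ _ h := Rel.comp_left f h
  comp_right g h := Rel.comp_right g h

end PreCob

/-- The category `Cob(n)`: graded Temperley-Lieb diagrams with `2 n` boundary points, and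
`ℤ[α]`-linear combinations of dotted cobordisms modulo the local relations. -/
def Cob (n : ℕ) : Type := CategoryTheory.Quotient (PreCob.Rel n)

namespace Cob

variable {n : ℕ}

noncomputable instance category (n : ℕ) : Category.{1} (Cob n) :=
  inferInstanceAs (Category (CategoryTheory.Quotient (PreCob.Rel n)))

noncomputable instance preadditive (n : ℕ) : Preadditive (Cob n) :=
  CategoryTheory.Quotient.preadditive (PreCob.Rel n) (fun _ _ _ _ _ _ h h' => PreCob.Rel.add h h')

/-- The quotient functor. -/
noncomputable def quotient (n : ℕ) : PreCob n ⥤ Cob n := CategoryTheory.Quotient.functor (PreCob.Rel n)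

instance (n : ℕ) : (quotient n).Additive := ⟨rfl⟩

noncomputable instance linear (n : ℕ) : Linear BaseRing (Cob n) :=
  letI : Preadditive (CategoryTheory.Quotient (PreCob.Rel n)) := preadditive n
  haveI : (CategoryTheory.Quotient.functor (PreCob.Rel n)).Additive := ⟨rfl⟩
  CategoryTheory.Quotient.linear BaseRing (PreCob.Rel n) (fun r _ _ _ _ h => PreCob.Rel.smul r h)

/-- The object `q ^ s • a` of `Cob(n)`. -/
noncomputable abbrev of (s : ℤ) (a : TLDiagram n) : Cob n :=
  (quotient n).obj ((PreCob.incl n).obj ⟨s, a⟩)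

/-- The graded diagram underlying an object of `Cob(n)`. -/
def graded (A : Cob n) : GradedDiagram n :=
  CategoryTheory.Quotient.as (C := PreCob n) (r := PreCob.Rel n) A

/-- The `q`-grading of an object. -/
def shift (A : Cob n) : ℤ := A.graded.shift

/-- The diagram underlying an object of `Cob(n)`. -/
def diagram (A : Cob n) : TLDiagram n := A.graded.diagram

/-- The morphism `q ^ s • a → q ^ t • b` given by a single cobordism. -/
noncomputable def single (s t : ℤ) {a b : TLDiagram n} (S : Cobordism a b) : of s a ⟶ of t b :=
  (quotient n).map (PreCob.single s t S)

/-- The functor `A ⊗ -` on `Cob(n)`. -/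
noncomputable def tensorLeft (A : GradedDiagram n) : Cob n ⥤ Cob n :=
  CategoryTheory.Quotient.lift (PreCob.Rel n) (PreCob.tensorLeft A ⋙ quotient n)
    (fun _ _ _ _ h => CategoryTheory.Quotient.sound (PreCob.Rel n) (.tensorLeft A h))

/-- The functor `- ⊗ A` on `Cob(n)`. -/
noncomputable def tensorRight (A : GradedDiagram n) : Cob n ⥤ Cob n :=
  CategoryTheory.Quotient.lift (PreCob.Rel n) (PreCob.tensorRight A ⋙ quotient n)
    (fun _ _ _ _ h => CategoryTheory.Quotient.sound (PreCob.Rel n) (.tensorRight A h))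

instance (A : GradedDiagram n) : (PreCob.tensorLeft A).Additive :=
  inferInstanceAs (Free.lift _ _).Additive

instance (A : GradedDiagram n) : (PreCob.tensorRight A).Additive :=
  inferInstanceAs (Free.lift _ _).Additive

instance (A : GradedDiagram n) : (tensorLeft A).Additive where
  map_add := by
    rintro X Y ⟨f⟩ ⟨g⟩
    exact (PreCob.tensorLeft A ⋙ quotient n).map_add (f := f) (g := g)

instance (A : GradedDiagram n) : (tensorRight A).Additive where
  map_add := by
    rintro X Y ⟨f⟩ ⟨g⟩
    exact (PreCob.tensorRight A ⋙ quotient n).map_add (f := f) (g := g)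

/-- Homogeneous morphisms of degree `d`: sums of terms `± α ^ k • C` with `C` a cobordism
`q ^ i A → q ^ j B` with `deg_t C + (j - i) - 4 k = d`. Here `α` has degree `-4`, because it is the
value of a sphere with three dots. -/
def IsHomogeneous (d : ℤ) {A B : Cob n} (f : A ⟶ B) : Prop :=
  f ∈ AddSubgroup.closure {g : A ⟶ B |
    ∃ (S : Cobordism A.diagram B.diagram) (k : ℕ),
      S.1.degree + (B.shift - A.shift) - 4 * (k : ℤ) = d ∧
      g = (alpha ^ k • single A.shift B.shift S : A ⟶ B)}

end Cob

/-! ## Complexes and universal projectors -/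

/-- The additive closure of `Cob(n)`: finite direct sums of objects, and matrices. -/
abbrev MatCob (n : ℕ) : Type 1 := Mat_ (Cob n)

/-- Cochain complexes (the differential raises the homological degree by one) in `Mat(Cob(n))`. -/
abbrev CobComplex (n : ℕ) : Type 1 := CochainComplex (MatCob n) ℤ

namespace MatCob

variable {n : ℕ}

/-- A matrix all of whose entries have degree zero. -/
def IsDegreeZero {A B : MatCob n} (f : A ⟶ B) : Prop :=
  ∀ i j, Cob.IsHomogeneous 0 (f i j)

/-- A single graded diagram as an object of `Mat(Cob(n))`. -/
noncomputable def of (s : ℤ) (a : TLDiagram n) : MatCob n := (Mat_.embedding (Cob n)).obj (Cob.of s a)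

end MatCob

instance (n : ℕ) : HasZeroObject (MatCob n) := hasZeroObject_of_hasFiniteBiproducts _

instance (n : ℕ) : HasBinaryBiproducts (MatCob n) := hasBinaryBiproducts_of_finite_biproducts _

instance {C D : Type} [Category.{1} C] [Category.{1} D] [Preadditive C] [Preadditive D]
    (F : C ⥤ D) [F.Additive] : F.mapMat_.Additive where
  map_add {_ _ _ _} := by
    ext i j
    exact F.map_add

namespace CobComplex

open scoped ZeroObject

variable {n : ℕ}

/-- The complex `a ⊗ P`, for a diagram `a` regarded as a complex in homological degree zero. -/
noncomputable def tensorLeft (a : TLDiagram n) (P : CobComplex n) : CobComplex n :=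
  ((Cob.tensorLeft ⟨0, a⟩).mapMat_.mapHomologicalComplex _).obj P

/-- The complex `P ⊗ a`, for a diagram `a` regarded as a complex in homological degree zero. -/
noncomputable def tensorRight (P : CobComplex n) (a : TLDiagram n) : CobComplex n :=
  ((Cob.tensorRight ⟨0, a⟩).mapMat_.mapHomologicalComplex _).obj P

/-- `P ≃ 0`, by means of homotopies of degree zero. -/
def IsContractible (P : CobComplex n) : Prop :=
  ∃ e : HomotopyEquiv P 0, ∀ i j, MatCob.IsDegreeZero (e.homotopyHomInvId.hom i j)

/-- Universal projectors in `Kom(n)`. -/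
structure IsUniversalProjector (P : CobComplex n) : Prop where
  /-- The complex vanishes in negative homological degrees. -/
  isZero : ∀ k : ℤ, k < 0 → IsZero (P.X k)
  /-- The `q`-degrees of all summands in positive homological degree are nonnegative. -/
  shift_nonneg : ∀ k : ℤ, 0 < k → ∀ i : (P.X k).ι, 0 ≤ ((P.X k).X i).shift
  /-- The differential is a matrix of degree zero maps. -/
  degree_zero : ∀ k : ℤ, MatCob.IsDegreeZero (P.d k (k + 1))
  /-- The identity diagram is the term in homological degree zero. -/
  one : ∃ φ : P.X 0 ≅ MatCob.of 0 .one,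
    MatCob.IsDegreeZero φ.hom ∧ MatCob.IsDegreeZero φ.inv
  /-- The identity diagram does not appear in positive homological degree. -/
  not_one : ∀ k : ℤ, 0 < k → ∀ D : MatCob n, IsEmpty (P.X k ≅ MatCob.of 0 .one ⊞ D)
  /-- The complex is contractible under turnbacks from below. -/
  tensor_e : ∀ i : Fin (n - 1), IsContractible (P.tensorRight (.e i))
  /-- The complex is contractible under turnbacks from above. -/
  e_tensor : ∀ i : Fin (n - 1), IsContractible (P.tensorLeft (.e i))

end CobComplex

/-! ## The third projector -/

namespace ThirdProjector

open Cobordism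

/-- The first generator of the Temperley-Lieb algebra on three strands. -/
abbrev e₁ : TLDiagram 3 := .e 0

/-- The second generator. -/
abbrev e₂ : TLDiagram 3 := .e 1

/-- The two diagrams in homological degree `m + 1`: alternately
`(e₁, e₂)`, `(e₁e₂, e₂e₁)`, `(e₁e₂, e₂e₁)`, `(e₁, e₂)`, with period four. -/
def diagram : ℕ → Fin 2 → TLDiagram 3
  | 0, 0 => e₁
  | 0, 1 => e₂
  | 1, 0 => e₁.stack e₂
  | 1, 1 => e₂.stack e₁
  | 2, 0 => e₁.stack e₂
  | 2, 1 => e₂.stack e₁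
  | 3, 0 => e₁
  | 3, 1 => e₂
  | m + 4, s => diagram m s

/-- The `q`-degree of the two diagrams in homological degree `m + 1`: `1, 2, 4, 5, 7, 8, 10, …`. -/
def shift : ℕ → ℤ
  | 0 => 1
  | 1 => 2
  | 2 => 4
  | 3 => 5
  | m + 4 => shift m + 6

/-- The complex in nonnegative homological degrees:
`1`, `q (e₁ ⊕ e₂)`, `q² (e₁e₂ ⊕ e₂e₁)`, `q⁴ (e₁e₂ ⊕ e₂e₁)`, `q⁵ (e₁ ⊕ e₂)`, `q⁷ (e₁ ⊕ e₂)`, … -/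
noncomputable def term : ℕ → MatCob 3
  | 0 => MatCob.of 0 .one
  | m + 1 => ⟨Fin 2, fun s => Cob.of (shift m) (diagram m s)⟩

/-- The saddle turning `1` into `e₁`, respectively `e₂`: the entries of the matrix `A`. -/
noncomputable def matrixA : MatCob.of 0 .one ⟶ term 1 :=
  fun _ (t : Fin 2) => match t with
    | 0 => Cob.single 0 1 (saddle 0)
    | 1 => Cob.single 0 1 (saddle 1)

/-! In the following matrices the first index `s` is the summand of the source, and the second
index `t` is the summand of the target. The gradings `i` of the source and `j` of the target are
arbitrary, because a cobordism does not depend on them. -/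

/-- The matrix `B` of saddles `e₁ ⊕ e₂ → e₁e₂ ⊕ e₂e₁`. -/
noncomputable def matrixB (i j : ℤ) :
    (s t : Fin 2) → (Cob.of i (diagram 0 s) ⟶ Cob.of j (diagram 1 t))
  | 0, 0 => Cob.single i j (saddleBelow e₁ 1)
  | 1, 0 => -Cob.single i j (saddleAbove 0 e₂)
  | 0, 1 => -Cob.single i j (saddleAbove 1 e₁)
  | 1, 1 => Cob.single i j (saddleBelow e₂ 0)

/-- The matrix `C : e₁e₂ ⊕ e₂e₁ → e₁e₂ ⊕ e₂e₁`. On the diagonal it is the sum of a dot on the upper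
turnback and a dot on the lower turnback, off the diagonal it is a composition of two saddles. -/
noncomputable def matrixC (i j : ℤ) :
    (s t : Fin 2) → (Cob.of i (diagram 1 s) ⟶ Cob.of j (diagram 2 t))
  | 0, 0 => Cob.single i j (dot (e₁.stack e₂) ((e₁.stack e₂).top 0)) +
      Cob.single i j (dot (e₁.stack e₂) ((e₁.stack e₂).bot 2))
  | 1, 0 => Cob.single i j ((saddleAbove' 1 e₁).comp (saddleBelow e₁ 1))
  | 0, 1 => Cob.single i j ((saddleAbove' 0 e₂).comp (saddleBelow e₂ 0))
  | 1, 1 => Cob.single i j (dot (e₂.stack e₁) ((e₂.stack e₁).top 2)) +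
      Cob.single i j (dot (e₂.stack e₁) ((e₂.stack e₁).bot 0))

/-- The matrix `D` of saddles `e₁e₂ ⊕ e₂e₁ → e₁ ⊕ e₂`. -/
noncomputable def matrixD (i j : ℤ) :
    (s t : Fin 2) → (Cob.of i (diagram 2 s) ⟶ Cob.of j (diagram 3 t))
  | 0, 0 => Cob.single i j (saddleBelow' e₁ 1)
  | 1, 0 => -Cob.single i j (saddleAbove' 1 e₁)
  | 0, 1 => -Cob.single i j (saddleAbove' 0 e₂)
  | 1, 1 => Cob.single i j (saddleBelow' e₂ 0)

/-- The matrix `E : e₁ ⊕ e₂ → e₁ ⊕ e₂`. On the diagonal it is the sum of a dot on the upper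
turnback and a dot on the lower turnback, off the diagonal it is a composition of two saddles. -/
noncomputable def matrixE (i j : ℤ) :
    (s t : Fin 2) → (Cob.of i (diagram 3 s) ⟶ Cob.of j (diagram 4 t))
  | 0, 0 => Cob.single i j (dot e₁ (e₁.top 0)) + Cob.single i j (dot e₁ (e₁.bot 0))
  | 1, 0 => Cob.single i j ((saddle' 1).comp (saddle 0))
  | 0, 1 => Cob.single i j ((saddle' 0).comp (saddle 1))
  | 1, 1 => Cob.single i j (dot e₂ (e₂.top 2)) + Cob.single i j (dot e₂ (e₂.bot 2))

/-- The matrix of the differential from homological degree `m + 1` to `m + 2`. -/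
noncomputable def matrix : (m : ℕ) → (i j : ℤ) →
    (s t : Fin 2) → (Cob.of i (diagram m s) ⟶ Cob.of j (diagram (m + 1) t))
  | 0 => matrixB
  | 1 => matrixC
  | 2 => matrixD
  | 3 => matrixE
  | m + 4 => matrix m

/-- The terms of the third projector in all homological degrees. -/
noncomputable def X : ℤ → MatCob 3
  | .ofNat k => term k
  | .negSucc _ => ⟨Empty, Empty.elim⟩

/-- The differential of the third projector. -/
noncomputable def d : (k : ℤ) → (X k ⟶ X (k + 1))
  | .ofNat 0 => matrixA
  | .ofNat (m + 1) => (fun s t => matrix m (shift m) (shift (m + 1)) s t : term (m + 1) ⟶ term (m + 2))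
  | .negSucc _ => 0

end ThirdProjector

/-- The third projector, a complex as soon as its differential squares to zero. -/
noncomputable def thirdProjector
    (h : ∀ k : ℤ, ThirdProjector.d k ≫ ThirdProjector.d (k + 1) = 0) : CobComplex 3 :=
  CochainComplex.of ThirdProjector.X ThirdProjector.d h

/-! The statement splits into the relations between consecutive matrices, the contractions, and the
absence of `1` in positive degree. A separate device decides equality of surfaces.

Relations. Every product of matrix entries is a surface built from a few saddles and dots. Some
products agree because saddles in different places commute. In the others, one surface contains a
tube joining two sheets, and cutting its neck gives the sum of the two surfaces with a dot on one of
the sheets. This is why `C` and `E` carry `u + l` on the diagonal. The outcome is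
`matrix_comp_matrix` and `d_comp_d`.

Contractions. Stacked on `e_i`, with `j ≠ i`, the diagrams `1`, `e_i`, `e_j`, `e_ie_j`, `e_je_i`
become, in the case of `e_i` on top, `E = e_i`, `EE = E` with a circle, `F = e_ie_j`, `FF = F` with
a circle, and `G = e_ie_je_i`, which is isotopic to `E`. A circle amounts to two shifted copies of
the rest of the diagram. After this replacement the copies of `E` and of `F` in neighbouring degrees
cancel in pairs. The contraction that realises the cancellation is written with births, deaths and
saddles. Its decisive entries reduce to the neck relation `x ≫ δ ≫ β + δ ≫ β ≫ x = 𝟙`, where `x` is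
a dot on the circle and `δ`, `β` are its death and birth, while the dots elsewhere cancel. The same
relations hold for both `i` and on both sides. The computation is therefore done once in
`TurnbackCalculus`, and `calculusL` and `calculusR` supply the relations. The differential has
period four, and `fifth₁₁` shows that the homotopy closes up after one period. The abstract
calculation thus gives a contraction of the whole complex (`Contraction.homotopy_spec`).

No copy of `1`. If `1` were a summand of a term of positive degree, its identity would be a sum of
maps factoring through diagrams whose upper boundary has a turnback. A function on morphisms
separates the two. Put `α = 1` and reduce to `ZMod 17`. The algebra of the circle becomes the
semisimple algebra spanned by the two eigenlines of the dot, with eigenvalues `1` and `-1`. A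
surface is then evaluated by summing, over all labellings of its components by these two
eigenvalues, a product of local weights. This sum is compatible with both gluings and respects the
local relations (`PreCob.Rel.amplitude_eq`). With alternating labels on the three strands it
vanishes on everything factoring through a turnback, but equals one on the identity (`isEmpty_iso`).

Equality of surfaces. A surface all of whose components meet the boundary is determined by the
partition of the boundary sites into components together with the degree and the number of dots of
each component. `SurfaceData` stores this as lists of numbers, the tables of composites are computed
from those of the elementary pieces, and `eq_of_check` turns each equality of surfaces into a finite
computation. The gradings are removed beforehand by `matrix_eq_regrade`. -/

/-! ## Deciding equality of surfaces -/

/-- Gives the classes of the two ends of an edge the same label. -/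
def unite (L : List ℕ) (e : ℕ × ℕ) : List ℕ :=
  L.map fun c => if c = L.getD e.2 0 then L.getD e.1 0 else c

/-- Labels of the connected components of the graph with vertices `0, …, N - 1` and edges `E`. -/
def classes (N : ℕ) (E : List (ℕ × ℕ)) : List ℕ := E.foldl unite (List.range N)

theorem length_unite (L : List ℕ) (e : ℕ × ℕ) : (unite L e).length = L.length := by
  simp [unite]

theorem getD_unite (L : List ℕ) (e : ℕ × ℕ) {i : ℕ} (hi : i < L.length) :
    (unite L e).getD i 0 =
      if L.getD i 0 = L.getD e.2 0 then L.getD e.1 0 else L.getD i 0 := by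
  have h : i < (unite L e).length := by rwa [length_unite]
  rw [List.getD_eq_getElem _ _ h, List.getD_eq_getElem _ _ hi]
  exact List.getElem_map _

theorem length_foldl_unite (E : List (ℕ × ℕ)) (L : List ℕ) :
    (E.foldl unite L).length = L.length := by
  induction E generalizing L with
  | nil => rfl
  | cons e E ih => simp [ih, length_unite]

/-- Each step applies one and the same function to all labels, so labels that have become equal stay
equal. -/
theorem foldl_unite_congr (E : List (ℕ × ℕ)) (L : List ℕ) {i j : ℕ} (hi : i < L.length)
    (hj : j < L.length) (h : L.getD i 0 = L.getD j 0) :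
    (E.foldl unite L).getD i 0 = (E.foldl unite L).getD j 0 := by
  induction E generalizing L with
  | nil => exact h
  | cons e E ih =>
    refine ih (unite L e) (by rwa [length_unite]) (by rwa [length_unite]) ?_
    rw [getD_unite _ _ hi, getD_unite _ _ hj, h]

theorem foldl_unite_sound (E : List (ℕ × ℕ)) (L : List ℕ) {p : ℕ × ℕ} (hp : p ∈ E)
    (h1 : p.1 < L.length) (h2 : p.2 < L.length) :
    (E.foldl unite L).getD p.1 0 = (E.foldl unite L).getD p.2 0 := by
  induction E generalizing L with
  | nil => simp at hp
  | cons e E ih =>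
    rcases List.mem_cons.1 hp with rfl | hp
    · refine foldl_unite_congr E (unite L p) (by rwa [length_unite]) (by rwa [length_unite]) ?_
      rw [getD_unite _ _ h1, getD_unite _ _ h2]
      simp
    · exact ih (unite L e) hp (by rwa [length_unite]) (by rwa [length_unite])

/-- Invariant of the algorithm: vertices with equal labels have equal values under any `g` that is
constant along edges. With the quotient map as `g`, no two classes are ever merged wrongly. -/
theorem foldl_unite_complete {α : Type*} (g : ℕ → α) (E : List (ℕ × ℕ)) (L : List ℕ)
    (hE : ∀ p ∈ E, g p.1 = g p.2 ∧ p.1 < L.length ∧ p.2 < L.length)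
    (hL : ∀ i j, i < L.length → j < L.length → L.getD i 0 = L.getD j 0 → g i = g j) {i j : ℕ}
    (hi : i < L.length) (hj : j < L.length)
    (h : (E.foldl unite L).getD i 0 = (E.foldl unite L).getD j 0) : g i = g j := by
  induction E generalizing L with
  | nil => exact hL i j hi hj h
  | cons e E ih =>
    have he := hE e (by simp)
    refine ih (unite L e) ?_ ?_ (by rwa [length_unite]) (by rwa [length_unite]) h
    · intro p hp
      rw [length_unite]
      exact hE p (by simp [hp])
    · intro i j hi hj
      rw [length_unite] at hi hj
      rw [getD_unite _ _ hi, getD_unite _ _ hj]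
      split_ifs with h1 h2 h2
      · exact fun _ => (hL _ _ hi he.2.2 h1).trans (hL _ _ hj he.2.2 h2).symm
      · intro h
        exact (hL _ _ hi he.2.2 h1).trans (he.1.symm.trans (hL _ _ he.2.1 hj h))
      · intro h
        exact (hL _ _ hi he.2.1 h).trans (he.1.trans (hL _ _ hj he.2.2 h2).symm)
      · exact hL i j hi hj

theorem length_classes (N : ℕ) (E : List (ℕ × ℕ)) : (classes N E).length = N := by
  simp [classes, length_foldl_unite]

theorem classes_lt (N : ℕ) (E : List (ℕ × ℕ)) (hE : ∀ p ∈ E, p.1 < N ∧ p.2 < N) {i : ℕ}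
    (hi : i < N) : (classes N E).getD i 0 < N := by
  suffices H : ∀ L : List ℕ, L.length = N → (∀ i < N, L.getD i 0 < N) →
      ∀ i < N, (E.foldl unite L).getD i 0 < N by
    refine H _ (by simp) (fun i hi => ?_) i hi
    simp [List.getD, hi]
  induction E with
  | nil => exact fun L _ h => h
  | cons e E ih =>
    intro L hL h
    refine ih (fun p hp => hE p (by simp [hp])) _ (by rwa [length_unite]) fun i hi => ?_
    rw [getD_unite _ _ (by omega)]
    have := hE e (by simp)
    split_ifs
    · exact h _ this.1
    · exact h _ hi

/-- The labels computed by `classes` describe the quotient by the relation generated by the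
edges. -/
theorem classes_eq_iff {X : Type*} (R : X → X → Prop) (ψ : X → ℕ) (hψ : Function.Injective ψ)
    (N : ℕ) (hN : ∀ x, ψ x < N) (E : List (ℕ × ℕ)) (h1 : ∀ x y, R x y → (ψ x, ψ y) ∈ E)
    (h2 : ∀ p ∈ E, ∃ x y, R x y ∧ ψ x = p.1 ∧ ψ y = p.2) (x y : X) :
    (classes N E).getD (ψ x) 0 = (classes N E).getD (ψ y) 0 ↔ Quot.mk R x = Quot.mk R y := by
  classical
  constructor
  · intro h
    -- The quotient map transported along `ψ` to the numbers, with `none` off the image.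
    let g : ℕ → Option (Quot R) := fun k =>
      if hk : ∃ z, ψ z = k then some (Quot.mk R hk.choose) else none
    have hg (z : X) : g (ψ z) = some (Quot.mk R z) := by
      have hz : ∃ w, ψ w = ψ z := ⟨z, rfl⟩
      simp only [g, dif_pos hz]
      rw [hψ hz.choose_spec]
    have := foldl_unite_complete g E (List.range N) ?_ ?_ (i := ψ x) (j := ψ y)
      (by simpa using hN x) (by simpa using hN y) h
    · rw [hg, hg] at this
      exact Option.some.inj this
    · intro p hp
      obtain ⟨z, w, hzw, hz, hw⟩ := h2 p hp
      rw [← hz, ← hw, hg, hg, Quot.sound hzw]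
      simpa using ⟨hN z, hN w⟩
    · intro i j hi hj
      simp only [List.length_range] at hi hj
      simp only [List.getD, List.getElem?_range hi, List.getElem?_range hj, Option.getD_some]
      exact fun h => congrArg g h
  · intro h
    have key : ∀ u v, R u v → (classes N E).getD (ψ u) 0 = (classes N E).getD (ψ v) 0 :=
      fun u v huv => foldl_unite_sound E _ (h1 u v huv) (by simpa using hN u)
        (by simpa using hN v)
    exact congrArg (Quot.lift (fun u => (classes N E).getD (ψ u) 0) key) h

theorem getD_map_finRange {n : ℕ} (g : Fin n → ℕ) (j : Fin n) :
    ((List.finRange n).map g).getD j.val 0 = g j := by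
  rw [List.getD_eq_getElem _ _ (by simp)]
  simp

/-! ### Numbering the sites and the components of a diagram. -/

namespace TLDiagram

variable {n : ℕ}

/-- The number of sites. -/
def size : TLDiagram n → ℕ
  | one => n
  | circle => n + 1
  | e _ => n + n
  | stack a b => a.size + b.size

/-- The position of a site in the enumeration of all sites. -/
def idx : (a : TLDiagram n) → a.Site → ℕ
  | one, j => Fin.val j
  | circle, Sum.inl j => Fin.val j
  | circle, Sum.inr _ => n
  | e _, Sum.inl j => Fin.val j
  | e _, Sum.inr j => n + Fin.val j
  | stack a _, Sum.inl x => a.idx x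
  | stack a b, Sum.inr x => a.size + b.idx x

/-- The list of values of a function on the sites. -/
def tabulate : (a : TLDiagram n) → (a.Site → ℕ) → List ℕ
  | one, g => (List.finRange n).map g
  | circle, g => (List.finRange n).map (fun j => g (Sum.inl j)) ++ [g (Sum.inr ())]
  | e _, g => (List.finRange n).map (fun j => g (Sum.inl j)) ++
      (List.finRange n).map (fun j => g (Sum.inr j))
  | stack a b, g => a.tabulate (fun x => g (Sum.inl x)) ++ b.tabulate (fun x => g (Sum.inr x))

/-- The adjacent pairs of sites. -/
def edges : TLDiagram n → List (ℕ × ℕ)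
  | one => []
  | circle => []
  | e i => ((List.finRange n).filter (fun j => j ≠ left i ∧ j ≠ right i)).map
      (fun j => (j.val, n + j.val)) ++ [((left i).val, (right i).val),
        (n + (left i).val, n + (right i).val)]
  | stack a b => a.edges ++ b.edges.map (fun p => (a.size + p.1, a.size + p.2)) ++
      (List.finRange n).map (fun j => (a.idx (a.bot j), a.size + b.idx (b.top j)))

theorem idx_lt : (a : TLDiagram n) → (x : a.Site) → a.idx x < a.size
  | one, j => Fin.isLt j
  | circle, Sum.inl j => Nat.lt_succ_of_lt (Fin.isLt j)
  | circle, Sum.inr _ => Nat.lt_succ_self n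
  | e _, Sum.inl j => Nat.lt_of_lt_of_le (Fin.isLt j) (Nat.le_add_right _ _)
  | e _, Sum.inr j => Nat.add_lt_add_left (Fin.isLt j) n
  | stack a _, Sum.inl x => Nat.lt_of_lt_of_le (a.idx_lt x) (Nat.le_add_right _ _)
  | stack a b, Sum.inr x => Nat.add_lt_add_left (b.idx_lt x) a.size

theorem idx_injective : (a : TLDiagram n) → Function.Injective a.idx
  | one => Fin.val_injective
  | circle => by
    rintro (x | x) (y | y) h
    · exact congrArg _ (Fin.val_injective h)
    · exact absurd h (Fin.isLt x).ne
    · exact absurd h (Fin.isLt y).ne'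
    · rfl
  | e _ => by
    rintro (x | x) (y | y) h
    · exact congrArg _ (Fin.val_injective h)
    · exact absurd h (Nat.lt_of_lt_of_le (Fin.isLt x) (Nat.le_add_right _ _)).ne
    · exact absurd h (Nat.lt_of_lt_of_le (Fin.isLt y) (Nat.le_add_right _ _)).ne'
    · exact congrArg _ (Fin.val_injective (Nat.add_left_cancel h))
  | stack a b => by
    rintro (x | x) (y | y) h
    · exact congrArg _ (a.idx_injective h)
    · exact absurd h (Nat.lt_of_lt_of_le (a.idx_lt x) (Nat.le_add_right _ _)).ne
    · exact absurd h (Nat.lt_of_lt_of_le (a.idx_lt y) (Nat.le_add_right _ _)).ne'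
    · exact congrArg _ (b.idx_injective (Nat.add_left_cancel h))

theorem idx_surjective : (a : TLDiagram n) → ∀ k < a.size, ∃ x, a.idx x = k
  | one => fun k hk => ⟨(⟨k, hk⟩ : Fin n), rfl⟩
  | circle => fun k hk => by
    rcases Nat.lt_succ_iff_lt_or_eq.1 hk with h | h
    · exact ⟨Sum.inl ⟨k, h⟩, rfl⟩
    · exact ⟨Sum.inr (), h.symm⟩
  | e _ => fun k hk => by
    rcases Nat.lt_or_ge k n with h | h
    · exact ⟨Sum.inl ⟨k, h⟩, rfl⟩
    · exact ⟨Sum.inr ⟨k - n, by simp only [size] at hk; omega⟩, by simp only [idx]; omega⟩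
  | stack a b => fun k hk => by
    rcases Nat.lt_or_ge k a.size with h | h
    · obtain ⟨x, hx⟩ := a.idx_surjective k h
      exact ⟨Sum.inl x, hx⟩
    · obtain ⟨x, hx⟩ := b.idx_surjective (k - a.size) (by simp only [size] at hk; omega)
      exact ⟨Sum.inr x, by simp only [idx]; omega⟩

theorem length_tabulate : (a : TLDiagram n) → (g : a.Site → ℕ) → (a.tabulate g).length = a.size
  | one, g => (List.length_map (f := g)).trans List.length_finRange
  | circle, g => by simp [tabulate, size]
  | e _, g => by simp [tabulate, size]
  | stack a b, g => by simp [tabulate, size, length_tabulate]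

theorem getD_tabulate : (a : TLDiagram n) → (g : a.Site → ℕ) → (x : a.Site) →
    (a.tabulate g).getD (a.idx x) 0 = g x
  | one, g, j => getD_map_finRange g j
  | circle, g, Sum.inl j => by
    simp only [tabulate, idx]
    rw [List.getD_append _ _ _ _ (by simp), getD_map_finRange (fun j => g (Sum.inl j))]
  | circle, g, Sum.inr j => by
    simp only [tabulate, idx]
    rw [List.getD_append_right _ _ _ _ (by simp)]
    simp
  | e _, g, Sum.inl j => by
    simp only [tabulate, idx]
    rw [List.getD_append _ _ _ _ (by simp), getD_map_finRange (fun j => g (Sum.inl j))]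
  | e _, g, Sum.inr j => by
    simp only [tabulate, idx]
    rw [List.getD_append_right _ _ _ _ (by simp), List.length_map, List.length_finRange,
      Nat.add_sub_cancel_left, getD_map_finRange (fun j => g (Sum.inr j))]
  | stack a b, g, Sum.inl x => by
    simp only [tabulate, idx]
    rw [List.getD_append _ _ _ _ (by rw [length_tabulate]; exact a.idx_lt x), getD_tabulate]
  | stack a b, g, Sum.inr x => by
    simp only [tabulate, idx]
    rw [List.getD_append_right _ _ _ _ (by rw [length_tabulate]; exact Nat.le_add_right _ _),
      length_tabulate, Nat.add_sub_cancel_left, getD_tabulate]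

theorem mem_edges : (a : TLDiagram n) → (x y : a.Site) → a.Adj x y → (a.idx x, a.idx y) ∈ a.edges
  | one, _, _, h => h.elim
  | circle, _, _, h => h.elim
  | e i, x, y, h => by
    rcases h with ⟨j, h1, h2, rfl, rfl⟩ | ⟨rfl, rfl⟩ | ⟨rfl, rfl⟩
    · simp only [edges, idx, List.mem_append, List.mem_map, List.mem_filter]
      exact Or.inl ⟨j, ⟨List.mem_finRange j, by simp [h1, h2]⟩, rfl⟩
    · simp [edges, idx]
    · simp [edges, idx]
  | stack a b, Sum.inl x, Sum.inl y, h => by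
    simp only [edges, idx, List.mem_append]
    exact Or.inl (Or.inl (a.mem_edges x y h))
  | stack a b, Sum.inr x, Sum.inr y, h => by
    simp only [edges, idx, List.mem_append]
    exact Or.inl (Or.inr (List.mem_map_of_mem (f := fun p : ℕ × ℕ => (a.size + p.1, a.size + p.2))
      (b.mem_edges x y h)))
  | stack a b, Sum.inl x, Sum.inr y, h => by
    obtain ⟨j, rfl, rfl⟩ := h
    simp only [edges, idx, List.mem_append]
    exact Or.inr (List.mem_map_of_mem
      (f := fun j => (a.idx (a.bot j), a.size + b.idx (b.top j))) (List.mem_finRange j))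
  | stack a b, Sum.inr x, Sum.inl y, h => h.elim

theorem adj_of_mem_edges : (a : TLDiagram n) → ∀ p ∈ a.edges,
    ∃ x y, a.Adj x y ∧ a.idx x = p.1 ∧ a.idx y = p.2
  | one => by simp [edges]
  | circle => by simp [edges]
  | e i => fun p hp => by
    simp only [edges, List.mem_append, List.mem_map, List.mem_filter, List.mem_cons,
      List.not_mem_nil, or_false] at hp
    rcases hp with ⟨j, ⟨_, hj⟩, rfl⟩ | rfl | rfl
    · have hj := of_decide_eq_true hj
      exact ⟨Sum.inl j, Sum.inr j, Or.inl ⟨j, hj.1, hj.2, rfl, rfl⟩, rfl, rfl⟩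
    · exact ⟨Sum.inl (left i), Sum.inl (right i), Or.inr (Or.inl ⟨rfl, rfl⟩), rfl, rfl⟩
    · exact ⟨Sum.inr (left i), Sum.inr (right i), Or.inr (Or.inr ⟨rfl, rfl⟩), rfl, rfl⟩
  | stack a b => fun p hp => by
    simp only [edges, List.mem_append, List.mem_map] at hp
    rcases hp with (hp | ⟨q, hq, rfl⟩) | ⟨j, _, rfl⟩
    · obtain ⟨x, y, h, hx, hy⟩ := a.adj_of_mem_edges p hp
      exact ⟨Sum.inl x, Sum.inl y, h, hx, hy⟩
    · obtain ⟨x, y, h, hx, hy⟩ := b.adj_of_mem_edges q hq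
      exact ⟨Sum.inr x, Sum.inr y, h, congrArg _ hx, congrArg _ hy⟩
    · exact ⟨Sum.inl (a.bot j), Sum.inr (b.top j), ⟨j, rfl, rfl⟩, rfl, rfl⟩

/-- A number that determines the component of a site. -/
def lab (a : TLDiagram n) (x : a.Site) : ℕ := (classes a.size a.edges).getD (a.idx x) 0

theorem lab_eq_iff (a : TLDiagram n) (x y : a.Site) :
    a.lab x = a.lab y ↔ (Quot.mk _ x : a.Comp) = Quot.mk _ y :=
  classes_eq_iff a.Adj a.idx a.idx_injective a.size a.idx_lt a.edges a.mem_edges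
    a.adj_of_mem_edges x y

theorem lab_lt (a : TLDiagram n) (x : a.Site) : a.lab x < a.size := by
  refine classes_lt _ _ (fun p hp => ?_) (a.idx_lt x)
  obtain ⟨x, y, -, hx, hy⟩ := a.adj_of_mem_edges p hp
  exact ⟨hx ▸ a.idx_lt x, hy ▸ a.idx_lt y⟩

/-- The number that determines a component. -/
def compLab (a : TLDiagram n) : a.Comp → ℕ :=
  Quot.lift a.lab fun _ _ h => (a.lab_eq_iff _ _).2 (Quot.sound h)

theorem compLab_injective (a : TLDiagram n) : Function.Injective a.compLab := by
  rintro ⟨x⟩ ⟨y⟩ h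
  exact (a.lab_eq_iff x y).1 h

theorem compLab_lt (a : TLDiagram n) (c : a.Comp) : a.compLab c < a.size := by
  obtain ⟨x⟩ := c
  exact a.lab_lt x

end TLDiagram

/-! ### Surfaces as tables of numbers. -/

/-- The finitely supported function given by a list of pairs. -/
noncomputable def listFinsupp {M : Type*} [AddCommMonoid M] (L : List (ℕ × M)) : ℕ →₀ M :=
  (L.map fun p => Finsupp.single p.1 p.2).sum

/-- The value at `l` of the function given by a list of pairs. -/
def listValue {M : Type*} [AddCommMonoid M] (L : List (ℕ × M)) (l : ℕ) : M :=
  (L.map fun p => if p.1 = l then p.2 else 0).sum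

theorem listFinsupp_apply {M : Type*} [AddCommMonoid M] (L : List (ℕ × M)) (l : ℕ) :
    listFinsupp L l = listValue L l := by
  induction L with
  | nil => rfl
  | cons p L ih =>
    simp only [listFinsupp, listValue, List.map_cons, List.sum_cons, Finsupp.add_apply] at *
    rw [ih, Finsupp.single_apply]

theorem listFinsupp_append {M : Type*} [AddCommMonoid M] (L L' : List (ℕ × M)) :
    listFinsupp (L ++ L') = listFinsupp L + listFinsupp L' := by
  simp [listFinsupp]

theorem mapDomain_listFinsupp {M : Type*} [AddCommMonoid M] (f : ℕ → ℕ) (L : List (ℕ × M)) :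
    (listFinsupp L).mapDomain f = listFinsupp (L.map fun p => (f p.1, p.2)) := by
  induction L with
  | nil => exact Finsupp.mapDomain_zero
  | cons p L ih =>
    simp only [listFinsupp, List.map_cons, List.sum_cons, Finsupp.mapDomain_add] at *
    rw [ih, Finsupp.mapDomain_single]

/-- A table describing a surface: an upper bound for the labels of the components, the labels of
the components at all sites of the source and the target, the labels in use, the topological
degrees and the dots. -/
structure SurfaceData where
  bound : ℕ
  src : List ℕ
  tgt : List ℕ
  used : List ℕ
  chi : List (ℕ × ℤ)
  dots : List (ℕ × ℕ)

namespace SurfaceData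

/-- The table of the surface upside down. -/
def swap (D : SurfaceData) : SurfaceData := { D with src := D.tgt, tgt := D.src }

/-- The table of a surface glued from two pieces. -/
def glue (D D' : SurfaceData) (E : List (ℕ × ℕ))
    (src tgt : (ℕ → ℕ) → (ℕ → ℕ) → List ℕ) : SurfaceData :=
  let L := classes (D.bound + D'.bound) E
  let f : ℕ → ℕ := fun l => L.getD l 0
  let g : ℕ → ℕ := fun l => L.getD (D.bound + l) 0
  { bound := D.bound + D'.bound
    src := src f g
    tgt := tgt f g
    used := D.used.map f ++ D'.used.map g
    chi := D.chi.map (fun p => (f p.1, p.2)) ++ D'.chi.map (fun p => (g p.1, p.2))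
    dots := D.dots.map (fun p => (f p.1, p.2)) ++ D'.dots.map (fun p => (g p.1, p.2)) }

/-- The table of a composition. -/
def comp (D D' : SurfaceData) : SurfaceData :=
  glue D D' (D.tgt.zip (D'.src.map (D.bound + ·))) (fun f _ => D.src.map f)
    (fun _ g => D'.tgt.map g)

/-- The table of a tensor product. -/
def tensor {n : ℕ} (a c : TLDiagram n) (D D' : SurfaceData) : SurfaceData :=
  glue D D' ((List.finRange n).map fun j =>
      (D.src.getD (a.idx (a.bot j)) 0, D.bound + D'.src.getD (c.idx (c.top j)) 0))
    (fun f g => D.src.map f ++ D'.src.map g) (fun f g => D.tgt.map f ++ D'.tgt.map g)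

/-- A canonical form of the part of the table that does not depend on the choice of labels. -/
def canon (D : SurfaceData) : List ℕ × List ℤ × List ℕ :=
  ((D.src ++ D.tgt).map fun l => (D.src ++ D.tgt).idxOf l,
    (D.src ++ D.tgt).map (listValue D.chi), (D.src ++ D.tgt).map (listValue D.dots))

/-- Every component meets the boundary. -/
def touched (D : SurfaceData) : Bool := D.used.all fun l => l ∈ D.src ++ D.tgt

/-- The tables describe the same surface without closed components. -/
def check (D D' : SurfaceData) : Bool := D.touched && D'.touched && (D.canon = D'.canon)

end SurfaceData

/-- The table `D` describes the surface `S`. -/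
structure PreSurface.Describes {n : ℕ} {a b : TLDiagram n} (S : PreSurface a b)
    (D : SurfaceData) (φ : S.X → ℕ) : Prop where
  injective : Function.Injective φ
  lt : ∀ c, φ c < D.bound
  length_src : D.src.length = a.size
  length_tgt : D.tgt.length = b.size
  src : ∀ x, D.src.getD (a.idx x) 0 = φ (S.src x)
  tgt : ∀ x, D.tgt.getD (b.idx x) 0 = φ (S.tgt x)
  used : ∀ c, φ c ∈ D.used
  chi : S.chi.mapDomain φ = listFinsupp D.chi
  dots : S.dots.mapDomain φ = listFinsupp D.dots

theorem getD_mem_zip {L L' : List ℕ} (h : L.length = L'.length) {i : ℕ} (hi : i < L.length) :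
    (L.getD i 0, L'.getD i 0) ∈ L.zip L' := by
  rw [List.getD_eq_getElem _ _ hi, List.getD_eq_getElem _ _ (h ▸ hi)]
  exact List.mem_iff_getElem.2 ⟨i, by simp [← h, hi], by simp⟩

theorem exists_of_mem_zip {L L' : List ℕ} {p : ℕ × ℕ} (hp : p ∈ L.zip L') :
    ∃ i < L.length, L.getD i 0 = p.1 ∧ L'.getD i 0 = p.2 := by
  obtain ⟨i, hi, rfl⟩ := List.mem_iff_getElem.1 hp
  simp only [List.length_zip, lt_min_iff] at hi
  refine ⟨i, hi.1, ?_, ?_⟩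
  · rw [List.getD_eq_getElem _ _ hi.1]
    simp
  · rw [List.getD_eq_getElem _ _ hi.2]
    simp

theorem getD_map_zero {L : List ℕ} (f : ℕ → ℕ) {i : ℕ} (hi : i < L.length) :
    (L.map f).getD i 0 = f (L.getD i 0) := by
  rw [List.getD_eq_getElem _ _ hi, List.getD_eq_getElem _ _ (by simpa using hi), List.getElem_map]

/-! ### Tables determine surfaces and can be computed under gluing. -/

namespace PreSurface.Describes

variable {n : ℕ} {a b c d : TLDiagram n}

theorem exists_site {S : PreSurface a b} {D : SurfaceData} {φ : S.X → ℕ} (h : S.Describes D φ)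
    {l : ℕ} (hl : l ∈ D.src ++ D.tgt) : (∃ x, φ (S.src x) = l) ∨ ∃ x, φ (S.tgt x) = l := by
  rcases List.mem_append.1 hl with hl | hl
  · obtain ⟨i, hi, rfl⟩ := List.mem_iff_getElem.1 hl
    obtain ⟨x, rfl⟩ := a.idx_surjective i (h.length_src ▸ hi)
    exact Or.inl ⟨x, by rw [← h.src, List.getD_eq_getElem _ _ hi]⟩
  · obtain ⟨i, hi, rfl⟩ := List.mem_iff_getElem.1 hl
    obtain ⟨x, rfl⟩ := b.idx_surjective i (h.length_tgt ▸ hi)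
    exact Or.inr ⟨x, by rw [← h.tgt, List.getD_eq_getElem _ _ hi]⟩

/-- The point of `S` at a site of the source or the target. -/
def at' (S : PreSurface a b) : a.Site ⊕ b.Site → S.X := Sum.elim S.src S.tgt

/-- The position of a site in the joint list of sites. -/
def pos : a.Site ⊕ b.Site → ℕ := Sum.elim a.idx (fun x => a.size + b.idx x)

theorem getD_pos {S : PreSurface a b} {D : SurfaceData} {φ : S.X → ℕ} (h : S.Describes D φ)
    (x : a.Site ⊕ b.Site) :
    pos x < (D.src ++ D.tgt).length ∧ (D.src ++ D.tgt).getD (pos x) 0 = φ (at' S x) := by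
  rw [List.length_append, h.length_src, h.length_tgt]
  obtain x | x := x
  · refine ⟨Nat.lt_of_lt_of_le (a.idx_lt x) (Nat.le_add_right _ _), ?_⟩
    refine (List.getD_append _ _ _ _ ?_).trans (h.src x)
    rw [h.length_src]
    exact a.idx_lt x
  · refine ⟨Nat.add_lt_add_left (b.idx_lt x) _, ?_⟩
    refine Eq.trans (List.getD_append_right _ _ _ _ ?_) ?_
    · rw [h.length_src]
      exact Nat.le_add_right _ _
    · rw [h.length_src]
      exact (congrArg (fun k => D.tgt.getD k 0) (Nat.add_sub_cancel_left _ _)).trans (h.tgt x)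

theorem getD_map_pos {M : Type*} (f : ℕ → M) (m : M) {S : PreSurface a b} {D : SurfaceData}
    {φ : S.X → ℕ} (h : S.Describes D φ) (x : a.Site ⊕ b.Site) :
    ((D.src ++ D.tgt).map f).getD (pos x) m = f (φ (at' S x)) := by
  have := h.getD_pos x
  rw [← this.2, List.getD_eq_getElem _ _ this.1,
    List.getD_eq_getElem _ _ (by simpa using this.1), List.getElem_map]

theorem exists_at {S : PreSurface a b} {D : SurfaceData} {φ : S.X → ℕ} (h : S.Describes D φ)
    (ht : D.touched = true) (c : S.X) : ∃ x, at' S x = c := by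
  have := h.exists_site (of_decide_eq_true (List.all_eq_true.1 ht _ (h.used c)))
  rcases this with ⟨x, hx⟩ | ⟨x, hx⟩
  · exact ⟨Sum.inl x, h.injective hx⟩
  · exact ⟨Sum.inr x, h.injective hx⟩

/-- Since every component meets the boundary, a bijection of components compatible with the boundary
is forced: the component of a site in `S` must go to the component of the same site in `T`.
Agreement of the canonical forms makes this well defined, injective, and compatible with degrees and
dots. -/
theorem equivalent {S T : PreSurface a b} {D D' : SurfaceData} {φ : S.X → ℕ} {ψ : T.X → ℕ}
    (h : S.Describes D φ) (h' : T.Describes D' ψ) (hc : D.check D' = true) : Equivalent S T := by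
  classical
  simp only [SurfaceData.check, Bool.and_eq_true, decide_eq_true_eq] at hc
  obtain ⟨⟨ht, ht'⟩, hc⟩ := hc
  simp only [SurfaceData.canon, Prod.mk.injEq] at hc
  obtain ⟨hk, hchi, hdots⟩ := hc
  -- Two sites share a component exactly when their labels first occur at the same position of the
  -- joint list. These positions form the first entry of the canonical form and do not depend on the
  -- labels chosen.
  have key (x y : a.Site ⊕ b.Site) : at' S x = at' S y ↔ at' T x = at' T y := by
    have e1 (x) := h.getD_map_pos (fun l => (D.src ++ D.tgt).idxOf l) 0 x
    have e2 (x) := h'.getD_map_pos (fun l => (D'.src ++ D'.tgt).idxOf l) 0 x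
    rw [hk] at e1
    have m1 (x) : φ (at' S x) ∈ D.src ++ D.tgt := by
      rw [← (h.getD_pos x).2, List.getD_eq_getElem _ _ (h.getD_pos x).1]
      exact List.getElem_mem _
    have m2 (x) : ψ (at' T x) ∈ D'.src ++ D'.tgt := by
      rw [← (h'.getD_pos x).2, List.getD_eq_getElem _ _ (h'.getD_pos x).1]
      exact List.getElem_mem _
    rw [← h.injective.eq_iff, ← h'.injective.eq_iff, ← List.idxOf_inj (m1 x),
      ← List.idxOf_inj (m2 x), ← e1, ← e1, ← e2, ← e2]
  -- A boundary site for each component. By `key` the choice is irrelevant.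
  choose f hf using h.exists_at ht
  let θ : S.X → T.X := fun c => at' T (f c)
  have hθ (x) : θ (at' S x) = at' T x := (key _ _).1 (hf _)
  have hinj : Function.Injective θ := fun c c' hcc => by
    rw [← hf c, ← hf c']
    exact (key _ _).2 hcc
  have hsurj : Function.Surjective θ := fun t => by
    obtain ⟨x, rfl⟩ := h'.exists_at ht' t
    exact ⟨_, hθ x⟩
  refine ⟨Equiv.ofBijective θ ⟨hinj, hsurj⟩, fun x => hθ (Sum.inl x), fun x => hθ (Sum.inr x),
    ?_, ?_⟩
  · ext t
    obtain ⟨c, rfl⟩ := hsurj t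
    refine (Finsupp.mapDomain_apply hinj _ _).trans ?_
    have e1 := h.getD_map_pos (listValue D.chi) 0 (f c)
    rw [hchi, h'.getD_map_pos, ← listFinsupp_apply, ← listFinsupp_apply, ← h.chi, ← h'.chi,
      Finsupp.mapDomain_apply h.injective, Finsupp.mapDomain_apply h'.injective, hf] at e1
    exact e1.symm
  · ext t
    obtain ⟨c, rfl⟩ := hsurj t
    refine (Finsupp.mapDomain_apply hinj _ _).trans ?_
    have e1 := h.getD_map_pos (listValue D.dots) 0 (f c)
    rw [hdots, h'.getD_map_pos, ← listFinsupp_apply, ← listFinsupp_apply, ← h.dots, ← h'.dots,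
      Finsupp.mapDomain_apply h.injective, Finsupp.mapDomain_apply h'.injective, hf] at e1
    exact e1.symm

theorem swap {S : PreSurface a b} {D : SurfaceData} {φ : S.X → ℕ} (h : S.Describes D φ) :
    S.reverse.Describes D.swap φ :=
  ⟨h.injective, h.lt, h.length_tgt, h.length_src, h.tgt, h.src, h.used, h.chi, h.dots⟩

/-- The labels of a glued surface. -/
theorem exists_glue {X Y : Type} {φ : X → ℕ} {ψ : Y → ℕ} (hφ : Function.Injective φ)
    (hψ : Function.Injective ψ) {N N' : ℕ} (hN : ∀ x, φ x < N) (hN' : ∀ y, ψ y < N')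
    (R : X ⊕ Y → X ⊕ Y → Prop) (E : List (ℕ × ℕ))
    (h1 : ∀ u v, R u v → ∃ x y, u = Sum.inl x ∧ v = Sum.inr y ∧ (φ x, N + ψ y) ∈ E)
    (h2 : ∀ p ∈ E, ∃ x y, R (Sum.inl x) (Sum.inr y) ∧ φ x = p.1 ∧ N + ψ y = p.2) :
    ∃ θ : Quot R → ℕ, Function.Injective θ ∧ (∀ c, θ c < N + N') ∧
      (∀ x, θ (Quot.mk _ (Sum.inl x)) = (classes (N + N') E).getD (φ x) 0) ∧
      ∀ y, θ (Quot.mk _ (Sum.inr y)) = (classes (N + N') E).getD (N + ψ y) 0 := by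
  let χ : X ⊕ Y → ℕ := Sum.elim φ (fun y => N + ψ y)
  have hχ : Function.Injective χ := by
    rintro (x | x) (y | y) h
    · exact congrArg _ (hφ h)
    · exact absurd h (Nat.lt_of_lt_of_le (hN x) (Nat.le_add_right _ _)).ne
    · exact absurd h (Nat.lt_of_lt_of_le (hN y) (Nat.le_add_right _ _)).ne'
    · exact congrArg _ (hψ (Nat.add_left_cancel h))
  have hlt : ∀ x, χ x < N + N' := by
    rintro (x | x)
    · exact Nat.lt_of_lt_of_le (hN x) (Nat.le_add_right _ _)
    · exact Nat.add_lt_add_left (hN' x) N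
  have key := classes_eq_iff R χ hχ (N + N') hlt E
    (fun u v huv => by
      obtain ⟨x, y, rfl, rfl, h⟩ := h1 u v huv
      exact h)
    (fun p hp => by
      obtain ⟨x, y, h, hx, hy⟩ := h2 p hp
      exact ⟨_, _, h, hx, hy⟩)
  refine ⟨Quot.lift (fun u => (classes (N + N') E).getD (χ u) 0)
    (fun u v huv => (key u v).2 (Quot.sound huv)), ?_, ?_, fun _ => rfl, fun _ => rfl⟩
  · rintro ⟨u⟩ ⟨v⟩ h
    exact (key u v).1 h
  · rintro ⟨u⟩
    refine classes_lt _ _ (fun p hp => ?_) (hlt u)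
    obtain ⟨x, y, -, hx, hy⟩ := h2 p hp
    exact ⟨hx ▸ hlt (Sum.inl x), hy ▸ hlt (Sum.inr y)⟩

/-- Pushing forward a function given by a list only relabels the first entries, so the data of a
glued surface is the concatenation of two relabelled lists. -/
theorem mapDomain_glue {X Y Z M : Type} [AddCommMonoid M] {φ : X → ℕ} {ψ : Y → ℕ} {θ : Z → ℕ}
    (i : X → Z) (j : Y → Z) (f g : ℕ → ℕ) (hi : ∀ x, θ (i x) = f (φ x))
    (hj : ∀ y, θ (j y) = g (ψ y)) (u : X →₀ M) (v : Y →₀ M) (L L' : List (ℕ × M))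
    (hu : u.mapDomain φ = listFinsupp L) (hv : v.mapDomain ψ = listFinsupp L') :
    (u.mapDomain i + v.mapDomain j).mapDomain θ =
      listFinsupp (L.map (fun p => (f p.1, p.2)) ++ L'.map (fun p => (g p.1, p.2))) := by
  rw [listFinsupp_append, ← mapDomain_listFinsupp, ← mapDomain_listFinsupp, ← hu, ← hv,
    Finsupp.mapDomain_add]
  simp only [← Finsupp.mapDomain_comp]
  congr 2
  · exact funext hi
  · exact funext hj

/-- The labels of the second surface are shifted by `D.bound` to keep them apart from those of the
first. The edges then pair the two labels found over each site of the middle diagram. -/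
theorem comp {S : PreSurface a b} {T : PreSurface b c} {D D' : SurfaceData} {φ : S.X → ℕ}
    {ψ : T.X → ℕ} (h : S.Describes D φ) (h' : T.Describes D' ψ) :
    ∃ θ, (S.comp T).Describes (D.comp D') θ := by
  obtain ⟨θ, h1, h2, h3, h4⟩ := exists_glue h.injective h'.injective h.lt h'.lt (CompGlue S T)
    (D.tgt.zip (D'.src.map (D.bound + ·))) (by
      rintro _ _ ⟨x⟩
      refine ⟨_, _, rfl, rfl, ?_⟩
      rw [← h.tgt, ← h'.src, ← getD_map_zero (D.bound + ·) (h'.length_src ▸ b.idx_lt x)]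
      exact getD_mem_zip (by rw [List.length_map, h.length_tgt, h'.length_src])
        (h.length_tgt ▸ b.idx_lt x)) (by
      intro p hp
      obtain ⟨i, hi, h1, h2⟩ := exists_of_mem_zip hp
      rw [h.length_tgt] at hi
      obtain ⟨x, rfl⟩ := b.idx_surjective i hi
      refine ⟨_, _, .glue x, by rw [← h.tgt, h1], ?_⟩
      rw [← h'.src, ← h2, getD_map_zero _ (h'.length_src ▸ b.idx_lt x)])
  refine ⟨θ, h1, h2, ?_, ?_, ?_, ?_, ?_, ?_, ?_⟩
  · exact (List.length_map _).trans h.length_src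
  · exact (List.length_map _).trans h'.length_tgt
  · intro x
    refine (getD_map_zero _ (h.length_src ▸ a.idx_lt x)).trans ?_
    rw [h.src]
    exact (h3 _).symm
  · intro x
    refine (getD_map_zero _ (h'.length_tgt ▸ c.idx_lt x)).trans ?_
    rw [h'.tgt]
    exact (h4 _).symm
  · rintro ⟨x | x⟩
    · rw [h3]
      exact List.mem_append_left _ (List.mem_map_of_mem (h.used x))
    · rw [h4]
      exact List.mem_append_right _ (List.mem_map_of_mem (h'.used x))
  · exact mapDomain_glue _ _ (fun l => (classes _ _).getD l 0)
      (fun l => (classes _ _).getD (D.bound + l) 0) h3 h4 _ _ _ _ h.chi h'.chi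
  · exact mapDomain_glue _ _ (fun l => (classes _ _).getD l 0)
      (fun l => (classes _ _).getD (D.bound + l) 0) h3 h4 _ _ _ _ h.dots h'.dots

theorem getD_append_map {f g : ℕ → ℕ} {L L' : List ℕ} {u : a.Site → ℕ} {v : b.Site → ℕ}
    (hL : L.length = a.size) (hL' : L'.length = b.size)
    (hu : ∀ x, L.getD (a.idx x) 0 = u x) (hv : ∀ x, L'.getD (b.idx x) 0 = v x)
    (x : (a.stack b).Site) :
    (L.map f ++ L'.map g).getD ((a.stack b).idx x) 0 =
      Sum.elim (fun x => f (u x)) (fun x => g (v x)) x := by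
  obtain x | x := x
  · refine (List.getD_append _ _ _ _ ?_).trans ?_
    · rw [List.length_map, hL]
      exact a.idx_lt x
    · refine (getD_map_zero _ (hL ▸ a.idx_lt x)).trans ?_
      exact congrArg f (hu x)
  · refine (List.getD_append_right _ _ _ _ ?_).trans ?_
    · rw [List.length_map, hL]
      exact Nat.le_add_right _ _
    · rw [List.length_map, hL]
      refine (congrArg (fun k => (L'.map g).getD k 0) (Nat.add_sub_cancel_left _ _)).trans ?_
      refine (getD_map_zero _ (hL' ▸ b.idx_lt x)).trans ?_
      exact congrArg g (hv x)

theorem tensor {S : PreSurface a b} {T : PreSurface c d} {D D' : SurfaceData} {φ : S.X → ℕ}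
    {ψ : T.X → ℕ} (h : S.Describes D φ) (h' : T.Describes D' ψ) :
    ∃ θ, (S.tensor T).Describes (D.tensor a c D') θ := by
  obtain ⟨θ, h1, h2, h3, h4⟩ := exists_glue h.injective h'.injective h.lt h'.lt (TensorGlue S T)
    ((List.finRange n).map fun j =>
      (D.src.getD (a.idx (a.bot j)) 0, D.bound + D'.src.getD (c.idx (c.top j)) 0)) (by
      rintro _ _ ⟨j⟩
      refine ⟨_, _, rfl, rfl, ?_⟩
      rw [← h.src, ← h'.src]
      exact List.mem_map.2 ⟨j, List.mem_finRange j, rfl⟩) (by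
      intro p hp
      obtain ⟨j, -, rfl⟩ := List.mem_map.1 hp
      exact ⟨_, _, .glue j, (h.src _).symm, congrArg _ (h'.src _).symm⟩)
  refine ⟨θ, h1, h2, ?_, ?_, ?_, ?_, ?_, ?_, ?_⟩
  · refine List.length_append.trans ?_
    rw [List.length_map, List.length_map, h.length_src, h'.length_src]
    rfl
  · refine List.length_append.trans ?_
    rw [List.length_map, List.length_map, h.length_tgt, h'.length_tgt]
    rfl
  · intro x
    refine (getD_append_map h.length_src h'.length_src h.src h'.src x).trans ?_
    obtain x | x := x
    · exact (h3 _).symm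
    · exact (h4 _).symm
  · intro x
    refine (getD_append_map h.length_tgt h'.length_tgt h.tgt h'.tgt x).trans ?_
    obtain x | x := x
    · exact (h3 _).symm
    · exact (h4 _).symm
  · rintro ⟨x | x⟩
    · rw [h3]
      exact List.mem_append_left _ (List.mem_map_of_mem (h.used x))
    · rw [h4]
      exact List.mem_append_right _ (List.mem_map_of_mem (h'.used x))
  · exact mapDomain_glue _ _ (fun l => (classes _ _).getD l 0)
      (fun l => (classes _ _).getD (D.bound + l) 0) h3 h4 _ _ _ _ h.chi h'.chi
  · exact mapDomain_glue _ _ (fun l => (classes _ _).getD l 0)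
      (fun l => (classes _ _).getD (D.bound + l) 0) h3 h4 _ _ _ _ h.dots h'.dots

end PreSurface.Describes

/-! ## Tables of the elementary cobordisms -/

namespace SurfaceData

variable {n : ℕ}

/-- The table of a cylinder; `f` describes the isotopy on sites. -/
def cylinder (a b : TLDiagram n) (f : a.Site → b.Site) : SurfaceData where
  bound := b.size
  src := a.tabulate fun x => b.lab (f x)
  tgt := classes b.size b.edges
  used := classes b.size b.edges
  chi := []
  dots := []

/-- The table of the identity with a dot. -/
def dot (a : TLDiagram n) (p : a.Site) : SurfaceData where
  bound := a.size
  src := classes a.size a.edges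
  tgt := classes a.size a.edges
  used := classes a.size a.edges
  chi := []
  dots := [(a.lab p, 1)]

/-- The table of the identity. -/
def id (a : TLDiagram n) : SurfaceData where
  bound := a.size
  src := classes a.size a.edges
  tgt := classes a.size a.edges
  used := classes a.size a.edges
  chi := []
  dots := []

/-- The label of a strand in a saddle. -/
def saddleLab (i : Fin (n - 1)) (j : Fin n) : ℕ :=
  if j = TLDiagram.right i then (TLDiagram.left i).val else j.val

/-- The table of a saddle. -/
def saddle (i : Fin (n - 1)) : SurfaceData where
  bound := n
  src := (TLDiagram.one : TLDiagram n).tabulate (saddleLab i)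
  tgt := (TLDiagram.e i).tabulate (Sum.elim (saddleLab i) (saddleLab i))
  used := (TLDiagram.one : TLDiagram n).tabulate (saddleLab i)
  chi := [((TLDiagram.left i).val, -1)]
  dots := []

/-- The table of a birth. -/
def birth (n : ℕ) : SurfaceData where
  bound := n + 1
  src := (TLDiagram.one : TLDiagram n).tabulate fun j => j.val
  tgt := (TLDiagram.circle : TLDiagram n).tabulate TLDiagram.circle.idx
  used := (TLDiagram.circle : TLDiagram n).tabulate TLDiagram.circle.idx
  chi := [(n, 1)]
  dots := []

/-- The table of a merge. -/
def merge (a : TLDiagram n) (p : a.Site) : SurfaceData where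
  bound := a.size
  src := (TLDiagram.circle.stack a).tabulate
    (Sum.elim (Sum.elim (fun j => a.lab (a.top j)) (fun _ => a.lab p)) a.lab)
  tgt := classes a.size a.edges
  used := classes a.size a.edges
  chi := [(a.lab p, -1)]
  dots := []

end SurfaceData

namespace TLDiagram

variable {n : ℕ}

theorem lab_mem (a : TLDiagram n) (x : a.Site) : a.lab x ∈ classes a.size a.edges := by
  have h : a.idx x < (classes a.size a.edges).length := by
    rw [length_classes]
    exact a.idx_lt x
  rw [lab, List.getD_eq_getElem _ _ h]
  exact List.getElem_mem _

theorem compLab_mem (a : TLDiagram n) (c : a.Comp) : a.compLab c ∈ classes a.size a.edges := by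
  obtain ⟨x⟩ := c
  exact a.lab_mem x

theorem mem_tabulate (a : TLDiagram n) (g : a.Site → ℕ) (x : a.Site) : g x ∈ a.tabulate g := by
  have h : a.idx x < (a.tabulate g).length := by
    rw [length_tabulate]
    exact a.idx_lt x
  rw [← a.getD_tabulate g x, List.getD_eq_getElem _ _ h]
  exact List.getElem_mem _

end TLDiagram

namespace PreSurface

variable {n : ℕ} {a b c d : TLDiagram n}

theorem describes_cylinder (φ : a.Comp ≃ b.Comp)
    (htop : ∀ j, φ (Quot.mk _ (a.top j)) = Quot.mk _ (b.top j))
    (hbot : ∀ j, φ (Quot.mk _ (a.bot j)) = Quot.mk _ (b.bot j)) (f : a.Site → b.Site)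
    (hf : ∀ x, φ (Quot.mk _ x) = Quot.mk _ (f x)) :
    (cylinder φ htop hbot).Describes (SurfaceData.cylinder a b f) b.compLab where
  injective := b.compLab_injective
  lt := b.compLab_lt
  length_src := TLDiagram.length_tabulate _ _
  length_tgt := length_classes _ _
  src x := (TLDiagram.getD_tabulate _ _ _).trans (congrArg b.compLab (hf x)).symm
  tgt _ := rfl
  used := b.compLab_mem
  chi := Finsupp.mapDomain_zero
  dots := Finsupp.mapDomain_zero

/-- A table of a cylinder uses a map of sites inducing the bijection of components. Reversing the
cylinder describes the inverse isotopy without choosing such a map in the opposite direction. -/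
theorem cylinder_symm (φ : a.Comp ≃ b.Comp)
    (htop : ∀ j, φ (Quot.mk _ (a.top j)) = Quot.mk _ (b.top j))
    (hbot : ∀ j, φ (Quot.mk _ (a.bot j)) = Quot.mk _ (b.bot j)) :
    Equivalent (cylinder φ.symm (fun j => φ.symm_apply_eq.2 (htop j).symm)
      (fun j => φ.symm_apply_eq.2 (hbot j).symm)) (cylinder φ htop hbot).reverse :=
  ⟨φ, fun _ => φ.apply_symm_apply _, fun _ => rfl, Finsupp.mapDomain_zero, Finsupp.mapDomain_zero⟩

theorem describes_dot (a : TLDiagram n) (p : a.Site) :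
    (dot a p).Describes (SurfaceData.dot a p) a.compLab where
  injective := a.compLab_injective
  lt := a.compLab_lt
  length_src := length_classes _ _
  length_tgt := length_classes _ _
  src _ := rfl
  tgt _ := rfl
  used := a.compLab_mem
  chi := Finsupp.mapDomain_zero
  dots := Finsupp.mapDomain_single.trans (add_zero _).symm

theorem describes_id (a : TLDiagram n) : (id a).Describes (SurfaceData.id a) a.compLab where
  injective := a.compLab_injective
  lt := a.compLab_lt
  length_src := length_classes _ _
  length_tgt := length_classes _ _
  src _ := rfl
  tgt _ := rfl
  used := a.compLab_mem
  chi := Finsupp.mapDomain_zero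
  dots := Finsupp.mapDomain_zero

theorem describes_saddle (i : Fin (n - 1)) :
    ∃ φ, (saddle i).Describes (SurfaceData.saddle i) φ := by
  have hlr : TLDiagram.left i ≠ TLDiagram.right i := fun h => by
    have := congrArg Fin.val h
    simp [TLDiagram.left, TLDiagram.right] at this
  refine ⟨Quot.lift (SurfaceData.saddleLab i) ?_, ?_⟩
  · rintro _ _ ⟨⟩
    simp [SurfaceData.saddleLab]
  · have hsrc : ∀ x : Fin n, ((TLDiagram.one : TLDiagram n).tabulate
        (SurfaceData.saddleLab i)).getD x.val 0 = SurfaceData.saddleLab i x :=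
      fun x => TLDiagram.getD_tabulate (n := n) .one _ x
    refine ⟨?_, ?_, TLDiagram.length_tabulate _ _, TLDiagram.length_tabulate _ _, hsrc, ?_, ?_,
      ?_, Finsupp.mapDomain_zero⟩
    · rintro ⟨x⟩ ⟨y⟩ h
      change SurfaceData.saddleLab i x = SurfaceData.saddleLab i y at h
      simp only [SurfaceData.saddleLab] at h
      have key : (Quot.mk (SaddleGlue i) (TLDiagram.left i)) =
        Quot.mk (SaddleGlue i) (TLDiagram.right i) := Quot.sound .glue
      split_ifs at h with h1 h2 h2
      · rw [h1, h2]
      · rw [h1, ← Fin.ext h, key]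
      · rw [h2, Fin.ext h, key]
      · rw [Fin.ext h]
    · rintro ⟨x⟩
      change SurfaceData.saddleLab i x < n
      simp only [SurfaceData.saddleLab]
      split_ifs
      · exact Fin.isLt _
      · exact x.isLt
    · intro x
      refine (TLDiagram.getD_tabulate _ _ _).trans ?_
      obtain x | x := x <;> rfl
    · rintro ⟨x⟩
      exact TLDiagram.mem_tabulate (n := n) .one (SurfaceData.saddleLab i) x
    · refine Finsupp.mapDomain_single.trans (Eq.trans ?_ (add_zero _).symm)
      change Finsupp.single (SurfaceData.saddleLab i (TLDiagram.left i)) _ = _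
      rw [SurfaceData.saddleLab, if_neg hlr]

theorem describes_birth (n : ℕ) :
    (birth n).Describes (SurfaceData.birth n) (TLDiagram.circle : TLDiagram n).idx where
  injective := TLDiagram.idx_injective _
  lt := (TLDiagram.circle : TLDiagram n).idx_lt
  length_src := TLDiagram.length_tabulate _ _
  length_tgt := TLDiagram.length_tabulate _ _
  src x := TLDiagram.getD_tabulate (n := n) .one _ x
  tgt _ := TLDiagram.getD_tabulate _ _ _
  used x := TLDiagram.mem_tabulate (n := n) .circle _ x
  chi := Finsupp.mapDomain_single.trans (add_zero _).symm
  dots := Finsupp.mapDomain_zero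

theorem describes_merge (a : TLDiagram n) (p : a.Site) :
    (merge a p).Describes (SurfaceData.merge a p) a.compLab where
  injective := a.compLab_injective
  lt := a.compLab_lt
  length_src := TLDiagram.length_tabulate _ _
  length_tgt := length_classes _ _
  src x := by
    refine (TLDiagram.getD_tabulate _ _ _).trans ?_
    obtain (x | x) | x := x <;> rfl
  tgt _ := rfl
  used := a.compLab_mem
  chi := Finsupp.mapDomain_single.trans (add_zero _).symm
  dots := Finsupp.mapDomain_zero

end PreSurface

/-! ### Tables of cobordisms, assembled by instance search. -/

namespace Cobordism

variable {n : ℕ} {a b c d : TLDiagram n}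

/-- The cobordism `S` is described by the table `D`. -/
class HasTable (S : Cobordism a b) (D : outParam SurfaceData) : Prop where
  out : ∃ (S' : PreSurface a b) (φ : S'.X → ℕ), S.1 = Surface.mk S' ∧ S'.Describes D φ

/-- Both tables are output parameters, so they are computed from the way in which `S` and `T` are
built. Only the Boolean condition remains, a closed computation once the indices are fixed. -/
theorem eq_of_check (S T : Cobordism a b) {D D' : SurfaceData} [hS : HasTable S D]
    [hT : HasTable T D'] (h : D.check D' = true) : S = T := by
  obtain ⟨S', φ, hS, hD⟩ := hS.out
  obtain ⟨T', ψ, hT, hD'⟩ := hT.out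
  refine Subtype.ext ?_
  rw [hS, hT]
  exact _root_.Quotient.sound (hD.equivalent hD' h)

/-- The union of the cylinders over the components of a diagram. -/
noncomputable def cylinder (φ : a.Comp ≃ b.Comp)
    (htop : ∀ j, φ (Quot.mk _ (a.top j)) = Quot.mk _ (b.top j))
    (hbot : ∀ j, φ (Quot.mk _ (a.bot j)) = Quot.mk _ (b.bot j)) : Cobordism a b :=
  ⟨Surface.mk (PreSurface.cylinder φ htop hbot), .cylinder φ htop hbot⟩

/-- The inverse of `cylinder`. -/
noncomputable def cylinder' (φ : a.Comp ≃ b.Comp)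
    (htop : ∀ j, φ (Quot.mk _ (a.top j)) = Quot.mk _ (b.top j))
    (hbot : ∀ j, φ (Quot.mk _ (a.bot j)) = Quot.mk _ (b.bot j)) : Cobordism b a :=
  cylinder φ.symm (fun j => φ.symm_apply_eq.2 (htop j).symm)
    (fun j => φ.symm_apply_eq.2 (hbot j).symm)

theorem hasTable_cylinder (φ : a.Comp ≃ b.Comp)
    (htop : ∀ j, φ (Quot.mk _ (a.top j)) = Quot.mk _ (b.top j))
    (hbot : ∀ j, φ (Quot.mk _ (a.bot j)) = Quot.mk _ (b.bot j)) (f : a.Site → b.Site)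
    (hf : ∀ x, φ (Quot.mk _ x) = Quot.mk _ (f x)) :
    HasTable (cylinder φ htop hbot) (SurfaceData.cylinder a b f) :=
  ⟨_, _, rfl, PreSurface.describes_cylinder φ htop hbot f hf⟩

theorem hasTable_cylinder' (φ : a.Comp ≃ b.Comp)
    (htop : ∀ j, φ (Quot.mk _ (a.top j)) = Quot.mk _ (b.top j))
    (hbot : ∀ j, φ (Quot.mk _ (a.bot j)) = Quot.mk _ (b.bot j)) (f : a.Site → b.Site)
    (hf : ∀ x, φ (Quot.mk _ x) = Quot.mk _ (f x)) :
    HasTable (cylinder' φ htop hbot) (SurfaceData.cylinder a b f).swap :=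
  ⟨_, _, _root_.Quotient.sound (PreSurface.cylinder_symm φ htop hbot),
    (PreSurface.describes_cylinder φ htop hbot f hf).swap⟩

instance (S : Cobordism a b) (T : Cobordism b c) (D D' : SurfaceData) [hS : HasTable S D]
    [hT : HasTable T D'] : HasTable (S.comp T) (D.comp D') := by
  obtain ⟨S', φ, hS, hD⟩ := hS.out
  obtain ⟨T', ψ, hT, hD'⟩ := hT.out
  obtain ⟨θ, hθ⟩ := hD.comp hD'
  exact ⟨S'.comp T', θ, congrArg₂ Surface.comp hS hT, hθ⟩

instance (S : Cobordism a b) (T : Cobordism c d) (D D' : SurfaceData) [hS : HasTable S D]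
    [hT : HasTable T D'] : HasTable (S.tensor T) (D.tensor a c D') := by
  obtain ⟨S', φ, hS, hD⟩ := hS.out
  obtain ⟨T', ψ, hT, hD'⟩ := hT.out
  obtain ⟨θ, hθ⟩ := hD.tensor hD'
  exact ⟨S'.tensor T', θ, congrArg₂ Surface.tensor hS hT, hθ⟩

instance (a : TLDiagram n) : HasTable (id a) (SurfaceData.id a) :=
  ⟨_, _, rfl, PreSurface.describes_id a⟩

instance (a : TLDiagram n) (p : a.Site) : HasTable (dot a p) (SurfaceData.dot a p) :=
  ⟨_, _, rfl, PreSurface.describes_dot a p⟩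

instance (i : Fin (n - 1)) : HasTable (saddle i) (SurfaceData.saddle i) := by
  obtain ⟨φ, hφ⟩ := PreSurface.describes_saddle i
  exact ⟨_, _, rfl, hφ⟩

instance (i : Fin (n - 1)) : HasTable (saddle' i) (SurfaceData.saddle i).swap := by
  obtain ⟨φ, hφ⟩ := PreSurface.describes_saddle i
  exact ⟨_, _, rfl, hφ.swap⟩

instance : HasTable (birth n) (SurfaceData.birth n) :=
  ⟨_, _, rfl, PreSurface.describes_birth n⟩

instance : HasTable (death n) (SurfaceData.birth n).swap :=
  ⟨_, _, rfl, (PreSurface.describes_birth n).swap⟩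

instance : HasTable (dotCircle n) (SurfaceData.dot TLDiagram.circle (Sum.inr () : Fin n ⊕ Unit)) :=
  ⟨_, _, rfl, PreSurface.describes_dot TLDiagram.circle (Sum.inr () : Fin n ⊕ Unit)⟩

/-- A circle merges with the component of the point `p`. -/
noncomputable def merge (a : TLDiagram n) (p : a.Site) : Cobordism (TLDiagram.circle.stack a) a :=
  ⟨Surface.mk (PreSurface.merge a p), .merge a p⟩

/-- A circle splits off from the component of the point `p`. -/
noncomputable def split (a : TLDiagram n) (p : a.Site) : Cobordism a (TLDiagram.circle.stack a) :=
  ⟨Surface.mk (PreSurface.merge a p).reverse, .split a p⟩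

instance (a : TLDiagram n) (p : a.Site) : HasTable (merge a p) (SurfaceData.merge a p) :=
  ⟨_, _, rfl, PreSurface.describes_merge a p⟩

instance (a : TLDiagram n) (p : a.Site) : HasTable (split a p) (SurfaceData.merge a p).swap :=
  ⟨_, _, rfl, (PreSurface.describes_merge a p).swap⟩

/-- The isotopy from `a` stacked on `1` to `a`. -/
noncomputable abbrev stackOneCyl (a : TLDiagram n) : Cobordism (a.stack .one) a :=
  cylinder (stackOne a) (fun _ => rfl) (fun _ => rfl)

/-- The isotopy from `a` to `a` stacked on `1`. -/
noncomputable abbrev stackOneCyl' (a : TLDiagram n) : Cobordism a (a.stack .one) :=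
  cylinder' (stackOne a) (fun _ => rfl) (fun _ => rfl)

/-- The isotopy from `1` stacked on `a` to `a`. -/
noncomputable abbrev oneStackCyl (a : TLDiagram n) : Cobordism (TLDiagram.one.stack a) a :=
  cylinder (oneStack a) (fun _ => rfl) (fun _ => rfl)

/-- The isotopy from `a` to `1` stacked on `a`. -/
noncomputable abbrev oneStackCyl' (a : TLDiagram n) : Cobordism a (TLDiagram.one.stack a) :=
  cylinder' (oneStack a) (fun _ => rfl) (fun _ => rfl)

instance (a : TLDiagram n) : HasTable (stackOneCyl a)
    (SurfaceData.cylinder (a.stack .one) a (Sum.elim (fun x => x) a.bot)) :=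
  hasTable_cylinder _ _ _ _ (by rintro (x | x) <;> rfl)

instance (a : TLDiagram n) : HasTable (stackOneCyl' a)
    (SurfaceData.cylinder (a.stack .one) a (Sum.elim (fun x => x) a.bot)).swap :=
  hasTable_cylinder' _ _ _ _ (by rintro (x | x) <;> rfl)

instance (a : TLDiagram n) : HasTable (oneStackCyl a)
    (SurfaceData.cylinder (TLDiagram.one.stack a) a (Sum.elim a.top (fun x => x))) :=
  hasTable_cylinder _ _ _ _ (by rintro (x | x) <;> rfl)

instance (a : TLDiagram n) : HasTable (oneStackCyl' a)
    (SurfaceData.cylinder (TLDiagram.one.stack a) a (Sum.elim a.top (fun x => x))).swap :=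
  hasTable_cylinder' _ _ _ _ (by rintro (x | x) <;> rfl)

/-- Here and in the next three instances the saddle unfolds to the displayed composition, up to
proofs, so its table is that of the composition. -/
instance (a : TLDiagram n) (i : Fin (n - 1)) (D : SurfaceData)
    [h : HasTable ((stackOneCyl' a).comp ((id a).tensor (saddle i))) D] :
    HasTable (saddleBelow a i) D := h

instance (a : TLDiagram n) (i : Fin (n - 1)) (D : SurfaceData)
    [h : HasTable ((oneStackCyl' a).comp ((saddle i).tensor (id a))) D] :
    HasTable (saddleAbove i a) D := h

instance (a : TLDiagram n) (i : Fin (n - 1)) (D : SurfaceData)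
    [h : HasTable (((id a).tensor (saddle' i)).comp (stackOneCyl a)) D] :
    HasTable (saddleBelow' a i) D := h

instance (a : TLDiagram n) (i : Fin (n - 1)) (D : SurfaceData)
    [h : HasTable (((saddle' i).tensor (id a)).comp (oneStackCyl a)) D] :
    HasTable (saddleAbove' i a) D := h

end Cobordism

/-! ## Calculus in `Cob(n)` -/

namespace Cob

variable {n : ℕ} {a b c : TLDiagram n}

theorem single_comp (s t u : ℤ) (S : Cobordism a b) (T : Cobordism b c) :
    single s t S ≫ single t u T = single s u (S.comp T) := by
  rw [single, single, single, ← Functor.map_comp]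
  exact congrArg _ ((PreCob.incl n).map_comp (X := ⟨s, a⟩) (Y := ⟨t, b⟩) (Z := ⟨u, c⟩) S T).symm

theorem single_id (s : ℤ) (a : TLDiagram n) : single s s (Cobordism.id a) = 𝟙 (of s a) := by
  have h : PreCob.single s s (Cobordism.id a) = 𝟙 _ := (PreCob.incl n).map_id ⟨s, a⟩
  rw [single, h]
  exact (quotient n).map_id _

theorem tensorLeft_single (z : TLDiagram n) (s t : ℤ) (S : Cobordism a b) :
    (tensorLeft ⟨0, z⟩).map (single s t S) =
      single (0 + s) (0 + t) ((Cobordism.id z).tensor S) := by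
  have h : (PreCob.tensorLeft ⟨0, z⟩).map (PreCob.single s t S) =
      PreCob.single (0 + s) (0 + t) ((Cobordism.id z).tensor S) :=
    (Free.lift_map_single BaseRing ((GradedDiagram.tensorLeft ⟨0, z⟩) ⋙ PreCob.incl n)
      (X := ⟨s, a⟩) (Y := ⟨t, b⟩) S 1).trans (one_smul _ _)
  exact congrArg (quotient n).map h

theorem tensorRight_single (z : TLDiagram n) (s t : ℤ) (S : Cobordism a b) :
    (tensorRight ⟨0, z⟩).map (single s t S) =
      single (s + 0) (t + 0) (S.tensor (Cobordism.id z)) := by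
  have h : (PreCob.tensorRight ⟨0, z⟩).map (PreCob.single s t S) =
      PreCob.single (s + 0) (t + 0) (S.tensor (Cobordism.id z)) :=
    (Free.lift_map_single BaseRing ((GradedDiagram.tensorRight ⟨0, z⟩) ⋙ PreCob.incl n)
      (X := ⟨s, a⟩) (Y := ⟨t, b⟩) S 1).trans (one_smul _ _)
  exact congrArg (quotient n).map h

/-- A cobordism between diagrams without a shift of the grading. -/
noncomputable def sg (S : Cobordism a b) : of 0 a ⟶ of 0 b := single 0 0 S

theorem sg_comp (S : Cobordism a b) (T : Cobordism b c) : sg S ≫ sg T = sg (S.comp T) :=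
  single_comp 0 0 0 S T

theorem sg_id (a : TLDiagram n) : sg (Cobordism.id a) = 𝟙 (of 0 a) := single_id 0 a

/-- The surface obtained by cutting the neck over a circle, with a dot on the upper half. -/
noncomputable def cutTop (a : TLDiagram n) :
    Cobordism (TLDiagram.circle.stack a) (TLDiagram.circle.stack a) :=
  ((Cobordism.dotCircle n).comp ((Cobordism.death n).comp (Cobordism.birth n))).tensor
    (Cobordism.id a)

/-- The surface obtained by cutting the neck over a circle, with a dot on the lower half. -/
noncomputable def cutBot (a : TLDiagram n) :
    Cobordism (TLDiagram.circle.stack a) (TLDiagram.circle.stack a) :=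
  (((Cobordism.death n).comp (Cobordism.birth n)).comp (Cobordism.dotCircle n)).tensor
    (Cobordism.id a)

instance (a : TLDiagram n) (D : SurfaceData)
    [h : Cobordism.HasTable (((Cobordism.dotCircle n).comp ((Cobordism.death n).comp
      (Cobordism.birth n))).tensor (Cobordism.id a)) D] : Cobordism.HasTable (cutTop a) D := h

instance (a : TLDiagram n) (D : SurfaceData)
    [h : Cobordism.HasTable ((((Cobordism.death n).comp (Cobordism.birth n)).comp
      (Cobordism.dotCircle n)).tensor (Cobordism.id a)) D] : Cobordism.HasTable (cutBot a) D := h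

/-- The neck relation is imposed next to the identity diagram only. Applying `- ⊗ a` places it next
to an arbitrary diagram. -/
theorem sg_circle (a : TLDiagram n) :
    sg (Cobordism.id (TLDiagram.circle.stack a)) = sg (cutTop a) + sg (cutBot a) := by
  have h : single 0 0 (Cobordism.id (.circle : TLDiagram n)) =
      single 0 0 ((Cobordism.dotCircle n).comp ((Cobordism.death n).comp (Cobordism.birth n))) +
      single 0 0 (((Cobordism.death n).comp (Cobordism.birth n)).comp (Cobordism.dotCircle n)) :=
    (CategoryTheory.Quotient.sound _ (PreCob.Rel.neck (n := n) 0)).trans (quotient n).map_add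
  have h' := congrArg (tensorRight ⟨0, a⟩).map h
  rw [Functor.map_add] at h'
  have e1 := tensorRight_single a 0 0 (Cobordism.id (.circle : TLDiagram n))
  rw [Cobordism.id_tensor_id] at e1
  exact e1.symm.trans (h'.trans (congrArg₂ _ (tensorRight_single a 0 0 _)
    (tensorRight_single a 0 0 _)))

/-- The neck cutting relation, for a surface factored through a diagram with a circle. -/
theorem sg_neck (P : Cobordism a (TLDiagram.circle.stack c))
    (Q : Cobordism (TLDiagram.circle.stack c) b) (S S₁ S₂ : Cobordism a b) (h : S = P.comp Q)
    (h₁ : S₁ = (P.comp (cutTop c)).comp Q) (h₂ : S₂ = (P.comp (cutBot c)).comp Q) :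
    sg S = sg S₁ + sg S₂ := by
  have e : S = (P.comp (Cobordism.id _)).comp Q := by rw [Cobordism.comp_id, h]
  rw [e, h₁, h₂, ← sg_comp, ← sg_comp, ← sg_comp, ← sg_comp, ← sg_comp, ← sg_comp, sg_circle,
    Preadditive.comp_add, Preadditive.add_comp]

/-- The neck cutting relation, with the surfaces compared by their tables. -/
theorem sg_neck_of_check (P : Cobordism a (TLDiagram.circle.stack c))
    (Q : Cobordism (TLDiagram.circle.stack c) b) {S S₁ S₂ : Cobordism a b}
    {D D₁ D₂ D' D₁' D₂' : SurfaceData} [Cobordism.HasTable S D] [Cobordism.HasTable S₁ D₁]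
    [Cobordism.HasTable S₂ D₂] [Cobordism.HasTable (P.comp Q) D']
    [Cobordism.HasTable ((P.comp (cutTop c)).comp Q) D₁']
    [Cobordism.HasTable ((P.comp (cutBot c)).comp Q) D₂']
    (h : D.check D' = true ∧ D₁.check D₁' = true ∧ D₂.check D₂' = true) :
    sg S = sg S₁ + sg S₂ :=
  sg_neck P Q S S₁ S₂ (Cobordism.eq_of_check _ _ h.1) (Cobordism.eq_of_check _ _ h.2.1)
    (Cobordism.eq_of_check _ _ h.2.2)

/-- A change of the gradings of source and target. -/
noncomputable def regrade (s t : ℤ) (f : of 0 a ⟶ of 0 b) : of s a ⟶ of t b :=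
  single s 0 (Cobordism.id a) ≫ f ≫ single 0 t (Cobordism.id b)

theorem regrade_sg (s t : ℤ) (S : Cobordism a b) : regrade s t (sg S) = single s t S := by
  rw [regrade, sg, single_comp, single_comp, Cobordism.id_comp, Cobordism.comp_id]

theorem regrade_comp (s t u : ℤ) (f : of 0 a ⟶ of 0 b) (g : of 0 b ⟶ of 0 c) :
    regrade s t f ≫ regrade t u g = regrade s u (f ≫ g) := by
  have h : single 0 t (Cobordism.id b) ≫ single t 0 (Cobordism.id b) = 𝟙 (of 0 b) := by
    rw [single_comp, Cobordism.id_comp, single_id]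
  simp only [regrade, Category.assoc]
  rw [← Category.assoc (single 0 t _), h, Category.id_comp]

theorem regrade_add (s t : ℤ) (f g : of 0 a ⟶ of 0 b) :
    regrade s t (f + g) = regrade s t f + regrade s t g := by
  simp [regrade]

theorem regrade_neg (s t : ℤ) (f : of 0 a ⟶ of 0 b) :
    regrade s t (-f) = -regrade s t f := by
  simp [regrade]

theorem regrade_zero (s t : ℤ) : regrade s t (0 : of 0 a ⟶ of 0 b) = 0 := by
  simp [regrade]

/-- The functor `z ⊗ -` on morphisms without a shift. -/
noncomputable def whiskerL (z : TLDiagram n) (f : of 0 a ⟶ of 0 b) :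
    of 0 (z.stack a) ⟶ of 0 (z.stack b) :=
  (tensorLeft ⟨0, z⟩).map f

/-- The functor `- ⊗ z` on morphisms without a shift. -/
noncomputable def whiskerR (z : TLDiagram n) (f : of 0 a ⟶ of 0 b) :
    of 0 (a.stack z) ⟶ of 0 (b.stack z) :=
  (tensorRight ⟨0, z⟩).map f

theorem whiskerL_sg (z : TLDiagram n) (S : Cobordism a b) :
    whiskerL z (sg S) = sg ((Cobordism.id z).tensor S) := tensorLeft_single z 0 0 S

theorem whiskerR_sg (z : TLDiagram n) (S : Cobordism a b) :
    whiskerR z (sg S) = sg (S.tensor (Cobordism.id z)) := tensorRight_single z 0 0 S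

theorem whiskerL_add (z : TLDiagram n) (f g : of 0 a ⟶ of 0 b) :
    whiskerL z (f + g) = whiskerL z f + whiskerL z g :=
  (tensorLeft ⟨0, z⟩).map_add

theorem whiskerR_add (z : TLDiagram n) (f g : of 0 a ⟶ of 0 b) :
    whiskerR z (f + g) = whiskerR z f + whiskerR z g :=
  (tensorRight ⟨0, z⟩).map_add

theorem whiskerL_neg (z : TLDiagram n) (f : of 0 a ⟶ of 0 b) :
    whiskerL z (-f) = -whiskerL z f :=
  (tensorLeft ⟨0, z⟩).map_neg

theorem whiskerR_neg (z : TLDiagram n) (f : of 0 a ⟶ of 0 b) :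
    whiskerR z (-f) = -whiskerR z f :=
  (tensorRight ⟨0, z⟩).map_neg

end Cob

/-! ### Removing the gradings from the differential. -/

namespace ThirdProjector

open Cob

/-- A cobordism does not see the gradings of its ends. Every identity between the periodic matrices
therefore follows from the one with all shifts equal to zero. -/
theorem matrix_eq_regrade : ∀ (m : ℕ) (i j : ℤ) (s t : Fin 2),
    matrix m i j s t = regrade i j (matrix m 0 0 s t)
  | 0, i, j, s, t => by
    fin_cases s <;> fin_cases t
    · exact (regrade_sg i j _).symm
    · exact ((regrade_neg i j _).trans (congrArg _ (regrade_sg i j _))).symm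
    · exact ((regrade_neg i j _).trans (congrArg _ (regrade_sg i j _))).symm
    · exact (regrade_sg i j _).symm
  | 1, i, j, s, t => by
    fin_cases s <;> fin_cases t
    · exact ((regrade_add i j _ _).trans (congrArg₂ _ (regrade_sg i j _) (regrade_sg i j _))).symm
    · exact (regrade_sg i j _).symm
    · exact (regrade_sg i j _).symm
    · exact ((regrade_add i j _ _).trans (congrArg₂ _ (regrade_sg i j _) (regrade_sg i j _))).symm
  | 2, i, j, s, t => by
    fin_cases s <;> fin_cases t
    · exact (regrade_sg i j _).symm
    · exact ((regrade_neg i j _).trans (congrArg _ (regrade_sg i j _))).symm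
    · exact ((regrade_neg i j _).trans (congrArg _ (regrade_sg i j _))).symm
    · exact (regrade_sg i j _).symm
  | 3, i, j, s, t => by
    fin_cases s <;> fin_cases t
    · exact ((regrade_add i j _ _).trans (congrArg₂ _ (regrade_sg i j _) (regrade_sg i j _))).symm
    · exact (regrade_sg i j _).symm
    · exact (regrade_sg i j _).symm
    · exact ((regrade_add i j _ _).trans (congrArg₂ _ (regrade_sg i j _) (regrade_sg i j _))).symm
  | m + 4, i, j, s, t => matrix_eq_regrade m i j s t

end ThirdProjector

namespace ThirdProjector

open Cob Cobordism

/-! ## The differential squares to zero -/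

/-- The two generators. -/
abbrev gen (i : Fin 2) : TLDiagram 3 := .e i

/-- The outer strand on which a generator acts. -/
def outer (i : Fin 2) : Fin 3 := if i = 0 then 0 else 2

variable {i j : Fin 2}

/-- The two saddles occur in different places and commute: both composites are the same surface from
`1` to `e_ie_j`, and the sign in `B` cancels them. -/
theorem saddle_comp_matrixB (h : i ≠ j) :
    sg (saddle (n := 3) i) ≫ sg (saddleBelow (gen i) j) +
      sg (saddle (n := 3) j) ≫ (-sg (saddleAbove i (gen j))) = 0 := by
  have e : (saddle (n := 3) i).comp (saddleBelow (gen i) j) =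
      (saddle j).comp (saddleAbove i (gen j)) :=
    eq_of_check _ _ (by revert i j; decide +kernel)
  rw [Preadditive.comp_neg, sg_comp, sg_comp, e, add_neg_cancel]

/-- The saddle above `e_i` followed by its reverse is a tube between the upper turnback and the
through strand. Cutting it gives a dot on either. The final saddle joins the through strand to the
lower turnback, so the second dot becomes a dot there. -/
theorem matrixB_comp_matrixC_diag (h : i ≠ j) :
    sg (saddleBelow (gen i) j) ≫
        (sg (dot ((gen i).stack (gen j)) (((gen i).stack (gen j)).top (outer i))) +
          sg (dot ((gen i).stack (gen j)) (((gen i).stack (gen j)).bot (outer j)))) +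
      (-sg (saddleAbove j (gen i))) ≫
        sg ((saddleAbove' j (gen i)).comp (saddleBelow (gen i) j)) = 0 := by
  rw [Preadditive.comp_add, Preadditive.neg_comp, sg_comp, sg_comp, sg_comp]
  exact add_neg_eq_zero.2
    (sg_neck_of_check (split (gen i) ((gen i).top (outer i)))
      ((merge (gen i) ((gen i).top (outer j))).comp (saddleBelow (gen i) j))
    (by revert i j; decide +kernel)).symm

/-- The three saddles amount to a tube between the upper and the lower turnback of `e_i`, followed
by the single saddle `e_i → e_je_i`. -/
theorem matrixB_comp_matrixC_off (h : i ≠ j) :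
    sg (saddleBelow (gen i) j) ≫ sg ((saddleAbove' i (gen j)).comp (saddleBelow (gen j) i)) +
      (-sg (saddleAbove j (gen i))) ≫
        (sg (dot ((gen j).stack (gen i)) (((gen j).stack (gen i)).top (outer j))) +
          sg (dot ((gen j).stack (gen i)) (((gen j).stack (gen i)).bot (outer i)))) = 0 := by
  rw [Preadditive.comp_add, Preadditive.neg_comp, Preadditive.neg_comp, sg_comp, sg_comp, sg_comp,
    ← neg_add]
  exact add_neg_eq_zero.2
    (sg_neck_of_check (split (gen i) ((gen i).top (outer i)))
      ((merge (gen i) ((gen i).bot (outer i))).comp (saddleAbove j (gen i)))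
    (by revert i j; decide +kernel))

/-- Again three saddles equal a tube between the two turnbacks followed by one saddle, here the
saddle `e_ie_j → e_i`. For the off-diagonal entries below, the remaining saddle is `e_ie_j → e_j`.
-/
theorem matrixC_comp_matrixD_diag (h : i ≠ j) :
    (sg (dot ((gen i).stack (gen j)) (((gen i).stack (gen j)).top (outer i))) +
        sg (dot ((gen i).stack (gen j)) (((gen i).stack (gen j)).bot (outer j)))) ≫
        sg (saddleBelow' (gen i) j) +
      sg ((saddleAbove' i (gen j)).comp (saddleBelow (gen j) i)) ≫
        (-sg (saddleAbove' j (gen i))) = 0 := by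
  rw [Preadditive.add_comp, Preadditive.comp_neg, sg_comp, sg_comp, sg_comp]
  exact add_neg_eq_zero.2
    (sg_neck_of_check (split _ (((gen i).stack (gen j)).top (outer i)))
      ((merge _ (((gen i).stack (gen j)).bot (outer j))).comp (saddleBelow' (gen i) j))
    (by revert i j; decide +kernel)).symm

theorem matrixC_comp_matrixD_off (h : i ≠ j) :
    (sg (dot ((gen i).stack (gen j)) (((gen i).stack (gen j)).top (outer i))) +
        sg (dot ((gen i).stack (gen j)) (((gen i).stack (gen j)).bot (outer j)))) ≫
        (-sg (saddleAbove' i (gen j))) +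
      sg ((saddleAbove' i (gen j)).comp (saddleBelow (gen j) i)) ≫
        sg (saddleBelow' (gen j) i) = 0 := by
  rw [Preadditive.comp_neg, Preadditive.add_comp, sg_comp, sg_comp, sg_comp]
  exact neg_add_eq_zero.2
    (sg_neck_of_check (split _ (((gen i).stack (gen j)).top (outer i)))
      ((merge _ (((gen i).stack (gen j)).bot (outer j))).comp (saddleAbove' i (gen j)))
    (by revert i j; decide +kernel)).symm

/-- Here the dots sit on the target, so the tube between the turnbacks comes after the remaining
saddle. -/
theorem matrixD_comp_matrixE_diag (h : i ≠ j) :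
    sg (saddleBelow' (gen i) j) ≫
        (sg (dot (gen i) ((gen i).top (outer i))) + sg (dot (gen i) ((gen i).bot (outer i)))) +
      (-sg (saddleAbove' i (gen j))) ≫ sg ((saddle' (n := 3) j).comp (saddle i)) = 0 := by
  rw [Preadditive.comp_add, Preadditive.neg_comp, sg_comp, sg_comp, sg_comp]
  exact add_neg_eq_zero.2
    (sg_neck_of_check ((saddleBelow' (gen i) j).comp (split _ ((gen i).top (outer i))))
      (merge _ ((gen i).bot (outer i)))
    (by revert i j; decide +kernel)).symm

theorem matrixD_comp_matrixE_off (h : i ≠ j) :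
    sg (saddleBelow' (gen i) j) ≫ sg ((saddle' (n := 3) i).comp (saddle j)) +
      (-sg (saddleAbove' i (gen j))) ≫
        (sg (dot (gen j) ((gen j).top (outer j))) + sg (dot (gen j) ((gen j).bot (outer j)))) =
      0 := by
  rw [Preadditive.neg_comp, Preadditive.comp_add, sg_comp, sg_comp, sg_comp]
  exact add_neg_eq_zero.2
    (sg_neck_of_check ((saddleAbove' i (gen j)).comp (split _ ((gen j).top (outer j))))
      (merge _ ((gen j).bot (outer j)))
    (by revert i j; decide +kernel))

/-- Passing from `e_i` through `1` and `e_j` to `e_ie_j` is a tube between the two turnbacks of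
`e_i`, followed by the saddle below. -/
theorem matrixE_comp_matrixB_diag (h : i ≠ j) :
    (sg (dot (gen i) ((gen i).top (outer i))) + sg (dot (gen i) ((gen i).bot (outer i)))) ≫
        sg (saddleBelow (gen i) j) +
      sg ((saddle' (n := 3) i).comp (saddle j)) ≫ (-sg (saddleAbove i (gen j))) = 0 := by
  rw [Preadditive.add_comp, Preadditive.comp_neg, sg_comp, sg_comp, sg_comp]
  exact add_neg_eq_zero.2
    (sg_neck_of_check (split _ ((gen i).top (outer i)))
      ((merge _ ((gen i).bot (outer i))).comp (saddleBelow (gen i) j))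
    (by revert i j; decide +kernel)).symm

theorem matrixE_comp_matrixB_off (h : i ≠ j) :
    (sg (dot (gen i) ((gen i).top (outer i))) + sg (dot (gen i) ((gen i).bot (outer i)))) ≫
        (-sg (saddleAbove j (gen i))) +
      sg ((saddle' (n := 3) i).comp (saddle j)) ≫ sg (saddleBelow (gen j) i) = 0 := by
  rw [Preadditive.comp_neg, Preadditive.add_comp, sg_comp, sg_comp, sg_comp]
  exact neg_add_eq_zero.2
    (sg_neck_of_check (split _ ((gen i).top (outer i)))
      ((merge _ ((gen i).bot (outer i))).comp (saddleAbove j (gen i)))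
    (by revert i j; decide +kernel)).symm

theorem zero_ne_one : (0 : Fin 2) ≠ 1 := by decide

theorem one_ne_zero : (1 : Fin 2) ≠ 0 := by decide

/-- For `i = 1` the summand attached to `i` stands second in the matrices. -/
theorem sum_eq_of_swap {M : Type*} [AddCommMonoid M] {f : Fin 2 → M} {z : M}
    (h : f 1 + f 0 = z) : ∑ t, f t = z := by
  rw [Fin.sum_univ_two, add_comm, h]

theorem sum_eq_of_add {M : Type*} [AddCommMonoid M] {f : Fin 2 → M} {z : M}
    (h : f 0 + f 1 = z) : ∑ t, f t = z := by
  rw [Fin.sum_univ_two, h]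

theorem matrix_comp_matrix : ∀ (m : ℕ) (s u : Fin 2),
    ∑ t, matrix m 0 0 s t ≫ matrix (m + 1) 0 0 t u = 0
  | 0, s, u => by
    fin_cases s <;> fin_cases u
    · exact sum_eq_of_add (matrixB_comp_matrixC_diag zero_ne_one)
    · exact sum_eq_of_add (matrixB_comp_matrixC_off zero_ne_one)
    · exact sum_eq_of_swap (matrixB_comp_matrixC_off one_ne_zero)
    · exact sum_eq_of_swap (matrixB_comp_matrixC_diag one_ne_zero)
  | 1, s, u => by
    fin_cases s <;> fin_cases u
    · exact sum_eq_of_add (matrixC_comp_matrixD_diag zero_ne_one)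
    · exact sum_eq_of_add (matrixC_comp_matrixD_off zero_ne_one)
    · exact sum_eq_of_swap (matrixC_comp_matrixD_off one_ne_zero)
    · exact sum_eq_of_swap (matrixC_comp_matrixD_diag one_ne_zero)
  | 2, s, u => by
    fin_cases s <;> fin_cases u
    · exact sum_eq_of_add (matrixD_comp_matrixE_diag zero_ne_one)
    · exact sum_eq_of_add (matrixD_comp_matrixE_off zero_ne_one)
    · exact sum_eq_of_swap (matrixD_comp_matrixE_off one_ne_zero)
    · exact sum_eq_of_swap (matrixD_comp_matrixE_diag one_ne_zero)
  | 3, s, u => by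
    fin_cases s <;> fin_cases u
    · exact sum_eq_of_add (matrixE_comp_matrixB_diag zero_ne_one)
    · exact sum_eq_of_add (matrixE_comp_matrixB_off zero_ne_one)
    · exact sum_eq_of_swap (matrixE_comp_matrixB_off one_ne_zero)
    · exact sum_eq_of_swap (matrixE_comp_matrixB_diag one_ne_zero)
  | m + 4, s, u => matrix_comp_matrix m s u

theorem regrade_sum {a b : TLDiagram 3} (s t : ℤ) (f : Fin 2 → (Cob.of 0 a ⟶ Cob.of 0 b)) :
    regrade s t (∑ r, f r) = ∑ r, regrade s t (f r) := by
  rw [Fin.sum_univ_two, Fin.sum_univ_two, regrade_add]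

/-- The entries of the first differential, without a shift. -/
noncomputable def entryA (t : Fin 2) : Cob.of 0 (.one : TLDiagram 3) ⟶ Cob.of 0 (diagram 0 t) :=
  match t with
  | 0 => sg (saddle 0)
  | 1 => sg (saddle 1)

theorem matrixA_eq_regrade (u : PUnit) (t : Fin 2) : matrixA u t = regrade 0 1 (entryA t) := by
  fin_cases t
  · exact (regrade_sg 0 1 _).symm
  · exact (regrade_sg 0 1 _).symm

theorem entryA_comp_matrix (u : Fin 2) : ∑ t, entryA t ≫ matrix 0 0 0 t u = 0 := by
  fin_cases u
  · exact sum_eq_of_add (saddle_comp_matrixB zero_ne_one)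
  · exact sum_eq_of_swap (saddle_comp_matrixB one_ne_zero)

theorem d_comp_d : ∀ k : ℤ, d k ≫ d (k + 1) = 0
  | .ofNat 0 => by
    ext u (t : Fin 2)
    refine (Mat_.comp_apply (M := term 0) (N := term 1) (K := term 2) matrixA _ u t).trans ?_
    have h (r : Fin 2) : matrixA u r ≫ matrix 0 1 2 r t =
        regrade 0 2 (entryA r ≫ matrix 0 0 0 r t) :=
      (congrArg₂ (· ≫ ·) (matrixA_eq_regrade u r) (matrix_eq_regrade 0 1 2 r t)).trans
        (regrade_comp _ _ _ _ _)
    refine (Finset.sum_congr rfl fun r _ => h r).trans ?_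
    refine (regrade_sum _ _ _).symm.trans ?_
    rw [entryA_comp_matrix, regrade_zero]
    rfl
  | .ofNat (m + 1) => by
    ext (s : Fin 2) (t : Fin 2)
    refine (Mat_.comp_apply (M := term (m + 1)) (N := term (m + 2)) (K := term (m + 3)) _ _ s t).trans ?_
    have h (r : Fin 2) : matrix m (shift m) (shift (m + 1)) s r ≫
        matrix (m + 1) (shift (m + 1)) (shift (m + 2)) r t =
        regrade (shift m) (shift (m + 2)) (matrix m 0 0 s r ≫ matrix (m + 1) 0 0 r t) := by
      rw [matrix_eq_regrade m, matrix_eq_regrade (m + 1), regrade_comp]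
    refine (Finset.sum_congr rfl fun r _ => h r).trans ?_
    refine (regrade_sum _ _ _).symm.trans ?_
    rw [matrix_comp_matrix, regrade_zero]
    rfl
  | .negSucc _ => zero_comp

end ThirdProjector

/-! ## The contracting homotopy in an abstract setting -/

/-- Objects and morphisms of a preadditive category that behave like the terms of the third
projector stacked on a turnback. The objects `EE` and `FF` are `E` and `F` together with a circle,
with births `β`, `βF`, deaths `δ`, `δF` and dots `x`, `xF` of the circle. The matrices
`B = (bb, nρ; nτ, κ)`, `C`, `D = (bb', nτ'; nρ', κ')` and `H` are the periodic differentials. -/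
structure TurnbackCalculus (C : Type*) [Category C] [Preadditive C] where
  (E F EE FF G : C)
  (σ : E ⟶ EE) (σ' : EE ⟶ E) (b : E ⟶ F) (b' : F ⟶ E)
  (bb : EE ⟶ FF) (bb' : FF ⟶ EE) (τ nτ : F ⟶ FF) (τ' nτ' : FF ⟶ F)
  (ρ nρ : EE ⟶ G) (ρ' nρ' : G ⟶ EE) (κ : F ⟶ G) (κ' : G ⟶ F)
  (δ : EE ⟶ E) (β : E ⟶ EE) (δF : FF ⟶ F) (βF : F ⟶ FF)
  (x l t : EE ⟶ EE) (xF lF tF : FF ⟶ FF)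
  (C₁₁ : FF ⟶ FF) (C₁₂ : FF ⟶ G) (C₂₁ : G ⟶ FF) (C₂₂ : G ⟶ G)
  (H₁₁ : EE ⟶ EE) (H₁₂ : EE ⟶ F) (H₂₁ : F ⟶ EE) (H₂₂ : F ⟶ F)
  nτ_eq : nτ = -τ
  nτ'_eq : nτ' = -τ'
  nρ_eq : nρ = -ρ
  nρ'_eq : nρ' = -ρ'
  C₁₁_eq : C₁₁ = xF + lF
  C₁₂_eq : C₁₂ = τ' ≫ κ
  C₂₁_eq : C₂₁ = ρ' ≫ bb
  H₁₁_eq : H₁₁ = x + l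
  H₁₂_eq : H₁₂ = σ' ≫ b
  H₂₁_eq : H₂₁ = b' ≫ σ
  σ_δ : σ ≫ δ = 𝟙 E
  β_σ' : β ≫ σ' = 𝟙 E
  τ_δF : τ ≫ δF = 𝟙 F
  βF_τ' : βF ≫ τ' = 𝟙 F
  bb_δF : bb ≫ δF = δ ≫ b
  β_bb : β ≫ bb = b ≫ βF
  bb'_δ : bb' ≫ δ = δF ≫ b'
  βF_bb' : βF ≫ bb' = b' ≫ β
  ρ'_δ_β_ρ : (ρ' ≫ δ) ≫ (β ≫ ρ) = 𝟙 G
  neck : x ≫ δ ≫ β + δ ≫ β ≫ x = 𝟙 EE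
  neckF : xF ≫ δF ≫ βF + δF ≫ βF ≫ xF = 𝟙 FF
  l_comm : l ≫ δ ≫ β = δ ≫ β ≫ l
  t_comm : t ≫ δ ≫ β = δ ≫ β ≫ t
  lF_comm : lF ≫ δF ≫ βF = δF ≫ βF ≫ lF
  σ'_σ : σ' ≫ σ = x + l
  ρ_ρ' : ρ ≫ ρ' = x + t
  bb_bb' : bb ≫ bb' = l + t
  τ'_τ : τ' ≫ τ = xF + tF
  bb'_bb : bb' ≫ bb = lF + tF
  κ_ρ' : κ ≫ ρ' = b' ≫ σ
  ρ_κ' : ρ ≫ κ' = σ' ≫ b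

namespace TurnbackCalculus

variable {C : Type*} [Category C] [Preadditive C] (K : TurnbackCalculus C)

/-- A saddle that splits off a circle is a birth followed by a tube to the new circle. Cutting this
tube leaves a dot on the circle or on the neighbouring turnback. -/
theorem σ_eq : K.σ = K.β ≫ (K.x + K.l) := by
  rw [← K.σ'_σ, ← Category.assoc, K.β_σ', Category.id_comp]

theorem τ_eq : K.τ = K.βF ≫ (K.xF + K.tF) := by
  rw [← K.τ'_τ, ← Category.assoc, K.βF_τ', Category.id_comp]

theorem τ'_eq : K.τ' = (K.xF + K.tF) ≫ K.δF := by
  rw [← K.τ'_τ, Category.assoc, K.τ_δF, Category.comp_id]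

theorem κ_θ : K.κ ≫ K.ρ' ≫ K.δ = K.b' := by
  rw [← Category.assoc, K.κ_ρ', Category.assoc, K.σ_δ, Category.comp_id]

theorem θ_κ' : K.β ≫ K.ρ ≫ K.κ' = K.b := by
  rw [K.ρ_κ', ← Category.assoc, K.β_σ', Category.id_comp]

/-- By `ρ'_δ_β_ρ`, the map `ρ' ≫ δ : G ⟶ E` followed by `β ≫ ρ` is the identity of `G`, reflecting
the isotopy between `G` and `E`. This expresses `κ` by `b'`, and likewise `κ'` by `b`. -/
theorem κ_eq : K.κ = K.b' ≫ K.β ≫ K.ρ := by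
  rw [← K.κ_θ, Category.assoc, Category.assoc, ← Category.assoc K.ρ', K.ρ'_δ_β_ρ,
    Category.comp_id]

theorem κ'_eq : K.κ' = (K.ρ' ≫ K.δ) ≫ K.b := by
  rw [← K.θ_κ', ← Category.assoc K.β, ← Category.assoc (K.ρ' ≫ K.δ), K.ρ'_δ_β_ρ,
    Category.id_comp]

/-! The entries of the contracting homotopy. -/

/-- From the second to the first term, on `FF ⟶ EE`. -/
def h₂₁₁ : K.FF ⟶ K.EE := -(K.δF ≫ K.b' ≫ K.β)

/-- From the second to the first term, on `FF ⟶ F`. -/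
def h₂₁₂ : K.FF ⟶ K.F := -K.δF

/-- From the second to the first term, on `G ⟶ EE`. -/
def h₂₂₁ : K.G ⟶ K.EE := -((K.ρ' ≫ K.δ) ≫ K.β)

/-- From the third to the second term, on `FF ⟶ FF`. -/
def h₃₁₁ : K.FF ⟶ K.FF := K.δF ≫ K.βF

/-- From the fourth to the third term, on `EE ⟶ FF`. -/
def h₄₁₁ : K.EE ⟶ K.FF := -(K.δ ≫ K.b ≫ K.βF)

/-- From the fourth to the third term, on `EE ⟶ G`. -/
def h₄₁₂ : K.EE ⟶ K.G := -(K.δ ≫ K.β ≫ K.ρ)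

/-- From the fourth to the third term, on `F ⟶ FF`. -/
def h₄₂₁ : K.F ⟶ K.FF := -K.βF

/-- From the fifth to the fourth term, on `EE ⟶ EE`. -/
def h₅₁₁ : K.EE ⟶ K.EE := K.δ ≫ K.β

theorem zeroth : K.σ ≫ K.δ + K.b ≫ (0 : K.F ⟶ K.E) = 𝟙 K.E := by
  rw [K.σ_δ, comp_zero, add_zero]

theorem bb_h₂₁₁ : K.bb ≫ K.h₂₁₁ = -(K.δ ≫ K.β ≫ (K.l + K.t)) := by
  rw [h₂₁₁, Preadditive.comp_neg, ← Category.assoc, K.bb_δF, ← K.βF_bb', Category.assoc,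
    ← Category.assoc K.b, ← K.β_bb, Category.assoc, K.bb_bb']

theorem nρ_h₂₂₁ : K.nρ ≫ K.h₂₂₁ = (K.x + K.t) ≫ K.δ ≫ K.β := by
  rw [h₂₂₁, K.nρ_eq, Preadditive.neg_comp, Preadditive.comp_neg, neg_neg, ← K.ρ_ρ']
  simp only [Category.assoc]

/-- The three terms are `δ ≫ β ≫ (x + l)`, `-(δ ≫ β ≫ (l + t))` and `(x + t) ≫ δ ≫ β`. The dots `l`
and `t` lie off the circle: `l` cancels outright and `t` commutes with `δ ≫ β`, so only the neck
relation for `x` is left. -/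
theorem first₁₁ :
    K.δ ≫ K.σ + (K.bb ≫ K.h₂₁₁ + K.nρ ≫ K.h₂₂₁) = 𝟙 K.EE := by
  rw [K.bb_h₂₁₁, K.nρ_h₂₂₁, K.σ_eq, ← K.neck]
  simp only [Preadditive.comp_add, Preadditive.add_comp, K.t_comm]
  abel

theorem first₁₂ : K.δ ≫ K.b + (K.bb ≫ K.h₂₁₂ + K.nρ ≫ (0 : K.G ⟶ K.F)) = 0 := by
  rw [h₂₁₂, Preadditive.comp_neg, K.bb_δF, comp_zero, add_zero, add_neg_cancel]

theorem nτ_h₂₁₁ : K.nτ ≫ K.h₂₁₁ + K.κ ≫ K.h₂₂₁ = 0 := by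
  rw [h₂₁₁, h₂₂₁, K.nτ_eq, Preadditive.neg_comp, Preadditive.comp_neg, neg_neg,
    Preadditive.comp_neg, ← Category.assoc, K.τ_δF, Category.id_comp, ← Category.assoc, K.κ_θ,
    add_neg_cancel]

theorem nτ_h₂₁₂ : K.nτ ≫ K.h₂₁₂ + K.κ ≫ (0 : K.G ⟶ K.F) = 𝟙 K.F := by
  rw [h₂₁₂, K.nτ_eq, Preadditive.neg_comp, Preadditive.comp_neg, neg_neg, K.τ_δF, comp_zero,
    add_zero]

theorem first₂₁ : (0 : K.F ⟶ K.E) ≫ K.σ + (K.nτ ≫ K.h₂₁₁ + K.κ ≫ K.h₂₂₁) = 0 := by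
  rw [zero_comp, zero_add, K.nτ_h₂₁₁]

theorem first₂₂ :
    (0 : K.F ⟶ K.E) ≫ K.b + (K.nτ ≫ K.h₂₁₂ + K.κ ≫ (0 : K.G ⟶ K.F)) = 𝟙 K.F := by
  rw [zero_comp, zero_add, K.nτ_h₂₁₂]

theorem second₁₁ :
    (K.h₂₁₁ ≫ K.bb + K.h₂₁₂ ≫ K.nτ) + (K.C₁₁ ≫ K.h₃₁₁ + K.C₁₂ ≫ (0 : K.G ⟶ K.FF)) =
      𝟙 K.FF := by
  -- The saddles slide past the death and the birth of the circle, until they meet as `bb' ≫ bb`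
  -- next to the circle of `FF`.
  have e : K.h₂₁₁ ≫ K.bb = -(K.δF ≫ K.βF ≫ (K.lF + K.tF)) := by
    rw [h₂₁₁, Preadditive.neg_comp, Category.assoc, Category.assoc, K.β_bb, ← K.bb'_bb,
      ← Category.assoc K.βF, K.βF_bb', Category.assoc, K.β_bb]
  -- What remains is `δF ≫ βF ≫ (xF - lF) + (xF + lF) ≫ δF ≫ βF`. Since `lF` commutes with `δF ≫
  -- βF`, this is the neck relation for `FF`.
  rw [e, h₂₁₂, K.nτ_eq, K.τ_eq, K.C₁₁_eq, h₃₁₁, comp_zero, add_zero, ← K.neckF,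
    Preadditive.neg_comp, Preadditive.comp_neg, neg_neg]
  simp only [Preadditive.comp_add, Preadditive.add_comp, K.lF_comm]
  abel

theorem second₁₂ :
    (K.h₂₁₁ ≫ K.nρ + K.h₂₁₂ ≫ K.κ) + (K.C₁₁ ≫ (0 : K.FF ⟶ K.G) + K.C₁₂ ≫ (0 : K.G ⟶ K.G)) =
      0 := by
  rw [h₂₁₁, h₂₁₂, K.nρ_eq, K.κ_eq, comp_zero, comp_zero, add_zero, add_zero]
  simp

theorem second₂₁ :
    (K.h₂₂₁ ≫ K.bb + (0 : K.G ⟶ K.F) ≫ K.nτ) +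
      (K.C₂₁ ≫ K.h₃₁₁ + K.C₂₂ ≫ (0 : K.G ⟶ K.FF)) = 0 := by
  have e : K.C₂₁ ≫ K.h₃₁₁ = (K.ρ' ≫ K.δ) ≫ K.β ≫ K.bb := by
    rw [K.C₂₁_eq, h₃₁₁, Category.assoc, ← Category.assoc K.bb, K.bb_δF, K.β_bb]
    simp only [Category.assoc]
  rw [e, h₂₂₁]
  simp

theorem second₂₂ :
    (K.h₂₂₁ ≫ K.nρ + (0 : K.G ⟶ K.F) ≫ K.κ) +
      (K.C₂₁ ≫ (0 : K.FF ⟶ K.G) + K.C₂₂ ≫ (0 : K.G ⟶ K.G)) = 𝟙 K.G := by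
  rw [h₂₂₁, K.nρ_eq, Preadditive.neg_comp, Preadditive.comp_neg, neg_neg, Category.assoc,
    K.ρ'_δ_β_ρ]
  simp

/-- The computation of `second₁₁` read backwards: the dots `tF` cancel and `lF` commutes, leaving
the neck relation. -/
theorem third₁₁ :
    (K.h₃₁₁ ≫ K.C₁₁ + (0 : K.FF ⟶ K.G) ≫ K.C₂₁) + (K.bb' ≫ K.h₄₁₁ + K.nτ' ≫ K.h₄₂₁) =
      𝟙 K.FF := by
  have e : K.bb' ≫ K.h₄₁₁ = -((K.lF + K.tF) ≫ K.δF ≫ K.βF) := by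
    rw [h₄₁₁, Preadditive.comp_neg, ← K.bb'_bb, Category.assoc, ← Category.assoc K.bb, K.bb_δF,
      Category.assoc]
  rw [e, h₄₂₁, K.nτ'_eq, K.τ'_eq, K.C₁₁_eq, h₃₁₁, zero_comp, add_zero, ← K.neckF,
    Preadditive.neg_comp, Preadditive.comp_neg, neg_neg]
  simp only [Preadditive.comp_add, Preadditive.add_comp, Category.assoc, K.lF_comm]
  abel

theorem third₁₂ :
    (K.h₃₁₁ ≫ K.C₁₂ + (0 : K.FF ⟶ K.G) ≫ K.C₂₂) +
      (K.bb' ≫ K.h₄₁₂ + K.nτ' ≫ (0 : K.F ⟶ K.G)) = 0 := by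
  have e : K.bb' ≫ K.h₄₁₂ = -(K.δF ≫ K.κ) := by
    rw [h₄₁₂, Preadditive.comp_neg, ← Category.assoc, K.bb'_δ, Category.assoc, ← K.κ_eq]
  rw [e, h₃₁₁, K.C₁₂_eq, Category.assoc, ← Category.assoc K.βF, K.βF_τ']
  simp

theorem third₂₁ :
    ((0 : K.G ⟶ K.FF) ≫ K.C₁₁ + (0 : K.G ⟶ K.G) ≫ K.C₂₁) +
      (K.nρ' ≫ K.h₄₁₁ + K.κ' ≫ K.h₄₂₁) = 0 := by
  rw [K.κ'_eq, h₄₁₁, h₄₂₁, K.nρ'_eq]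
  simp

theorem third₂₂ :
    ((0 : K.G ⟶ K.FF) ≫ K.C₁₂ + (0 : K.G ⟶ K.G) ≫ K.C₂₂) +
      (K.nρ' ≫ K.h₄₁₂ + K.κ' ≫ (0 : K.F ⟶ K.G)) = 𝟙 K.G := by
  rw [h₄₁₂, K.nρ'_eq, ← K.ρ'_δ_β_ρ]
  simp

/-- The mirror image of `first₁₁`: the dots `t` cancel outright and `l` commutes with `δ ≫ β`. -/
theorem fourth₁₁ :
    (K.h₄₁₁ ≫ K.bb' + K.h₄₁₂ ≫ K.nρ') + (K.H₁₁ ≫ K.h₅₁₁ + K.H₁₂ ≫ (0 : K.F ⟶ K.EE)) =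
      𝟙 K.EE := by
  have e : K.h₄₁₁ ≫ K.bb' = -(K.δ ≫ K.β ≫ (K.l + K.t)) := by
    rw [h₄₁₁, Preadditive.neg_comp, Category.assoc, Category.assoc, ← K.bb_bb',
      ← Category.assoc K.β, K.β_bb, Category.assoc]
  have e' : K.h₄₁₂ ≫ K.nρ' = K.δ ≫ K.β ≫ (K.x + K.t) := by
    rw [h₄₁₂, K.nρ'_eq, Preadditive.neg_comp, Preadditive.comp_neg, neg_neg, Category.assoc,
      Category.assoc, K.ρ_ρ']
  rw [e, e', K.H₁₁_eq, h₅₁₁, comp_zero, add_zero, ← K.neck]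
  simp only [Preadditive.comp_add, Preadditive.add_comp, K.l_comm]
  abel

theorem fourth₁₂ :
    (K.h₄₁₁ ≫ K.nτ' + K.h₄₁₂ ≫ K.κ') +
      (K.H₁₁ ≫ (0 : K.EE ⟶ K.F) + K.H₁₂ ≫ (0 : K.F ⟶ K.F)) = 0 := by
  have e : K.h₄₁₁ ≫ K.nτ' = K.δ ≫ K.b := by
    rw [h₄₁₁, K.nτ'_eq, Preadditive.neg_comp, Preadditive.comp_neg, neg_neg, Category.assoc,
      Category.assoc, K.βF_τ', Category.comp_id]
  have e' : K.h₄₁₂ ≫ K.κ' = -(K.δ ≫ K.b) := by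
    rw [h₄₁₂, Preadditive.neg_comp, Category.assoc, Category.assoc, K.θ_κ']
  rw [e, e']
  simp

theorem fourth₂₁ :
    (K.h₄₂₁ ≫ K.bb' + (0 : K.F ⟶ K.G) ≫ K.nρ') +
      (K.H₂₁ ≫ K.h₅₁₁ + K.H₂₂ ≫ (0 : K.F ⟶ K.EE)) = 0 := by
  have e : K.H₂₁ ≫ K.h₅₁₁ = K.b' ≫ K.β := by
    rw [K.H₂₁_eq, h₅₁₁, Category.assoc, ← Category.assoc K.σ, K.σ_δ, Category.id_comp]
  rw [e, h₄₂₁, Preadditive.neg_comp, K.βF_bb']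
  simp

theorem fourth₂₂ :
    (K.h₄₂₁ ≫ K.nτ' + (0 : K.F ⟶ K.G) ≫ K.κ') +
      (K.H₂₁ ≫ (0 : K.EE ⟶ K.F) + K.H₂₂ ≫ (0 : K.F ⟶ K.F)) = 𝟙 K.F := by
  rw [h₄₂₁, K.nτ'_eq, Preadditive.neg_comp, Preadditive.comp_neg, neg_neg, K.βF_τ']
  simp

/-- By `σ_eq`, `δ ≫ σ` equals `h₅₁₁ ≫ H₁₁`. The beginning of the complex thus contributes the same
term as the periodic part, and the homotopy can be continued with period four. -/
theorem fifth₁₁ :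
    (K.h₅₁₁ ≫ K.H₁₁ + (0 : K.EE ⟶ K.F) ≫ K.H₂₁) + (K.bb ≫ K.h₂₁₁ + K.nρ ≫ K.h₂₂₁) =
      𝟙 K.EE := by
  rw [← K.first₁₁, K.H₁₁_eq, h₅₁₁, Category.assoc, ← K.σ_eq, zero_comp, add_zero]

theorem fifth₁₂ :
    (K.h₅₁₁ ≫ K.H₁₂ + (0 : K.EE ⟶ K.F) ≫ K.H₂₂) +
      (K.bb ≫ K.h₂₁₂ + K.nρ ≫ (0 : K.G ⟶ K.F)) = 0 := by
  rw [h₅₁₁, K.H₁₂_eq, Category.assoc, ← Category.assoc K.β, K.β_σ', Category.id_comp, zero_comp,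
    add_zero]
  exact K.first₁₂

theorem fifth₂₁ :
    ((0 : K.F ⟶ K.EE) ≫ K.H₁₁ + (0 : K.F ⟶ K.F) ≫ K.H₂₁) +
      (K.nτ ≫ K.h₂₁₁ + K.κ ≫ K.h₂₂₁) = 0 := by
  rw [K.nτ_h₂₁₁]
  simp

theorem fifth₂₂ :
    ((0 : K.F ⟶ K.EE) ≫ K.H₁₂ + (0 : K.F ⟶ K.F) ≫ K.H₂₂) +
      (K.nτ ≫ K.h₂₁₂ + K.κ ≫ (0 : K.G ⟶ K.F)) = 𝟙 K.F := by
  rw [K.nτ_h₂₁₂]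
  simp

end TurnbackCalculus

/-! ## Isotopies, and births and deaths of circles inside a diagram -/

namespace TLDiagram

variable {n : ℕ}

/-- Finiteness makes `IsIsotopy` a decidable condition on labels and the labellings in the state
sums a finite set. -/
instance siteFintype : (a : TLDiagram n) → Fintype a.Site
  | one => inferInstanceAs (Fintype (Fin n))
  | circle => inferInstanceAs (Fintype (Fin n ⊕ Unit))
  | e _ => inferInstanceAs (Fintype (Fin n ⊕ Fin n))
  | stack a b =>
    letI := a.siteFintype
    letI := b.siteFintype
    inferInstanceAs (Fintype (a.Site ⊕ b.Site))

/-- The sites of the upper one of two stacked diagrams. -/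
def inUpper {a b : TLDiagram n} (x : a.Site) : (a.stack b).Site := Sum.inl x

/-- The sites of the lower one of two stacked diagrams. -/
def inLower {a b : TLDiagram n} (x : b.Site) : (a.stack b).Site := Sum.inr x

/-- A map between the sites of two diagrams that comes from an isotopy. -/
abbrev IsIsotopy {a b : TLDiagram n} (f : a.Site → b.Site) : Prop :=
  (∀ x y, b.lab (f x) = b.lab (f y) ↔ a.lab x = a.lab y) ∧ (∀ y, ∃ x, b.lab (f x) = b.lab y) ∧
    (∀ j, b.lab (f (a.top j)) = b.lab (b.top j)) ∧ ∀ j, b.lab (f (a.bot j)) = b.lab (b.bot j)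

/-- The bijection between the components of isotopic diagrams. -/
noncomputable def isotopyEquiv {a b : TLDiagram n} (f : a.Site → b.Site) (h : IsIsotopy f) :
    a.Comp ≃ b.Comp :=
  Equiv.ofBijective (Quot.lift (fun x => Quot.mk _ (f x)) fun x y hxy =>
      (b.lab_eq_iff _ _).1 ((h.1 x y).2 ((a.lab_eq_iff x y).2 (Quot.sound hxy)))) (by
    constructor
    · rintro ⟨x⟩ ⟨y⟩ hxy
      exact (a.lab_eq_iff x y).1 ((h.1 x y).1 ((b.lab_eq_iff _ _).2 hxy))
    · rintro ⟨y⟩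
      obtain ⟨x, hx⟩ := h.2.1 y
      exact ⟨Quot.mk _ x, (b.lab_eq_iff _ _).1 hx⟩)

end TLDiagram

namespace Cobordism

variable {n : ℕ} {a b : TLDiagram n}

/-- The cylinder over an isotopy. -/
noncomputable def isotopy (f : a.Site → b.Site) (h : TLDiagram.IsIsotopy f) : Cobordism a b :=
  cylinder (TLDiagram.isotopyEquiv f h) (fun j => (b.lab_eq_iff _ _).1 (h.2.2.1 j))
    (fun j => (b.lab_eq_iff _ _).1 (h.2.2.2 j))

/-- The cylinder over the inverse of an isotopy. -/
noncomputable def isotopy' (f : a.Site → b.Site) (h : TLDiagram.IsIsotopy f) : Cobordism b a :=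
  cylinder' (TLDiagram.isotopyEquiv f h) (fun j => (b.lab_eq_iff _ _).1 (h.2.2.1 j))
    (fun j => (b.lab_eq_iff _ _).1 (h.2.2.2 j))

instance (f : a.Site → b.Site) (h : TLDiagram.IsIsotopy f) :
    HasTable (isotopy f h) (SurfaceData.cylinder a b f) :=
  hasTable_cylinder _ _ _ _ (fun _ => rfl)

instance (f : a.Site → b.Site) (h : TLDiagram.IsIsotopy f) :
    HasTable (isotopy' f h) (SurfaceData.cylinder a b f).swap :=
  hasTable_cylinder' _ _ _ _ (fun _ => rfl)

/-- The birth of a circle, followed by an isotopy. -/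
noncomputable abbrev birthAt (f : (TLDiagram.circle.stack a).Site → b.Site)
    (h : TLDiagram.IsIsotopy f) : Cobordism a b :=
  (oneStackCyl' a).comp (((birth n).tensor (id a)).comp (isotopy f h))

/-- An isotopy, followed by the death of a circle. -/
noncomputable abbrev deathAt (f : (TLDiagram.circle.stack a).Site → b.Site)
    (h : TLDiagram.IsIsotopy f) : Cobordism b a :=
  (isotopy' f h).comp (((death n).tensor (id a)).comp (oneStackCyl a))

end Cobordism

namespace Cob

theorem sg_eq_of_check {n : ℕ} {a b : TLDiagram n} {S T : Cobordism a b} {D D' : SurfaceData}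
    [Cobordism.HasTable S D] [Cobordism.HasTable T D'] (h : D.check D' = true) : sg S = sg T :=
  congrArg sg (Cobordism.eq_of_check S T h)

end Cob

/-! ### The circles created by stacking the projector on a turnback. -/

namespace ThirdProjector

open Cob Cobordism

variable {i j : Fin 2}

/-- The circle in `e_i ⊗ e_i`, next to `e_i ⊗ 1`. -/
def circleL (i : Fin 2) :
    (TLDiagram.circle.stack ((gen i).stack .one)).Site → ((gen i).stack (gen i)).Site :=
  Sum.elim
    (Sum.elim ((gen i).stack (gen i)).top fun _ => Sum.inl (Sum.inr (TLDiagram.left (n := 3) i)))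
    (Sum.elim (Sum.elim (fun j => Sum.inl (Sum.inl j)) (fun j => Sum.inr (Sum.inr j)))
      (fun j => Sum.inr (Sum.inr j)))

/-- The circle in `e_i ⊗ (e_i ⊗ e_j)`, next to `e_i ⊗ e_j`. -/
def circleLF (i j : Fin 2) : (TLDiagram.circle.stack ((gen i).stack (gen j))).Site →
    ((gen i).stack ((gen i).stack (gen j))).Site :=
  Sum.elim
    (Sum.elim ((gen i).stack ((gen i).stack (gen j))).top
      fun _ => Sum.inl (Sum.inr (TLDiagram.left (n := 3) i)))
    (Sum.elim (Sum.elim (fun k => Sum.inl (Sum.inl k)) (fun k => Sum.inr (Sum.inl (Sum.inr k))))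
      (fun y => Sum.inr (Sum.inr y)))

/-- The circle in `e_i ⊗ e_i`, next to `1 ⊗ e_i`. -/
def circleR (i : Fin 2) :
    (TLDiagram.circle.stack (TLDiagram.one.stack (gen i))).Site → ((gen i).stack (gen i)).Site :=
  Sum.elim
    (Sum.elim ((gen i).stack (gen i)).top fun _ => Sum.inl (Sum.inr (TLDiagram.left (n := 3) i)))
    (Sum.elim (fun j => Sum.inl (Sum.inl j))
      (Sum.elim (fun j => Sum.inl (Sum.inl j)) (fun j => Sum.inr (Sum.inr j))))

/-- The circle in `(e_j ⊗ e_i) ⊗ e_i`, next to `e_j ⊗ e_i`. -/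
def circleRF (i j : Fin 2) : (TLDiagram.circle.stack ((gen j).stack (gen i))).Site →
    (((gen j).stack (gen i)).stack (gen i)).Site :=
  Sum.elim
    (Sum.elim (((gen j).stack (gen i)).stack (gen i)).top
      fun _ => Sum.inr (Sum.inl (TLDiagram.left (n := 3) i)))
    (Sum.elim (fun y => Sum.inl (Sum.inl y))
      (Sum.elim (fun k => Sum.inl (Sum.inr (Sum.inl k))) (fun k => Sum.inr (Sum.inr k))))

theorem isIsotopy_circleL (i : Fin 2) : TLDiagram.IsIsotopy (circleL i) := by
  revert i
  decide +kernel

theorem isIsotopy_circleLF (h : i ≠ j) : TLDiagram.IsIsotopy (circleLF i j) := by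
  revert i j
  decide +kernel

theorem isIsotopy_circleR (i : Fin 2) : TLDiagram.IsIsotopy (circleR i) := by
  revert i
  decide +kernel

theorem isIsotopy_circleRF (h : i ≠ j) : TLDiagram.IsIsotopy (circleRF i j) := by
  revert i j
  decide +kernel

end ThirdProjector

/-! ### The turnback calculus on both sides of the projector. -/

namespace ThirdProjector

open Cob Cobordism

variable {i j : Fin 2}

set_option maxHeartbeats 1000000 in
/-- The terms of the third projector below the turnback `e_i`. -/
noncomputable def calculusL (h : i ≠ j) : TurnbackCalculus (Cob 3) where
  E := Cob.of 0 ((gen i).stack (TLDiagram.one))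
  F := Cob.of 0 ((gen i).stack (gen j))
  EE := Cob.of 0 ((gen i).stack (gen i))
  FF := Cob.of 0 ((gen i).stack ((gen i).stack (gen j)))
  G := Cob.of 0 ((gen i).stack ((gen j).stack (gen i)))
  σ := whiskerL (gen i) (sg (saddle (n := 3) i))
  σ' := whiskerL (gen i) (sg (saddle' (n := 3) i))
  b := whiskerL (gen i) (sg (saddle (n := 3) j))
  b' := whiskerL (gen i) (sg (saddle' (n := 3) j))
  bb := whiskerL (gen i) (sg (saddleBelow (gen i) j))
  τ := whiskerL (gen i) (sg (saddleAbove i (gen j)))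
  nτ := whiskerL (gen i) (-sg (saddleAbove i (gen j)))
  ρ := whiskerL (gen i) (sg (saddleAbove j (gen i)))
  nρ := whiskerL (gen i) (-sg (saddleAbove j (gen i)))
  κ := whiskerL (gen i) (sg (saddleBelow (gen j) i))
  bb' := whiskerL (gen i) (sg (saddleBelow' (gen i) j))
  τ' := whiskerL (gen i) (sg (saddleAbove' i (gen j)))
  nτ' := whiskerL (gen i) (-sg (saddleAbove' i (gen j)))
  ρ' := whiskerL (gen i) (sg (saddleAbove' j (gen i)))
  nρ' := whiskerL (gen i) (-sg (saddleAbove' j (gen i)))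
  κ' := whiskerL (gen i) (sg (saddleBelow' (gen j) i))
  δ := sg (deathAt (circleL i) (isIsotopy_circleL i))
  β := sg (birthAt (circleL i) (isIsotopy_circleL i))
  δF := sg (deathAt (circleLF i j) (isIsotopy_circleLF h))
  βF := sg (birthAt (circleLF i j) (isIsotopy_circleLF h))
  x := whiskerL (gen i) (sg (dot (gen i) ((gen i).top (outer i))))
  l := whiskerL (gen i) (sg (dot (gen i) ((gen i).bot (outer i))))
  t := whiskerL (gen i) (sg (dot (gen i) ((gen i).top (outer j))))
  xF := whiskerL (gen i) (sg (dot ((gen i).stack (gen j)) (((gen i).stack (gen j)).top (outer i))))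
  lF := whiskerL (gen i) (sg (dot ((gen i).stack (gen j)) (((gen i).stack (gen j)).bot (outer j))))
  tF := whiskerL (gen i) (sg (dot ((gen i).stack (gen j)) (((gen i).stack (gen j)).top (outer j))))
  C₁₁ := whiskerL (gen i) (sg (dot ((gen i).stack (gen j)) (((gen i).stack (gen j)).top (outer i))) +
    sg (dot ((gen i).stack (gen j)) (((gen i).stack (gen j)).bot (outer j))))
  C₁₂ := whiskerL (gen i) (sg ((saddleAbove' i (gen j)).comp (saddleBelow (gen j) i)))
  C₂₁ := whiskerL (gen i) (sg ((saddleAbove' j (gen i)).comp (saddleBelow (gen i) j)))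
  C₂₂ := whiskerL (gen i) (sg (dot ((gen j).stack (gen i)) (((gen j).stack (gen i)).top (outer j))) +
    sg (dot ((gen j).stack (gen i)) (((gen j).stack (gen i)).bot (outer i))))
  H₁₁ := whiskerL (gen i) (sg (dot (gen i) ((gen i).top (outer i))) +
    sg (dot (gen i) ((gen i).bot (outer i))))
  H₁₂ := whiskerL (gen i) (sg ((saddle' (n := 3) i).comp (saddle (n := 3) j)))
  H₂₁ := whiskerL (gen i) (sg ((saddle' (n := 3) j).comp (saddle (n := 3) i)))
  H₂₂ := whiskerL (gen i) (sg (dot (gen j) ((gen j).top (outer j))) +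
    sg (dot (gen j) ((gen j).bot (outer j))))
  nτ_eq := whiskerL_neg _ _
  nτ'_eq := whiskerL_neg _ _
  nρ_eq := whiskerL_neg _ _
  nρ'_eq := whiskerL_neg _ _
  C₁₁_eq := whiskerL_add _ _ _
  C₁₂_eq := by
    simp only [whiskerL_sg, sg_comp]
    exact sg_eq_of_check (by revert i j; decide +kernel)
  C₂₁_eq := by
    simp only [whiskerL_sg, sg_comp]
    exact sg_eq_of_check (by revert i j; decide +kernel)
  H₁₁_eq := whiskerL_add _ _ _
  H₁₂_eq := by
    simp only [whiskerL_sg, sg_comp]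
    exact sg_eq_of_check (by revert i j; decide +kernel)
  H₂₁_eq := by
    simp only [whiskerL_sg, sg_comp]
    exact sg_eq_of_check (by revert i j; decide +kernel)
  σ_δ := by
    simp only [whiskerL_sg, sg_comp, ← sg_id]
    exact sg_eq_of_check (by revert i j; decide +kernel)
  β_σ' := by
    simp only [whiskerL_sg, sg_comp, ← sg_id]
    exact sg_eq_of_check (by revert i j; decide +kernel)
  τ_δF := by
    simp only [whiskerL_sg, sg_comp, ← sg_id]
    exact sg_eq_of_check (by revert i j; decide +kernel)
  βF_τ' := by
    simp only [whiskerL_sg, sg_comp, ← sg_id]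
    exact sg_eq_of_check (by revert i j; decide +kernel)
  bb_δF := by
    simp only [whiskerL_sg, sg_comp]
    exact sg_eq_of_check (by revert i j; decide +kernel)
  β_bb := by
    simp only [whiskerL_sg, sg_comp]
    exact sg_eq_of_check (by revert i j; decide +kernel)
  bb'_δ := by
    simp only [whiskerL_sg, sg_comp]
    exact sg_eq_of_check (by revert i j; decide +kernel)
  βF_bb' := by
    simp only [whiskerL_sg, sg_comp]
    exact sg_eq_of_check (by revert i j; decide +kernel)
  -- The first saddle creates the circle that the death removes, and the second half does the
  -- reverse. No tube is left, so the surface is the cylinder over an isotopy.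
  ρ'_δ_β_ρ := by
    simp only [whiskerL_sg, sg_comp, ← sg_id]
    exact sg_eq_of_check (by revert i j; decide +kernel)
  neck := by
    simp only [whiskerL_sg, sg_comp, ← sg_id]
    -- The identity factors through the diagram with the circle moved aside, and the neck that is
    -- cut is the cylinder over this circle.
    exact (sg_neck_of_check (isotopy' (circleL i) (isIsotopy_circleL i))
      (isotopy (circleL i) (isIsotopy_circleL i)) (by revert i j; decide +kernel)).symm
  neckF := by
    simp only [whiskerL_sg, sg_comp, ← sg_id]
    exact (sg_neck_of_check (isotopy' (circleLF i j) (isIsotopy_circleLF h))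
      (isotopy (circleLF i j) (isIsotopy_circleLF h)) (by revert i j; decide +kernel)).symm
  l_comm := by
    simp only [whiskerL_sg, sg_comp]
    exact sg_eq_of_check (by revert i j; decide +kernel)
  t_comm := by
    simp only [whiskerL_sg, sg_comp]
    exact sg_eq_of_check (by revert i j; decide +kernel)
  lF_comm := by
    simp only [whiskerL_sg, sg_comp]
    exact sg_eq_of_check (by revert i j; decide +kernel)
  -- In this and the next four relations a saddle followed by its reverse is the identity with a
  -- tube between two components. The arguments of `split` and `merge` are points on these
  -- components.
  σ'_σ := by
    simp only [whiskerL_sg, sg_comp]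
    exact sg_neck_of_check (split ((gen i).stack (gen i)) (TLDiagram.inLower ((gen i).top (outer i))))
      (merge ((gen i).stack (gen i)) (TLDiagram.inLower ((gen i).bot (outer i)))) (by revert i j; decide +kernel)
  ρ_ρ' := by
    simp only [whiskerL_sg, sg_comp]
    exact sg_neck_of_check (split ((gen i).stack (gen i)) (TLDiagram.inLower ((gen i).top (outer i))))
      (merge ((gen i).stack (gen i)) (TLDiagram.inLower ((gen i).top (outer j)))) (by revert i j; decide +kernel)
  bb_bb' := by
    simp only [whiskerL_sg, sg_comp]
    exact sg_neck_of_check (split ((gen i).stack (gen i)) (TLDiagram.inLower ((gen i).bot (outer i))))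
      (merge ((gen i).stack (gen i)) (TLDiagram.inLower ((gen i).top (outer j)))) (by revert i j; decide +kernel)
  τ'_τ := by
    simp only [whiskerL_sg, sg_comp]
    exact sg_neck_of_check (split ((gen i).stack ((gen i).stack (gen j))) (TLDiagram.inLower (((gen i).stack (gen j)).top (outer i))))
      (merge ((gen i).stack ((gen i).stack (gen j))) (TLDiagram.inLower (((gen i).stack (gen j)).top (outer j)))) (by revert i j; decide +kernel)
  bb'_bb := by
    simp only [whiskerL_sg, sg_comp]
    exact sg_neck_of_check (split ((gen i).stack ((gen i).stack (gen j))) (TLDiagram.inLower (((gen i).stack (gen j)).bot (outer j))))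
      (merge ((gen i).stack ((gen i).stack (gen j))) (TLDiagram.inLower (((gen i).stack (gen j)).top (outer j)))) (by revert i j; decide +kernel)
  κ_ρ' := by
    simp only [whiskerL_sg, sg_comp]
    exact sg_eq_of_check (by revert i j; decide +kernel)
  ρ_κ' := by
    simp only [whiskerL_sg, sg_comp]
    exact sg_eq_of_check (by revert i j; decide +kernel)

set_option maxHeartbeats 1000000 in
set_option linter.unusedSimpArgs false in
/-- The terms of the third projector above the turnback `e_i`. -/
noncomputable def calculusR (h : i ≠ j) : TurnbackCalculus (Cob 3) where
  E := Cob.of 0 ((TLDiagram.one).stack (gen i))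
  F := Cob.of 0 ((gen j).stack (gen i))
  EE := Cob.of 0 ((gen i).stack (gen i))
  FF := Cob.of 0 (((gen j).stack (gen i)).stack (gen i))
  G := Cob.of 0 (((gen i).stack (gen j)).stack (gen i))
  σ := whiskerR (gen i) (sg (saddle (n := 3) i))
  σ' := whiskerR (gen i) (sg (saddle' (n := 3) i))
  b := whiskerR (gen i) (sg (saddle (n := 3) j))
  b' := whiskerR (gen i) (sg (saddle' (n := 3) j))
  -- With `e_i` stacked below, the map `EE ⟶ FF` is an entry of `B` with a sign and `EE ⟶ G` is one
  -- without, opposite to the case of `calculusL`. Hence `bb`, `κ` and their reverses carry the sign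
  -- here, while `τ` and `ρ` are negatives of saddles.
  bb := whiskerR (gen i) (-sg (saddleAbove j (gen i)))
  τ := -whiskerR (gen i) (sg (saddleBelow (gen j) i))
  nτ := whiskerR (gen i) (sg (saddleBelow (gen j) i))
  ρ := -whiskerR (gen i) (sg (saddleBelow (gen i) j))
  nρ := whiskerR (gen i) (sg (saddleBelow (gen i) j))
  κ := whiskerR (gen i) (-sg (saddleAbove i (gen j)))
  bb' := whiskerR (gen i) (-sg (saddleAbove' j (gen i)))
  τ' := -whiskerR (gen i) (sg (saddleBelow' (gen j) i))
  nτ' := whiskerR (gen i) (sg (saddleBelow' (gen j) i))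
  ρ' := -whiskerR (gen i) (sg (saddleBelow' (gen i) j))
  nρ' := whiskerR (gen i) (sg (saddleBelow' (gen i) j))
  κ' := whiskerR (gen i) (-sg (saddleAbove' i (gen j)))
  δ := sg (deathAt (circleR i) (isIsotopy_circleR i))
  β := sg (birthAt (circleR i) (isIsotopy_circleR i))
  -- The signs of `δF` and `βF` offset those of `τ`, `τ'`, `bb` and `bb'`. They cancel in `δF ≫ βF`,
  -- so the neck relation is unaffected.
  δF := -sg (deathAt (circleRF i j) (isIsotopy_circleRF h))
  βF := -sg (birthAt (circleRF i j) (isIsotopy_circleRF h))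
  -- The circle now contains the lower turnback of the upper factor, so compared with `calculusL`
  -- the dots `x` and `l` trade top and bottom.
  x := whiskerR (gen i) (sg (dot (gen i) ((gen i).bot (outer i))))
  l := whiskerR (gen i) (sg (dot (gen i) ((gen i).top (outer i))))
  t := whiskerR (gen i) (sg (dot (gen i) ((gen i).top (outer j))))
  xF := whiskerR (gen i) (sg (dot ((gen j).stack (gen i)) (((gen j).stack (gen i)).bot (outer i))))
  lF := whiskerR (gen i) (sg (dot ((gen j).stack (gen i)) (((gen j).stack (gen i)).top (outer j))))
  tF := whiskerR (gen i) (sg (dot ((gen j).stack (gen i)) (((gen j).stack (gen i)).top (outer i))))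
  C₁₁ := whiskerR (gen i) (sg (dot ((gen j).stack (gen i)) (((gen j).stack (gen i)).top (outer j))) +
    sg (dot ((gen j).stack (gen i)) (((gen j).stack (gen i)).bot (outer i))))
  C₁₂ := whiskerR (gen i) (sg ((saddleAbove' j (gen i)).comp (saddleBelow (gen i) j)))
  C₂₁ := whiskerR (gen i) (sg ((saddleAbove' i (gen j)).comp (saddleBelow (gen j) i)))
  C₂₂ := whiskerR (gen i) (sg (dot ((gen i).stack (gen j)) (((gen i).stack (gen j)).top (outer i))) +
    sg (dot ((gen i).stack (gen j)) (((gen i).stack (gen j)).bot (outer j))))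
  H₁₁ := whiskerR (gen i) (sg (dot (gen i) ((gen i).top (outer i))) +
    sg (dot (gen i) ((gen i).bot (outer i))))
  H₁₂ := whiskerR (gen i) (sg ((saddle' (n := 3) i).comp (saddle (n := 3) j)))
  H₂₁ := whiskerR (gen i) (sg ((saddle' (n := 3) j).comp (saddle (n := 3) i)))
  H₂₂ := whiskerR (gen i) (sg (dot (gen j) ((gen j).top (outer j))) +
    sg (dot (gen j) ((gen j).bot (outer j))))
  nτ_eq := (neg_neg _).symm
  nτ'_eq := (neg_neg _).symm
  nρ_eq := (neg_neg _).symm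
  nρ'_eq := (neg_neg _).symm
  C₁₁_eq := (whiskerR_add _ _ _).trans (add_comm _ _)
  C₁₂_eq := by
    simp only [whiskerR_neg, whiskerR_sg, Preadditive.neg_comp, Preadditive.comp_neg, neg_neg, neg_inj, sg_comp]
    exact sg_eq_of_check (by revert i j; decide +kernel)
  C₂₁_eq := by
    simp only [whiskerR_neg, whiskerR_sg, Preadditive.neg_comp, Preadditive.comp_neg, neg_neg, neg_inj, sg_comp]
    exact sg_eq_of_check (by revert i j; decide +kernel)
  H₁₁_eq := (whiskerR_add _ _ _).trans (add_comm _ _)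
  H₁₂_eq := by
    simp only [whiskerR_neg, whiskerR_sg, Preadditive.neg_comp, Preadditive.comp_neg, neg_neg, neg_inj, sg_comp]
    exact sg_eq_of_check (by revert i j; decide +kernel)
  H₂₁_eq := by
    simp only [whiskerR_neg, whiskerR_sg, Preadditive.neg_comp, Preadditive.comp_neg, neg_neg, neg_inj, sg_comp]
    exact sg_eq_of_check (by revert i j; decide +kernel)
  σ_δ := by
    simp only [whiskerR_neg, whiskerR_sg, Preadditive.neg_comp, Preadditive.comp_neg, neg_neg, neg_inj, sg_comp, ← sg_id]
    exact sg_eq_of_check (by revert i j; decide +kernel)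
  β_σ' := by
    simp only [whiskerR_neg, whiskerR_sg, Preadditive.neg_comp, Preadditive.comp_neg, neg_neg, neg_inj, sg_comp, ← sg_id]
    exact sg_eq_of_check (by revert i j; decide +kernel)
  τ_δF := by
    simp only [whiskerR_neg, whiskerR_sg, Preadditive.neg_comp, Preadditive.comp_neg, neg_neg, neg_inj, sg_comp, ← sg_id]
    exact sg_eq_of_check (by revert i j; decide +kernel)
  βF_τ' := by
    simp only [whiskerR_neg, whiskerR_sg, Preadditive.neg_comp, Preadditive.comp_neg, neg_neg, neg_inj, sg_comp, ← sg_id]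
    exact sg_eq_of_check (by revert i j; decide +kernel)
  bb_δF := by
    simp only [whiskerR_neg, whiskerR_sg, Preadditive.neg_comp, Preadditive.comp_neg, neg_neg, neg_inj, sg_comp]
    exact sg_eq_of_check (by revert i j; decide +kernel)
  β_bb := by
    simp only [whiskerR_neg, whiskerR_sg, Preadditive.neg_comp, Preadditive.comp_neg, neg_neg, neg_inj, sg_comp]
    exact sg_eq_of_check (by revert i j; decide +kernel)
  bb'_δ := by
    simp only [whiskerR_neg, whiskerR_sg, Preadditive.neg_comp, Preadditive.comp_neg, neg_neg, neg_inj, sg_comp]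
    exact sg_eq_of_check (by revert i j; decide +kernel)
  βF_bb' := by
    simp only [whiskerR_neg, whiskerR_sg, Preadditive.neg_comp, Preadditive.comp_neg, neg_neg, neg_inj, sg_comp]
    exact sg_eq_of_check (by revert i j; decide +kernel)
  ρ'_δ_β_ρ := by
    simp only [whiskerR_neg, whiskerR_sg, Preadditive.neg_comp, Preadditive.comp_neg, neg_neg, neg_inj, sg_comp, ← sg_id]
    exact sg_eq_of_check (by revert i j; decide +kernel)
  neck := by
    simp only [whiskerR_neg, whiskerR_sg, Preadditive.neg_comp, Preadditive.comp_neg, neg_neg, neg_inj, sg_comp, ← sg_id]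
    exact (sg_neck_of_check (isotopy' (circleR i) (isIsotopy_circleR i))
      (isotopy (circleR i) (isIsotopy_circleR i)) (by revert i j; decide +kernel)).symm
  neckF := by
    simp only [whiskerR_neg, whiskerR_sg, Preadditive.neg_comp, Preadditive.comp_neg, neg_neg, neg_inj, sg_comp, ← sg_id]
    exact (sg_neck_of_check (isotopy' (circleRF i j) (isIsotopy_circleRF h))
      (isotopy (circleRF i j) (isIsotopy_circleRF h)) (by revert i j; decide +kernel)).symm
  l_comm := by
    simp only [whiskerR_neg, whiskerR_sg, Preadditive.neg_comp, Preadditive.comp_neg, neg_neg, neg_inj, sg_comp]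
    exact sg_eq_of_check (by revert i j; decide +kernel)
  t_comm := by
    simp only [whiskerR_neg, whiskerR_sg, Preadditive.neg_comp, Preadditive.comp_neg, neg_neg, neg_inj, sg_comp]
    exact sg_eq_of_check (by revert i j; decide +kernel)
  lF_comm := by
    simp only [whiskerR_neg, whiskerR_sg, Preadditive.neg_comp, Preadditive.comp_neg, neg_neg, neg_inj, sg_comp]
    exact sg_eq_of_check (by revert i j; decide +kernel)
  σ'_σ := by
    simp only [whiskerR_neg, whiskerR_sg, Preadditive.neg_comp, Preadditive.comp_neg, neg_neg, neg_inj, sg_comp]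
    exact sg_neck_of_check (split ((gen i).stack (gen i)) (TLDiagram.inUpper ((gen i).bot (outer i))))
      (merge ((gen i).stack (gen i)) (TLDiagram.inUpper ((gen i).top (outer i)))) (by revert i j; decide +kernel)
  ρ_ρ' := by
    simp only [whiskerR_neg, whiskerR_sg, Preadditive.neg_comp, Preadditive.comp_neg, neg_neg, neg_inj, sg_comp]
    exact sg_neck_of_check (split ((gen i).stack (gen i)) (TLDiagram.inUpper ((gen i).bot (outer i))))
      (merge ((gen i).stack (gen i)) (TLDiagram.inUpper ((gen i).top (outer j)))) (by revert i j; decide +kernel)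
  bb_bb' := by
    simp only [whiskerR_neg, whiskerR_sg, Preadditive.neg_comp, Preadditive.comp_neg, neg_neg, neg_inj, sg_comp]
    exact sg_neck_of_check (split ((gen i).stack (gen i)) (TLDiagram.inUpper ((gen i).top (outer i))))
      (merge ((gen i).stack (gen i)) (TLDiagram.inUpper ((gen i).top (outer j)))) (by revert i j; decide +kernel)
  τ'_τ := by
    simp only [whiskerR_neg, whiskerR_sg, Preadditive.neg_comp, Preadditive.comp_neg, neg_neg, neg_inj, sg_comp]
    exact sg_neck_of_check (split (((gen j).stack (gen i)).stack (gen i)) (TLDiagram.inUpper (((gen j).stack (gen i)).bot (outer i))))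
      (merge (((gen j).stack (gen i)).stack (gen i)) (TLDiagram.inUpper (((gen j).stack (gen i)).top (outer i)))) (by revert i j; decide +kernel)
  bb'_bb := by
    simp only [whiskerR_neg, whiskerR_sg, Preadditive.neg_comp, Preadditive.comp_neg, neg_neg, neg_inj, sg_comp]
    exact sg_neck_of_check (split (((gen j).stack (gen i)).stack (gen i)) (TLDiagram.inUpper (((gen j).stack (gen i)).top (outer j))))
      (merge (((gen j).stack (gen i)).stack (gen i)) (TLDiagram.inUpper (((gen j).stack (gen i)).top (outer i)))) (by revert i j; decide +kernel)
  κ_ρ' := by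
    simp only [whiskerR_neg, whiskerR_sg, Preadditive.neg_comp, Preadditive.comp_neg, neg_neg, neg_inj, sg_comp]
    exact sg_eq_of_check (by revert i j; decide +kernel)
  ρ_κ' := by
    simp only [whiskerR_neg, whiskerR_sg, Preadditive.neg_comp, Preadditive.comp_neg, neg_neg, neg_inj, sg_comp]
    exact sg_eq_of_check (by revert i j; decide +kernel)

end ThirdProjector

/-! ## Degrees -/

namespace PreSurface

variable {n : ℕ} {a b c d : TLDiagram n}

/-- Pushing forward along a map preserves the total value. This makes the topological degree
additive under both gluings. -/
theorem sum_mapDomain_add {X Y Z M N : Type*} [AddCommMonoid M] [AddCommMonoid N] (f : M →+ N)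
    (u : X → Z) (v : Y → Z) (p : X →₀ M) (q : Y →₀ M) :
    (p.mapDomain u + q.mapDomain v).sum (fun _ m => f m) =
      p.sum (fun _ m => f m) + q.sum (fun _ m => f m) := by
  rw [Finsupp.sum_add_index' (by simp) (by simp), Finsupp.sum_mapDomain_index (by simp) (by simp),
    Finsupp.sum_mapDomain_index (by simp) (by simp)]

theorem degree_comp (S : PreSurface a b) (T : PreSurface b c) :
    (S.comp T).degree = S.degree + T.degree := by
  have h := sum_mapDomain_add (AddMonoidHom.id ℤ)
    (fun x => Quot.mk (CompGlue S T) (Sum.inl x)) (fun x => Quot.mk _ (Sum.inr x)) S.chi T.chi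
  have h' := sum_mapDomain_add (Nat.castAddMonoidHom ℤ)
    (fun x => Quot.mk (CompGlue S T) (Sum.inl x)) (fun x => Quot.mk _ (Sum.inr x)) S.dots T.dots
  simp only [AddMonoidHom.id_apply, Nat.coe_castAddMonoidHom] at h h'
  simp only [degree, comp, h, h']
  ring

theorem degree_tensor (S : PreSurface a b) (T : PreSurface c d) :
    (S.tensor T).degree = S.degree + T.degree := by
  have h := sum_mapDomain_add (AddMonoidHom.id ℤ)
    (fun x => Quot.mk (TensorGlue S T) (Sum.inl x)) (fun x => Quot.mk _ (Sum.inr x)) S.chi T.chi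
  have h' := sum_mapDomain_add (Nat.castAddMonoidHom ℤ)
    (fun x => Quot.mk (TensorGlue S T) (Sum.inl x)) (fun x => Quot.mk _ (Sum.inr x)) S.dots T.dots
  simp only [AddMonoidHom.id_apply, Nat.coe_castAddMonoidHom] at h h'
  simp only [degree, tensor, h, h']
  ring

end PreSurface

namespace Cobordism

variable {n : ℕ} {a b c d : TLDiagram n}

theorem degree_comp (S : Cobordism a b) (T : Cobordism b c) :
    (S.comp T).1.degree = S.1.degree + T.1.degree := by
  obtain ⟨⟨S⟩, _⟩ := S
  obtain ⟨⟨T⟩, _⟩ := T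
  exact PreSurface.degree_comp S T

theorem degree_tensor (S : Cobordism a b) (T : Cobordism c d) :
    (S.tensor T).1.degree = S.1.degree + T.1.degree := by
  obtain ⟨⟨S⟩, _⟩ := S
  obtain ⟨⟨T⟩, _⟩ := T
  exact PreSurface.degree_tensor S T

theorem degree_tensor_of {S : Cobordism a b} {T : Cobordism c d} {p q r : ℤ}
    (hS : S.1.degree = p) (hT : T.1.degree = q) (h : p + q = r) : (S.tensor T).1.degree = r := by
  rw [degree_tensor, hS, hT, h]

theorem degree_comp_of {S : Cobordism a b} {T : Cobordism b c} {p q r : ℤ} (hS : S.1.degree = p)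
    (hT : T.1.degree = q) (h : p + q = r) : (S.comp T).1.degree = r := by
  rw [degree_comp, hS, hT, h]

theorem degree_cylinder (φ : a.Comp ≃ b.Comp) (h h') : (cylinder φ h h').1.degree = 0 := by
  change (PreSurface.cylinder φ h h').degree = 0
  simp [PreSurface.degree, PreSurface.cylinder]

theorem degree_cylinder' (φ : a.Comp ≃ b.Comp) (h h') : (cylinder' φ h h').1.degree = 0 :=
  degree_cylinder _ _ _

theorem degree_id (a : TLDiagram n) : (id a).1.degree = 0 :=
  degree_cylinder _ _ _

theorem degree_isotopy (f : a.Site → b.Site) (h) : (isotopy f h).1.degree = 0 :=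
  degree_cylinder _ _ _

theorem degree_isotopy' (f : a.Site → b.Site) (h) : (isotopy' f h).1.degree = 0 :=
  degree_cylinder' _ _ _

theorem degree_dot (a : TLDiagram n) (p : a.Site) : (dot a p).1.degree = -2 := by
  change (PreSurface.dot a p).degree = -2
  simp [PreSurface.degree, PreSurface.dot, PreSurface.id, PreSurface.cylinder]

theorem degree_saddle (i : Fin (n - 1)) : (saddle i).1.degree = -1 := by
  change (PreSurface.saddle i).degree = -1
  rw [PreSurface.degree, PreSurface.saddle, Finsupp.sum_single_index rfl]
  simp

theorem degree_saddle' (i : Fin (n - 1)) : (saddle' i).1.degree = -1 :=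
  degree_saddle i

theorem degree_birth : (birth n).1.degree = 1 := by
  change (PreSurface.birth n).degree = 1
  simp [PreSurface.degree, PreSurface.birth]

theorem degree_death : (death n).1.degree = 1 :=
  degree_birth

theorem degree_saddleBelow (a : TLDiagram n) (i : Fin (n - 1)) :
    (saddleBelow a i).1.degree = -1 :=
  degree_comp_of (degree_cylinder (stackOne a).symm _ _) (degree_tensor_of (degree_id _) (degree_saddle _) (zero_add _)) (zero_add _)

theorem degree_saddleAbove (i : Fin (n - 1)) (a : TLDiagram n) :
    (saddleAbove i a).1.degree = -1 :=
  degree_comp_of (degree_cylinder (oneStack a).symm _ _) (degree_tensor_of (degree_saddle _) (degree_id _) (add_zero _)) (zero_add _)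

theorem degree_saddleBelow' (a : TLDiagram n) (i : Fin (n - 1)) :
    (saddleBelow' a i).1.degree = -1 :=
  degree_comp_of (degree_tensor_of (degree_id _) (degree_saddle' _) (zero_add _)) (degree_cylinder (stackOne a) _ _) (add_zero _)

theorem degree_saddleAbove' (i : Fin (n - 1)) (a : TLDiagram n) :
    (saddleAbove' i a).1.degree = -1 :=
  degree_comp_of (degree_tensor_of (degree_saddle' _) (degree_id _) (add_zero _)) (degree_cylinder (oneStack a) _ _) (add_zero _)

theorem degree_birthAt (f : (TLDiagram.circle.stack a).Site → b.Site) (h) :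
    (birthAt f h).1.degree = 1 :=
  degree_comp_of (degree_cylinder (oneStack a).symm _ _)
    (degree_comp_of (degree_tensor_of degree_birth (degree_id _) (add_zero _))
      (degree_isotopy f h) (add_zero _)) (zero_add _)

theorem degree_deathAt (f : (TLDiagram.circle.stack a).Site → b.Site) (h) :
    (deathAt f h).1.degree = 1 :=
  degree_comp_of (degree_isotopy' f h)
    (degree_comp_of (degree_tensor_of degree_death (degree_id _) (add_zero _))
      (degree_cylinder (oneStack a) _ _) (add_zero _)) (zero_add _)

end Cobordism

namespace Cob

variable {n : ℕ} {A B C : Cob n} {a b c : TLDiagram n} {d e : ℤ}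

theorem isHomogeneous_zero (d : ℤ) : IsHomogeneous d (0 : A ⟶ B) :=
  AddSubgroup.zero_mem _

theorem IsHomogeneous.neg {f : A ⟶ B} (h : IsHomogeneous d f) : IsHomogeneous d (-f) :=
  AddSubgroup.neg_mem _ h

theorem IsHomogeneous.add {f g : A ⟶ B} (h : IsHomogeneous d f) (h' : IsHomogeneous d g) :
    IsHomogeneous d (f + g) :=
  AddSubgroup.add_mem _ h h'

theorem isHomogeneous_single (s t : ℤ) (S : Cobordism a b) :
    IsHomogeneous (S.1.degree + (t - s)) (single s t S) :=
  AddSubgroup.subset_closure ⟨S, 0, by simp; rfl, by rw [pow_zero, one_smul]; rfl⟩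

theorem isHomogeneous_iff {s t : ℤ} {f : of s a ⟶ of t b} :
    IsHomogeneous d f ↔ f ∈ AddSubgroup.closure {g : of s a ⟶ of t b |
      ∃ (S : Cobordism a b) (k : ℕ), S.1.degree + (t - s) - 4 * (k : ℤ) = d ∧
        g = alpha ^ k • single s t S} :=
  Iff.rfl

theorem isHomogeneous_comp_of {s t u : ℤ} {f : of s a ⟶ of t b} {g : of t b ⟶ of u c}
    (hf : IsHomogeneous d f) (hg : IsHomogeneous e g) : IsHomogeneous (d + e) (f ≫ g) := by
  rw [isHomogeneous_iff] at hf hg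
  induction hf using AddSubgroup.closure_induction with
  | mem f hf =>
    obtain ⟨S, k, hS, rfl⟩ := hf
    induction hg using AddSubgroup.closure_induction with
    | mem g hg =>
      obtain ⟨T, l, hT, rfl⟩ := hg
      refine isHomogeneous_iff.2 (AddSubgroup.subset_closure ⟨S.comp T, k + l, ?_, ?_⟩)
      · rw [Cobordism.degree_comp]
        push_cast
        linarith
      · rw [Linear.smul_comp, Linear.comp_smul, smul_smul, ← pow_add, single_comp]
    | zero =>
      rw [comp_zero]
      exact isHomogeneous_zero _
    | add g g' _ _ h h' =>
      rw [Preadditive.comp_add]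
      exact h.add h'
    | neg g _ h =>
      rw [Preadditive.comp_neg]
      exact h.neg
  | zero =>
    rw [zero_comp]
    exact isHomogeneous_zero _
  | add f f' _ _ h h' =>
    rw [Preadditive.add_comp]
    exact h.add h'
  | neg f _ h =>
    rw [Preadditive.neg_comp]
    exact h.neg

theorem IsHomogeneous.comp {f : A ⟶ B} {g : B ⟶ C} (hf : IsHomogeneous d f)
    (hg : IsHomogeneous e g) : IsHomogeneous (d + e) (f ≫ g) :=
  isHomogeneous_comp_of (s := A.shift) (a := A.diagram) (t := B.shift) (b := B.diagram)
    (u := C.shift) (c := C.diagram) hf hg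

theorem isHomogeneous_id (s : ℤ) (a : TLDiagram n) : IsHomogeneous 0 (𝟙 (of s a)) := by
  have h := isHomogeneous_single s s (Cobordism.id a)
  rwa [Cobordism.degree_id, sub_self, add_zero, single_id] at h

theorem isHomogeneous_sg (S : Cobordism a b) : IsHomogeneous S.1.degree (sg S) := by
  have h := isHomogeneous_single 0 0 S
  rwa [sub_self, add_zero] at h

theorem IsHomogeneous.regrade {f : of 0 a ⟶ of 0 b} (hf : IsHomogeneous d f) (s t : ℤ)
    (h : d + (t - s) = e) : IsHomogeneous e (regrade s t f) := by
  have h' := (isHomogeneous_single s 0 (Cobordism.id a)).comp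
    (hf.comp (isHomogeneous_single 0 t (Cobordism.id b)))
  rw [Cobordism.degree_id, Cobordism.degree_id] at h'
  rw [Cob.regrade]
  convert h' using 1
  rw [← h]
  ring

end Cob

/-! ### Degrees of the homotopy and of the differential. -/

namespace TurnbackCalculus

open Cob

/-- The maps in a `TurnbackCalculus` have the degrees of births, deaths and saddles. -/
structure IsGraded {n : ℕ} (K : TurnbackCalculus (Cob n)) : Prop where
  δ : IsHomogeneous 1 K.δ
  β : IsHomogeneous 1 K.β
  δF : IsHomogeneous 1 K.δF
  βF : IsHomogeneous 1 K.βF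
  b : IsHomogeneous (-1) K.b
  b' : IsHomogeneous (-1) K.b'
  ρ : IsHomogeneous (-1) K.ρ
  ρ' : IsHomogeneous (-1) K.ρ'

namespace IsGraded

variable {n : ℕ} {K : TurnbackCalculus (Cob n)} (h : K.IsGraded)

include h

theorem h₂₁₁ : IsHomogeneous 1 K.h₂₁₁ := (h.δF.comp (h.b'.comp h.β)).neg

theorem h₂₁₂ : IsHomogeneous 1 K.h₂₁₂ := h.δF.neg

theorem h₂₂₁ : IsHomogeneous 1 K.h₂₂₁ := ((h.ρ'.comp h.δ).comp h.β).neg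

theorem h₃₁₁ : IsHomogeneous 2 K.h₃₁₁ := by
  rw [← one_add_one_eq_two]
  exact h.δF.comp h.βF

theorem h₄₁₁ : IsHomogeneous 1 K.h₄₁₁ := (h.δ.comp (h.b.comp h.βF)).neg

theorem h₄₁₂ : IsHomogeneous 1 K.h₄₁₂ := (h.δ.comp (h.β.comp h.ρ)).neg

theorem h₄₂₁ : IsHomogeneous 1 K.h₄₂₁ := h.βF.neg

theorem h₅₁₁ : IsHomogeneous 2 K.h₅₁₁ := by
  rw [← one_add_one_eq_two]
  exact h.δ.comp h.β

end IsGraded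

end TurnbackCalculus

namespace ThirdProjector

open Cob Cobordism

variable {i j : Fin 2}

theorem isHomogeneous_whiskerL (S : Cobordism (n := 3) a b) {d : ℤ} (h : S.1.degree = d)
    (z : TLDiagram 3) : IsHomogeneous d (whiskerL z (sg S)) := by
  rw [whiskerL_sg]
  have h' := isHomogeneous_sg ((Cobordism.id z).tensor S)
  rwa [degree_tensor, degree_id, zero_add, h] at h'

theorem isHomogeneous_whiskerR (S : Cobordism (n := 3) a b) {d : ℤ} (h : S.1.degree = d)
    (z : TLDiagram 3) : IsHomogeneous d (whiskerR z (sg S)) := by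
  rw [whiskerR_sg]
  have h' := isHomogeneous_sg (S.tensor (Cobordism.id z))
  rwa [degree_tensor, degree_id, add_zero, h] at h'

theorem isHomogeneous_sg_of {S : Cobordism (n := 3) a b} {d : ℤ} (h : S.1.degree = d) :
    IsHomogeneous d (sg S) :=
  h ▸ isHomogeneous_sg S

theorem isGraded_calculusL (h : i ≠ j) : (calculusL h).IsGraded where
  δ := by
    dsimp only [calculusL]
    exact isHomogeneous_sg_of (degree_deathAt (circleL i) (isIsotopy_circleL i))
  β := by
    dsimp only [calculusL]
    exact isHomogeneous_sg_of (degree_birthAt (circleL i) (isIsotopy_circleL i))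
  δF := by
    dsimp only [calculusL]
    exact isHomogeneous_sg_of (degree_deathAt (circleLF i j) (isIsotopy_circleLF h))
  βF := by
    dsimp only [calculusL]
    exact isHomogeneous_sg_of (degree_birthAt (circleLF i j) (isIsotopy_circleLF h))
  b := by
    dsimp only [calculusL]
    exact isHomogeneous_whiskerL (saddle (n := 3) j) (degree_saddle (n := 3) j) (gen i)
  b' := by
    dsimp only [calculusL]
    exact isHomogeneous_whiskerL (saddle' (n := 3) j) (degree_saddle' (n := 3) j) (gen i)
  ρ := by
    dsimp only [calculusL]
    exact isHomogeneous_whiskerL (saddleAbove (n := 3) j (gen i)) (degree_saddleAbove (n := 3) j (gen i)) (gen i)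
  ρ' := by
    dsimp only [calculusL]
    exact isHomogeneous_whiskerL (saddleAbove' (n := 3) j (gen i)) (degree_saddleAbove' (n := 3) j (gen i)) (gen i)

theorem isGraded_calculusR (h : i ≠ j) : (calculusR h).IsGraded where
  δ := isHomogeneous_sg_of (degree_deathAt (circleR i) (isIsotopy_circleR i))
  β := isHomogeneous_sg_of (degree_birthAt (circleR i) (isIsotopy_circleR i))
  δF := (isHomogeneous_sg_of (degree_deathAt (circleRF i j) (isIsotopy_circleRF h))).neg
  βF := (isHomogeneous_sg_of (degree_birthAt (circleRF i j) (isIsotopy_circleRF h))).neg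
  b := isHomogeneous_whiskerR (saddle (n := 3) j) (degree_saddle (n := 3) j) (gen i)
  b' := isHomogeneous_whiskerR (saddle' (n := 3) j) (degree_saddle' (n := 3) j) (gen i)
  ρ := (isHomogeneous_whiskerR (saddleBelow (n := 3) (gen i) j) (degree_saddleBelow (n := 3) (gen i) j) (gen i)).neg
  ρ' := (isHomogeneous_whiskerR (saddleBelow' (n := 3) (gen i) j) (degree_saddleBelow' (n := 3) (gen i) j) (gen i)).neg

/-- The degree of the differential before the shifts of the grading. -/
theorem isHomogeneous_matrix : ∀ (m : ℕ) (s t : Fin 2),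
    IsHomogeneous (shift m - shift (m + 1)) (matrix m 0 0 s t)
  | 0, s, t => by
    change IsHomogeneous (1 - 2) _
    fin_cases s <;> fin_cases t
    · exact isHomogeneous_sg_of (degree_saddleBelow _ _)
    · exact (isHomogeneous_sg_of (degree_saddleAbove _ _)).neg
    · exact (isHomogeneous_sg_of (degree_saddleAbove _ _)).neg
    · exact isHomogeneous_sg_of (degree_saddleBelow _ _)
  | 1, s, t => by
    change IsHomogeneous (2 - 4) _
    fin_cases s <;> fin_cases t
    · exact (isHomogeneous_sg_of (degree_dot _ _)).add (isHomogeneous_sg_of (degree_dot _ _))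
    · exact isHomogeneous_sg_of
        (degree_comp_of (degree_saddleAbove' _ _) (degree_saddleBelow _ _) (by norm_num))
    · exact isHomogeneous_sg_of
        (degree_comp_of (degree_saddleAbove' _ _) (degree_saddleBelow _ _) (by norm_num))
    · exact (isHomogeneous_sg_of (degree_dot _ _)).add (isHomogeneous_sg_of (degree_dot _ _))
  | 2, s, t => by
    change IsHomogeneous (4 - 5) _
    fin_cases s <;> fin_cases t
    · exact isHomogeneous_sg_of (degree_saddleBelow' _ _)
    · exact (isHomogeneous_sg_of (degree_saddleAbove' _ _)).neg
    · exact (isHomogeneous_sg_of (degree_saddleAbove' _ _)).neg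
    · exact isHomogeneous_sg_of (degree_saddleBelow' _ _)
  | 3, s, t => by
    change IsHomogeneous (5 - 7) _
    fin_cases s <;> fin_cases t
    · exact (isHomogeneous_sg_of (degree_dot _ _)).add (isHomogeneous_sg_of (degree_dot _ _))
    · exact isHomogeneous_sg_of (degree_comp_of (degree_saddle' _) (degree_saddle _) (by norm_num))
    · exact isHomogeneous_sg_of (degree_comp_of (degree_saddle' _) (degree_saddle _) (by norm_num))
    · exact (isHomogeneous_sg_of (degree_dot _ _)).add (isHomogeneous_sg_of (degree_dot _ _))
  | m + 4, s, t => by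
    have e : shift (m + 4) - shift (m + 4 + 1) = shift m - shift (m + 1) := by
      change shift m + 6 - (shift (m + 1) + 6) = _
      ring
    rw [e]
    exact isHomogeneous_matrix m s t

theorem isDegreeZero_d : ∀ k : ℤ, MatCob.IsDegreeZero (d k)
  | .ofNat 0 => by
    rintro _ (t : Fin 2)
    fin_cases t
    · have h := isHomogeneous_single 0 1 (saddle (n := 3) 0)
      rw [degree_saddle] at h
      exact h
    · have h := isHomogeneous_single 0 1 (saddle (n := 3) 1)
      rw [degree_saddle] at h
      exact h
  | .ofNat (m + 1) => by
    rintro (s : Fin 2) (t : Fin 2)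
    change IsHomogeneous 0 (matrix m (shift m) (shift (m + 1)) s t)
    rw [matrix_eq_regrade]
    exact (isHomogeneous_matrix m s t).regrade _ _ (by ring)
  | .negSucc _ => fun s => s.elim

theorem shift_nonneg : ∀ m : ℕ, 0 ≤ shift m
  | 0 => by decide
  | 1 => by decide
  | 2 => by decide
  | 3 => by decide
  | m + 4 => add_nonneg (shift_nonneg m) (by norm_num)

end ThirdProjector

/-! ## Contractible complexes -/

namespace CobComplex

open scoped ZeroObject

variable {n : ℕ}

/-- A complex with a contraction of degree zero is homotopy equivalent to zero. -/
theorem isContractible_of_contraction (K : CobComplex n) (s : ∀ k : ℤ, K.X (k + 1) ⟶ K.X k)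
    (hs : ∀ k, MatCob.IsDegreeZero (s k))
    (h : ∀ k, s k ≫ K.d k (k + 1) + K.d (k + 1) (k + 1 + 1) ≫ s (k + 1) = 𝟙 (K.X (k + 1))) :
    K.IsContractible := by
  classical
  -- The required homotopy goes from the zero map to the identity, so the contraction enters with a
  -- minus sign.
  let t : ∀ i j : ℤ, K.X i ⟶ K.X j := fun i j =>
    if e : j + 1 = i then eqToHom (by rw [e]) ≫ (-s j) else 0
  have ht (k : ℤ) : t (k + 1) k = -s k := by
    simp only [t]
    rw [dif_pos trivial, eqToHom_refl, Category.id_comp]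
  refine ⟨⟨0, 0, ⟨t, fun i j w => dif_neg w, fun i => ?_⟩, Homotopy.ofEq ?_⟩, fun i j => ?_⟩
  · obtain ⟨k, rfl⟩ : ∃ k, i = k + 1 := ⟨i - 1, by ring⟩
    have e : (ComplexShape.up ℤ).Rel (k + 1) (k + 1 + 1) := rfl
    have e' : (ComplexShape.up ℤ).Rel k (k + 1) := rfl
    rw [dNext_eq _ e, prevD_eq _ e', ht, ht, HomologicalComplex.id_f, ← h k]
    simp
  · exact (isZero_zero (CobComplex n)).eq_of_src _ _
  · change MatCob.IsDegreeZero (t i j)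
    by_cases e : j + 1 = i
    · subst e
      rw [ht]
      exact fun a b => (hs j a b).neg
    · rw [show t i j = 0 from dif_neg e]
      exact fun a b => Cob.isHomogeneous_zero 0

end CobComplex

namespace ThirdProjector

open Cob

/-! ## Contractions of the third projector -/

/-- The entries of an identity matrix. -/
noncomputable def idMatrix {C : Type*} [Category C] [Preadditive C] (P : Fin 2 → C) (s u : Fin 2) :
    P s ⟶ P u :=
  -- The classical instance is the one used by the identity morphisms of `Mat_`, with which these
  -- entries then agree by definition.
  @dite _ (s = u) (Classical.propDecidable _) (fun h => eqToHom (congrArg P h)) fun _ => 0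

/-- A contraction, without gradings, of the image of the third projector under a functor. -/
structure Contraction (F : Cob 3 ⥤ Cob 3) where
  first : ∀ s, F.obj (Cob.of 0 (diagram 0 s)) ⟶ F.obj (Cob.of 0 .one)
  second : ∀ s t, F.obj (Cob.of 0 (diagram 1 s)) ⟶ F.obj (Cob.of 0 (diagram 0 t))
  third : ∀ s t, F.obj (Cob.of 0 (diagram 2 s)) ⟶ F.obj (Cob.of 0 (diagram 1 t))
  fourth : ∀ s t, F.obj (Cob.of 0 (diagram 3 s)) ⟶ F.obj (Cob.of 0 (diagram 2 t))
  fifth : ∀ s t, F.obj (Cob.of 0 (diagram 4 s)) ⟶ F.obj (Cob.of 0 (diagram 3 t))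
  eq_zero : ∑ t, F.map (entryA t) ≫ first t = 𝟙 _
  eq_one : ∀ s u, first s ≫ F.map (entryA u) + ∑ t, F.map (matrix 0 0 0 s t) ≫ second t u =
    idMatrix (fun s => F.obj (Cob.of 0 (diagram 0 s))) s u
  eq_two : ∀ s u, ∑ t, second s t ≫ F.map (matrix 0 0 0 t u) +
    ∑ t, F.map (matrix 1 0 0 s t) ≫ third t u =
      idMatrix (fun s => F.obj (Cob.of 0 (diagram 1 s))) s u
  eq_three : ∀ s u, ∑ t, third s t ≫ F.map (matrix 1 0 0 t u) +
    ∑ t, F.map (matrix 2 0 0 s t) ≫ fourth t u =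
      idMatrix (fun s => F.obj (Cob.of 0 (diagram 2 s))) s u
  eq_four : ∀ s u, ∑ t, fourth s t ≫ F.map (matrix 2 0 0 t u) +
    ∑ t, F.map (matrix 3 0 0 s t) ≫ fifth t u =
      idMatrix (fun s => F.obj (Cob.of 0 (diagram 3 s))) s u
  eq_five : ∀ s u, ∑ t, fifth s t ≫ F.map (matrix 3 0 0 t u) +
    ∑ t, F.map (matrix 4 0 0 s t) ≫
      -- `diagram 5` and `diagram 4` reduce to `diagram 1` and `diagram 0`. The function `id` only
      -- assigns the shifted type to `second`, which closes the period.
      @id (∀ s t, F.obj (Cob.of 0 (diagram 5 s)) ⟶ F.obj (Cob.of 0 (diagram 4 t))) second t u =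
      idMatrix (fun s => F.obj (Cob.of 0 (diagram 4 s))) s u
  first_degree : ∀ s, IsHomogeneous 1 (first s)
  second_degree : ∀ s t, IsHomogeneous 1 (second s t)
  third_degree : ∀ s t, IsHomogeneous 2 (third s t)
  fourth_degree : ∀ s t, IsHomogeneous 1 (fourth s t)
  fifth_degree : ∀ s t, IsHomogeneous 2 (fifth s t)

namespace Contraction

variable {F : Cob 3 ⥤ Cob 3} (c : Contraction F)

/-- The periodic part of the contraction. -/
def hom : ∀ (m : ℕ) (s t : Fin 2),
    F.obj (Cob.of 0 (diagram (m + 1) s)) ⟶ F.obj (Cob.of 0 (diagram m t))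
  | 0 => c.second
  | 1 => c.third
  | 2 => c.fourth
  | 3 => c.fifth
  | m + 4 => hom m

theorem hom_spec : ∀ (m : ℕ) (s u : Fin 2), ∑ t, c.hom m s t ≫ F.map (matrix m 0 0 t u) +
    ∑ t, F.map (matrix (m + 1) 0 0 s t) ≫ c.hom (m + 1) t u =
      idMatrix (fun s => F.obj (Cob.of 0 (diagram (m + 1) s))) s u
  | 0 => c.eq_two
  | 1 => c.eq_three
  | 2 => c.eq_four
  | 3 => c.eq_five
  | m + 4 => hom_spec m

theorem hom_degree : ∀ (m : ℕ) (s t : Fin 2), IsHomogeneous (shift (m + 1) - shift m) (c.hom m s t)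
  | 0, s, t => by
    rw [show shift (0 + 1) - shift 0 = 1 by rfl]
    exact c.second_degree s t
  | 1, s, t => by
    rw [show shift (1 + 1) - shift 1 = 2 by rfl]
    exact c.third_degree s t
  | 2, s, t => by
    rw [show shift (2 + 1) - shift 2 = 1 by rfl]
    exact c.fourth_degree s t
  | 3, s, t => by
    rw [show shift (3 + 1) - shift 3 = 2 by rfl]
    exact c.fifth_degree s t
  | m + 4, s, t => by
    rw [show shift (m + 4 + 1) - shift (m + 4) = shift (m + 1) - shift m by
      change shift (m + 1) + 6 - (shift m + 6) = _
      ring]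
    exact hom_degree m s t

end Contraction

/-- A change of gradings on the image of a functor. -/
noncomputable def regradeMap (F : Cob 3 ⥤ Cob 3) (s t : ℤ) {a b : TLDiagram 3}
    (f : F.obj (Cob.of 0 a) ⟶ F.obj (Cob.of 0 b)) : F.obj (Cob.of s a) ⟶ F.obj (Cob.of t b) :=
  F.map (Cob.single s 0 (Cobordism.id a)) ≫ f ≫ F.map (Cob.single 0 t (Cobordism.id b))

section regradeMap

variable (F : Cob 3 ⥤ Cob 3) {a b c : TLDiagram 3} (s t u : ℤ)

theorem map_regrade (f : Cob.of 0 a ⟶ Cob.of 0 b) :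
    F.map (regrade s t f) = regradeMap F s t (F.map f) := by
  rw [regrade, regradeMap, F.map_comp, F.map_comp]

theorem regradeMap_comp (f : F.obj (Cob.of 0 a) ⟶ F.obj (Cob.of 0 b))
    (g : F.obj (Cob.of 0 b) ⟶ F.obj (Cob.of 0 c)) :
    regradeMap F s t f ≫ regradeMap F t u g = regradeMap F s u (f ≫ g) := by
  have h : F.map (single 0 t (Cobordism.id b)) ≫ F.map (single t 0 (Cobordism.id b)) = 𝟙 _ := by
    rw [← F.map_comp, single_comp, Cobordism.id_comp, single_id, F.map_id]
  simp only [regradeMap, Category.assoc]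
  rw [← Category.assoc (F.map (single 0 t _)), h, Category.id_comp]

theorem regradeMap_id : regradeMap F s s (𝟙 (F.obj (Cob.of 0 a))) = 𝟙 _ := by
  rw [regradeMap, Category.id_comp, ← F.map_comp, single_comp, Cobordism.id_comp, single_id,
    F.map_id]

theorem regradeMap_add (f g : F.obj (Cob.of 0 a) ⟶ F.obj (Cob.of 0 b)) :
    regradeMap F s t (f + g) = regradeMap F s t f + regradeMap F s t g := by
  simp [regradeMap]

theorem regradeMap_zero : regradeMap F s t (0 : F.obj (Cob.of 0 a) ⟶ F.obj (Cob.of 0 b)) = 0 := by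
  simp [regradeMap]

theorem regradeMap_sum (f : Fin 2 → (F.obj (Cob.of 0 a) ⟶ F.obj (Cob.of 0 b))) :
    regradeMap F s t (∑ r, f r) = ∑ r, regradeMap F s t (f r) := by
  rw [Fin.sum_univ_two, Fin.sum_univ_two, regradeMap_add]

theorem regradeMap_idMatrix (P : Fin 2 → TLDiagram 3) (r q : Fin 2) :
    regradeMap F s s (idMatrix (fun r => F.obj (Cob.of 0 (P r))) r q) =
      idMatrix (fun r => F.obj (Cob.of s (P r))) r q := by
  by_cases h : r = q
  · subst h
    simp only [idMatrix, dif_pos, eqToHom_refl]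
    exact regradeMap_id F s
  · simp only [idMatrix, dif_neg h]
    exact regradeMap_zero F s s

theorem regradeMap_add_eq (P : Fin 2 → TLDiagram 3) {r q : Fin 2}
    {f g : F.obj (Cob.of 0 (P r)) ⟶ F.obj (Cob.of 0 (P q))}
    (h : f + g = idMatrix (fun r => F.obj (Cob.of 0 (P r))) r q) :
    regradeMap F s s f + regradeMap F s s g = idMatrix (fun r => F.obj (Cob.of s (P r))) r q := by
  rw [← regradeMap_add, h, regradeMap_idMatrix]

end regradeMap

/-! ### From the contraction of one period to a graded contraction of the complex. -/

namespace Contraction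

variable {F : Cob 3 ⥤ Cob 3} (c : Contraction F)

theorem add_eq_of_eq {P Q : Cob 3} {f g f' g' h : P ⟶ Q} (hf : f = f') (hg : g = g')
    (e : f' + g' = h) : f + g = h := by
  rw [hf, hg, e]

/-- The contraction as a sequence of matrices with gradings. -/
noncomputable def homotopy [F.Additive] : ∀ k : ℤ, F.mapMat_.obj (X (k + 1)) ⟶ F.mapMat_.obj (X k)
  | .ofNat 0 => fun s _ => regradeMap F 1 0 (c.first s)
  | .ofNat (m + 1) => fun s t => regradeMap F (shift (m + 1)) (shift m) (c.hom m s t)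
  | .negSucc _ => 0

/-- The unshifted entries have exactly the degree by which the gradings of their two ends differ.
Regrading brings it to zero because, by `hF`, the functor respects the degree of a change of
grading. -/
theorem isDegreeZero_homotopy [F.Additive]
    (hF : ∀ s t a, IsHomogeneous (t - s) (F.map (single s t (Cobordism.id a)))) :
    ∀ k : ℤ, MatCob.IsDegreeZero (c.homotopy k) := by
  have h (s t : ℤ) {a b : TLDiagram 3} {f : F.obj (Cob.of 0 a) ⟶ F.obj (Cob.of 0 b)}
      (hf : IsHomogeneous (s - t) f) : IsHomogeneous 0 (regradeMap F s t f) := by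
    have h' := (hF s 0 a).comp (hf.comp (hF 0 t b))
    rwa [show 0 - s + (s - t + (t - 0)) = 0 by ring] at h'
  rintro ((_ | m) | _)
  · exact fun s _ => h 1 0 (c.first_degree s)
  · exact fun s t => h _ _ (c.hom_degree m s t)
  · exact fun s t => isHomogeneous_zero 0

theorem map_entryA (t : Fin 2) :
    F.map (matrixA PUnit.unit t) = regradeMap F 0 1 (F.map (entryA t)) :=
  (congrArg F.map (matrixA_eq_regrade _ t)).trans (map_regrade F 0 1 (entryA t))

theorem map_matrix (m : ℕ) (s t : Fin 2) :
    F.map (matrix m (shift m) (shift (m + 1)) s t) =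
      regradeMap F (shift m) (shift (m + 1)) (F.map (matrix m 0 0 s t)) :=
  (congrArg F.map (matrix_eq_regrade m _ _ s t)).trans (map_regrade F _ _ _)

theorem homotopy_spec [F.Additive] : ∀ k : ℤ,
    c.homotopy k ≫ F.mapMat_.map (d k) + F.mapMat_.map (d (k + 1)) ≫ c.homotopy (k + 1) =
      𝟙 (F.mapMat_.obj (X (k + 1)))
  | .ofNat 0 => by
    ext (s : Fin 2) (u : Fin 2)
    have e₁ : (c.homotopy (.ofNat 0) ≫ F.mapMat_.map (d (.ofNat 0))) s u =
        regradeMap F 1 1 (c.first s ≫ F.map (entryA u)) := by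
      refine (Mat_.comp_apply (M := F.mapMat_.obj (term 1)) (N := F.mapMat_.obj (term 0))
        (K := F.mapMat_.obj (term 1)) _ _ s u).trans ?_
      refine (Fintype.sum_unique (ι := PUnit) _).trans ?_
      exact (congrArg (_ ≫ ·) (map_entryA u)).trans (regradeMap_comp F 1 0 1 _ _)
    have e₂ : (F.mapMat_.map (d (.ofNat 1)) ≫ c.homotopy (.ofNat 1)) s u =
        regradeMap F 1 1 (∑ t, F.map (matrix 0 0 0 s t) ≫ c.second t u) := by
      refine (Mat_.comp_apply (M := F.mapMat_.obj (term 1)) (N := F.mapMat_.obj (term 2))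
        (K := F.mapMat_.obj (term 1)) _ _ s u).trans ?_
      refine Eq.trans ?_ (regradeMap_sum F _ _ _).symm
      exact Finset.sum_congr rfl fun t _ => (congrArg (· ≫ _) (map_matrix 0 s t)).trans
        (regradeMap_comp F 1 2 1 _ _)
    exact add_eq_of_eq e₁ e₂ (regradeMap_add_eq F 1 (diagram 0) (c.eq_one s u))
  | .ofNat (m + 1) => by
    ext (s : Fin 2) (u : Fin 2)
    have e₁ : (c.homotopy (.ofNat (m + 1)) ≫ F.mapMat_.map (d (.ofNat (m + 1)))) s u =
        regradeMap F (shift (m + 1)) (shift (m + 1))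
          (∑ t, c.hom m s t ≫ F.map (matrix m 0 0 t u)) := by
      refine (Mat_.comp_apply (M := F.mapMat_.obj (term (m + 2))) (N := F.mapMat_.obj (term (m + 1)))
        (K := F.mapMat_.obj (term (m + 2))) _ _ s u).trans ?_
      refine Eq.trans ?_ (regradeMap_sum F _ _ _).symm
      exact Finset.sum_congr rfl fun t _ => (congrArg (_ ≫ ·) (map_matrix m t u)).trans
        (regradeMap_comp F _ _ _ _ _)
    have e₂ : (F.mapMat_.map (d (.ofNat (m + 2))) ≫ c.homotopy (.ofNat (m + 2))) s u =
        regradeMap F (shift (m + 1)) (shift (m + 1))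
          (∑ t, F.map (matrix (m + 1) 0 0 s t) ≫ c.hom (m + 1) t u) := by
      refine (Mat_.comp_apply (M := F.mapMat_.obj (term (m + 2))) (N := F.mapMat_.obj (term (m + 3)))
        (K := F.mapMat_.obj (term (m + 2))) _ _ s u).trans ?_
      refine Eq.trans ?_ (regradeMap_sum F _ _ _).symm
      exact Finset.sum_congr rfl fun t _ => (congrArg (· ≫ _) (map_matrix (m + 1) s t)).trans
        (regradeMap_comp F _ _ _ _ _)
    exact add_eq_of_eq e₁ e₂ (regradeMap_add_eq F _ (diagram (m + 1)) (c.hom_spec m s u))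
  -- Here the identity is that of degree zero. The term in degree `-1` vanishes, so only `eq_zero`
  -- is left.
  | .negSucc 0 => by
    ext s u
    have e₂ : (F.mapMat_.map (d (.ofNat 0)) ≫ c.homotopy (.ofNat 0)) s u =
        regradeMap F 0 0 (∑ t, F.map (entryA t) ≫ c.first t) := by
      refine (Mat_.comp_apply (M := F.mapMat_.obj (term 0)) (N := F.mapMat_.obj (term 1))
        (K := F.mapMat_.obj (term 0)) _ _ s u).trans ?_
      refine Eq.trans ?_ (regradeMap_sum F _ _ _).symm
      exact Finset.sum_congr rfl fun t _ => (congrArg (· ≫ _) (map_entryA t)).trans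
        (regradeMap_comp F 0 1 0 _ _)
    have e₁ : (c.homotopy (.negSucc 0) ≫ F.mapMat_.map (d (.negSucc 0))) s u = 0 :=
      congrArg (fun M : F.mapMat_.obj (X (.negSucc 0 + 1)) ⟶ F.mapMat_.obj (X (.negSucc 0 + 1)) =>
        M s u) zero_comp
    have e₃ : (𝟙 (F.mapMat_.obj (X (.negSucc 0 + 1)))) s u = 𝟙 (F.obj (Cob.of 0 .one)) := by
      cases s
      cases u
      exact dif_pos rfl
    refine add_eq_of_eq e₁ e₂ (Eq.trans ((zero_add _).trans ?_) e₃.symm)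
    rw [c.eq_zero, regradeMap_id]
  | .negSucc (m + 1) => by
    ext s u
    exact s.elim

theorem isContractible [F.Additive] (c : Contraction F)
    (hF : ∀ s t a, IsHomogeneous (t - s) (F.map (single s t (Cobordism.id a)))) :
    CobComplex.IsContractible
      ((F.mapMat_.mapHomologicalComplex _).obj (thirdProjector d_comp_d)) := by
  refine CobComplex.isContractible_of_contraction _ c.homotopy (c.isDegreeZero_homotopy hF)
    fun k => ?_
  have h (k : ℤ) : (thirdProjector d_comp_d).d k (k + 1) = d k := CochainComplex.of_d X d k
  simp only [Functor.mapHomologicalComplex_obj_d, h]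
  exact c.homotopy_spec k

end Contraction

end ThirdProjector

/-! ### The contractions for the two turnbacks on either side. -/

namespace ThirdProjector

open Cob

theorem idMatrix_self {C : Type*} [Category C] [Preadditive C] (P : Fin 2 → C) (s : Fin 2) :
    idMatrix P s s = 𝟙 (P s) := by
  simp only [idMatrix, dif_pos, eqToHom_refl]

theorem idMatrix_of_ne {C : Type*} [Category C] [Preadditive C] (P : Fin 2 → C) {s u : Fin 2}
    (h : s ≠ u) : idMatrix P s u = 0 := by
  simp only [idMatrix, dif_neg h]

/-- The calculus lists the diagram with a circle first, whereas the matrices keep the fixed order of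
the summands. Here `p` is the position of `EE` or `FF` in that order. -/
theorem sum_eq_of_first {M : Type*} [AddCommMonoid M] {f : Fin 2 → M} {z : M} (p : Fin 2)
    (h : f p + f (p + 1) = z) : ∑ t, f t = z := by
  rw [Fin.sum_univ_two, ← h]
  fin_cases p
  · rfl
  · exact add_comm _ _

theorem add_sum_eq_of_first {M : Type*} [AddCommMonoid M] {x : M} {f : Fin 2 → M} {y z : M}
    (p : Fin 2) (h : x + (f p + f (p + 1)) = y) (hz : z = y) : x + ∑ t, f t = z := by
  rw [sum_eq_of_first p rfl, h, hz]

theorem sum_add_sum_eq_of_first {M : Type*} [AddCommMonoid M] {f g : Fin 2 → M} {y z : M}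
    (p q : Fin 2) (h : (f p + f (p + 1)) + (g q + g (q + 1)) = y) (hz : z = y) :
    ∑ t, f t + ∑ t, g t = z := by
  rw [sum_eq_of_first p rfl, sum_eq_of_first q rfl, h, hz]

/-- The contraction of the third projector below the turnback `e 0`. -/
noncomputable def contractionLZero : Contraction (Cob.tensorLeft ⟨0, gen 0⟩) where
  first s := match s with | 0 => (calculusL zero_ne_one).δ | 1 => 0
  second s t := match s, t with | 0, 0 => (calculusL zero_ne_one).h₂₁₁ | 0, 1 => (calculusL zero_ne_one).h₂₁₂ | 1, 0 => (calculusL zero_ne_one).h₂₂₁ | 1, 1 => 0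
  third s t := match s, t with | 0, 0 => (calculusL zero_ne_one).h₃₁₁ | 0, 1 => 0 | 1, 0 => 0 | 1, 1 => 0
  fourth s t := match s, t with | 0, 0 => (calculusL zero_ne_one).h₄₁₁ | 0, 1 => (calculusL zero_ne_one).h₄₁₂ | 1, 0 => (calculusL zero_ne_one).h₄₂₁ | 1, 1 => 0
  fifth s t := match s, t with | 0, 0 => (calculusL zero_ne_one).h₅₁₁ | 0, 1 => 0 | 1, 0 => 0 | 1, 1 => 0
  eq_zero := sum_eq_of_first 0 (calculusL zero_ne_one).zeroth
  eq_one s u := by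
    fin_cases s <;> fin_cases u
    · exact add_sum_eq_of_first 0 (calculusL zero_ne_one).first₁₁ (idMatrix_self _ 0)
    · exact add_sum_eq_of_first 0 (calculusL zero_ne_one).first₁₂ (idMatrix_of_ne _ zero_ne_one)
    · exact add_sum_eq_of_first 0 (calculusL zero_ne_one).first₂₁ (idMatrix_of_ne _ one_ne_zero)
    · exact add_sum_eq_of_first 0 (calculusL zero_ne_one).first₂₂ (idMatrix_self _ 1)
  eq_two s u := by
    fin_cases s <;> fin_cases u
    · exact sum_add_sum_eq_of_first 0 0 (calculusL zero_ne_one).second₁₁ (idMatrix_self _ 0)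
    · exact sum_add_sum_eq_of_first 0 0 (calculusL zero_ne_one).second₁₂ (idMatrix_of_ne _ zero_ne_one)
    · exact sum_add_sum_eq_of_first 0 0 (calculusL zero_ne_one).second₂₁ (idMatrix_of_ne _ one_ne_zero)
    · exact sum_add_sum_eq_of_first 0 0 (calculusL zero_ne_one).second₂₂ (idMatrix_self _ 1)
  eq_three s u := by
    fin_cases s <;> fin_cases u
    · exact sum_add_sum_eq_of_first 0 0 (calculusL zero_ne_one).third₁₁ (idMatrix_self _ 0)
    · exact sum_add_sum_eq_of_first 0 0 (calculusL zero_ne_one).third₁₂ (idMatrix_of_ne _ zero_ne_one)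
    · exact sum_add_sum_eq_of_first 0 0 (calculusL zero_ne_one).third₂₁ (idMatrix_of_ne _ one_ne_zero)
    · exact sum_add_sum_eq_of_first 0 0 (calculusL zero_ne_one).third₂₂ (idMatrix_self _ 1)
  eq_four s u := by
    fin_cases s <;> fin_cases u
    · exact sum_add_sum_eq_of_first 0 0 (calculusL zero_ne_one).fourth₁₁ (idMatrix_self _ 0)
    · exact sum_add_sum_eq_of_first 0 0 (calculusL zero_ne_one).fourth₁₂ (idMatrix_of_ne _ zero_ne_one)
    · exact sum_add_sum_eq_of_first 0 0 (calculusL zero_ne_one).fourth₂₁ (idMatrix_of_ne _ one_ne_zero)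
    · exact sum_add_sum_eq_of_first 0 0 (calculusL zero_ne_one).fourth₂₂ (idMatrix_self _ 1)
  eq_five s u := by
    fin_cases s <;> fin_cases u
    · exact sum_add_sum_eq_of_first 0 0 (calculusL zero_ne_one).fifth₁₁ (idMatrix_self _ 0)
    · exact sum_add_sum_eq_of_first 0 0 (calculusL zero_ne_one).fifth₁₂ (idMatrix_of_ne _ zero_ne_one)
    · exact sum_add_sum_eq_of_first 0 0 (calculusL zero_ne_one).fifth₂₁ (idMatrix_of_ne _ one_ne_zero)
    · exact sum_add_sum_eq_of_first 0 0 (calculusL zero_ne_one).fifth₂₂ (idMatrix_self _ 1)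
  first_degree s := by
    fin_cases s
    · exact (isGraded_calculusL zero_ne_one).δ
    · exact isHomogeneous_zero _
  second_degree s t := by
    fin_cases s <;> fin_cases t
    · exact (isGraded_calculusL zero_ne_one).h₂₁₁
    · exact (isGraded_calculusL zero_ne_one).h₂₁₂
    · exact (isGraded_calculusL zero_ne_one).h₂₂₁
    · exact isHomogeneous_zero _
  third_degree s t := by
    fin_cases s <;> fin_cases t
    · exact (isGraded_calculusL zero_ne_one).h₃₁₁
    · exact isHomogeneous_zero _
    · exact isHomogeneous_zero _
    · exact isHomogeneous_zero _
  fourth_degree s t := by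
    fin_cases s <;> fin_cases t
    · exact (isGraded_calculusL zero_ne_one).h₄₁₁
    · exact (isGraded_calculusL zero_ne_one).h₄₁₂
    · exact (isGraded_calculusL zero_ne_one).h₄₂₁
    · exact isHomogeneous_zero _
  fifth_degree s t := by
    fin_cases s <;> fin_cases t
    · exact (isGraded_calculusL zero_ne_one).h₅₁₁
    · exact isHomogeneous_zero _
    · exact isHomogeneous_zero _
    · exact isHomogeneous_zero _

/-- The contraction of the third projector below the turnback `e 1`. -/
noncomputable def contractionLOne : Contraction (Cob.tensorLeft ⟨0, gen 1⟩) where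
  first s := match s with | 0 => 0 | 1 => (calculusL one_ne_zero).δ
  second s t := match s, t with | 0, 0 => 0 | 0, 1 => (calculusL one_ne_zero).h₂₂₁ | 1, 0 => (calculusL one_ne_zero).h₂₁₂ | 1, 1 => (calculusL one_ne_zero).h₂₁₁
  third s t := match s, t with | 0, 0 => 0 | 0, 1 => 0 | 1, 0 => 0 | 1, 1 => (calculusL one_ne_zero).h₃₁₁
  fourth s t := match s, t with | 0, 0 => 0 | 0, 1 => (calculusL one_ne_zero).h₄₂₁ | 1, 0 => (calculusL one_ne_zero).h₄₁₂ | 1, 1 => (calculusL one_ne_zero).h₄₁₁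
  fifth s t := match s, t with | 0, 0 => 0 | 0, 1 => 0 | 1, 0 => 0 | 1, 1 => (calculusL one_ne_zero).h₅₁₁
  eq_zero := sum_eq_of_first 1 (calculusL one_ne_zero).zeroth
  eq_one s u := by
    fin_cases s <;> fin_cases u
    · exact add_sum_eq_of_first 1 (calculusL one_ne_zero).first₂₂ (idMatrix_self _ 0)
    · exact add_sum_eq_of_first 1 (calculusL one_ne_zero).first₂₁ (idMatrix_of_ne _ zero_ne_one)
    · exact add_sum_eq_of_first 1 (calculusL one_ne_zero).first₁₂ (idMatrix_of_ne _ one_ne_zero)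
    · exact add_sum_eq_of_first 1 (calculusL one_ne_zero).first₁₁ (idMatrix_self _ 1)
  eq_two s u := by
    fin_cases s <;> fin_cases u
    · exact sum_add_sum_eq_of_first 1 1 (calculusL one_ne_zero).second₂₂ (idMatrix_self _ 0)
    · exact sum_add_sum_eq_of_first 1 1 (calculusL one_ne_zero).second₂₁ (idMatrix_of_ne _ zero_ne_one)
    · exact sum_add_sum_eq_of_first 1 1 (calculusL one_ne_zero).second₁₂ (idMatrix_of_ne _ one_ne_zero)
    · exact sum_add_sum_eq_of_first 1 1 (calculusL one_ne_zero).second₁₁ (idMatrix_self _ 1)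
  eq_three s u := by
    fin_cases s <;> fin_cases u
    · exact sum_add_sum_eq_of_first 1 1 (calculusL one_ne_zero).third₂₂ (idMatrix_self _ 0)
    · exact sum_add_sum_eq_of_first 1 1 (calculusL one_ne_zero).third₂₁ (idMatrix_of_ne _ zero_ne_one)
    · exact sum_add_sum_eq_of_first 1 1 (calculusL one_ne_zero).third₁₂ (idMatrix_of_ne _ one_ne_zero)
    · exact sum_add_sum_eq_of_first 1 1 (calculusL one_ne_zero).third₁₁ (idMatrix_self _ 1)
  eq_four s u := by
    fin_cases s <;> fin_cases u
    · exact sum_add_sum_eq_of_first 1 1 (calculusL one_ne_zero).fourth₂₂ (idMatrix_self _ 0)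
    · exact sum_add_sum_eq_of_first 1 1 (calculusL one_ne_zero).fourth₂₁ (idMatrix_of_ne _ zero_ne_one)
    · exact sum_add_sum_eq_of_first 1 1 (calculusL one_ne_zero).fourth₁₂ (idMatrix_of_ne _ one_ne_zero)
    · exact sum_add_sum_eq_of_first 1 1 (calculusL one_ne_zero).fourth₁₁ (idMatrix_self _ 1)
  eq_five s u := by
    fin_cases s <;> fin_cases u
    · exact sum_add_sum_eq_of_first 1 1 (calculusL one_ne_zero).fifth₂₂ (idMatrix_self _ 0)
    · exact sum_add_sum_eq_of_first 1 1 (calculusL one_ne_zero).fifth₂₁ (idMatrix_of_ne _ zero_ne_one)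
    · exact sum_add_sum_eq_of_first 1 1 (calculusL one_ne_zero).fifth₁₂ (idMatrix_of_ne _ one_ne_zero)
    · exact sum_add_sum_eq_of_first 1 1 (calculusL one_ne_zero).fifth₁₁ (idMatrix_self _ 1)
  first_degree s := by
    fin_cases s
    · exact isHomogeneous_zero _
    · exact (isGraded_calculusL one_ne_zero).δ
  second_degree s t := by
    fin_cases s <;> fin_cases t
    · exact isHomogeneous_zero _
    · exact (isGraded_calculusL one_ne_zero).h₂₂₁
    · exact (isGraded_calculusL one_ne_zero).h₂₁₂
    · exact (isGraded_calculusL one_ne_zero).h₂₁₁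
  third_degree s t := by
    fin_cases s <;> fin_cases t
    · exact isHomogeneous_zero _
    · exact isHomogeneous_zero _
    · exact isHomogeneous_zero _
    · exact (isGraded_calculusL one_ne_zero).h₃₁₁
  fourth_degree s t := by
    fin_cases s <;> fin_cases t
    · exact isHomogeneous_zero _
    · exact (isGraded_calculusL one_ne_zero).h₄₂₁
    · exact (isGraded_calculusL one_ne_zero).h₄₁₂
    · exact (isGraded_calculusL one_ne_zero).h₄₁₁
  fifth_degree s t := by
    fin_cases s <;> fin_cases t
    · exact isHomogeneous_zero _
    · exact isHomogeneous_zero _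
    · exact isHomogeneous_zero _
    · exact (isGraded_calculusL one_ne_zero).h₅₁₁

/-- The contraction of the third projector above the turnback `e 0`. -/
noncomputable def contractionRZero : Contraction (Cob.tensorRight ⟨0, gen 0⟩) where
  first s := match s with | 0 => (calculusR zero_ne_one).δ | 1 => 0
  second s t := match s, t with | 0, 0 => (calculusR zero_ne_one).h₂₂₁ | 0, 1 => 0 | 1, 0 => (calculusR zero_ne_one).h₂₁₁ | 1, 1 => (calculusR zero_ne_one).h₂₁₂
  third s t := match s, t with | 0, 0 => 0 | 0, 1 => 0 | 1, 0 => 0 | 1, 1 => (calculusR zero_ne_one).h₃₁₁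
  fourth s t := match s, t with | 0, 0 => (calculusR zero_ne_one).h₄₁₂ | 0, 1 => (calculusR zero_ne_one).h₄₁₁ | 1, 0 => 0 | 1, 1 => (calculusR zero_ne_one).h₄₂₁
  fifth s t := match s, t with | 0, 0 => (calculusR zero_ne_one).h₅₁₁ | 0, 1 => 0 | 1, 0 => 0 | 1, 1 => 0
  eq_zero := sum_eq_of_first 0 (calculusR zero_ne_one).zeroth
  eq_one s u := by
    fin_cases s <;> fin_cases u
    -- With `e_0` stacked below, the circle in degree two comes from `e₂e₁`, the second summand,
    -- although in degree one it comes from the first. Below, the two kinds of terms call for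
    -- different indices.
    · exact add_sum_eq_of_first 1 (calculusR zero_ne_one).first₁₁ (idMatrix_self _ 0)
    · exact add_sum_eq_of_first 1 (calculusR zero_ne_one).first₁₂ (idMatrix_of_ne _ zero_ne_one)
    · exact add_sum_eq_of_first 1 (calculusR zero_ne_one).first₂₁ (idMatrix_of_ne _ one_ne_zero)
    · exact add_sum_eq_of_first 1 (calculusR zero_ne_one).first₂₂ (idMatrix_self _ 1)
  eq_two s u := by
    fin_cases s <;> fin_cases u
    · exact sum_add_sum_eq_of_first 0 1 (calculusR zero_ne_one).second₂₂ (idMatrix_self _ 0)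
    · exact sum_add_sum_eq_of_first 0 1 (calculusR zero_ne_one).second₂₁ (idMatrix_of_ne _ zero_ne_one)
    · exact sum_add_sum_eq_of_first 0 1 (calculusR zero_ne_one).second₁₂ (idMatrix_of_ne _ one_ne_zero)
    · exact sum_add_sum_eq_of_first 0 1 (calculusR zero_ne_one).second₁₁ (idMatrix_self _ 1)
  eq_three s u := by
    fin_cases s <;> fin_cases u
    · exact sum_add_sum_eq_of_first 1 0 (calculusR zero_ne_one).third₂₂ (idMatrix_self _ 0)
    · exact sum_add_sum_eq_of_first 1 0 (calculusR zero_ne_one).third₂₁ (idMatrix_of_ne _ zero_ne_one)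
    · exact sum_add_sum_eq_of_first 1 0 (calculusR zero_ne_one).third₁₂ (idMatrix_of_ne _ one_ne_zero)
    · exact sum_add_sum_eq_of_first 1 0 (calculusR zero_ne_one).third₁₁ (idMatrix_self _ 1)
  eq_four s u := by
    fin_cases s <;> fin_cases u
    · exact sum_add_sum_eq_of_first 1 0 (calculusR zero_ne_one).fourth₁₁ (idMatrix_self _ 0)
    · exact sum_add_sum_eq_of_first 1 0 (calculusR zero_ne_one).fourth₁₂ (idMatrix_of_ne _ zero_ne_one)
    · exact sum_add_sum_eq_of_first 1 0 (calculusR zero_ne_one).fourth₂₁ (idMatrix_of_ne _ one_ne_zero)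
    · exact sum_add_sum_eq_of_first 1 0 (calculusR zero_ne_one).fourth₂₂ (idMatrix_self _ 1)
  eq_five s u := by
    fin_cases s <;> fin_cases u
    · exact sum_add_sum_eq_of_first 0 1 (calculusR zero_ne_one).fifth₁₁ (idMatrix_self _ 0)
    · exact sum_add_sum_eq_of_first 0 1 (calculusR zero_ne_one).fifth₁₂ (idMatrix_of_ne _ zero_ne_one)
    · exact sum_add_sum_eq_of_first 0 1 (calculusR zero_ne_one).fifth₂₁ (idMatrix_of_ne _ one_ne_zero)
    · exact sum_add_sum_eq_of_first 0 1 (calculusR zero_ne_one).fifth₂₂ (idMatrix_self _ 1)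
  first_degree s := by
    fin_cases s
    · exact (isGraded_calculusR zero_ne_one).δ
    · exact isHomogeneous_zero _
  second_degree s t := by
    fin_cases s <;> fin_cases t
    · exact (isGraded_calculusR zero_ne_one).h₂₂₁
    · exact isHomogeneous_zero _
    · exact (isGraded_calculusR zero_ne_one).h₂₁₁
    · exact (isGraded_calculusR zero_ne_one).h₂₁₂
  third_degree s t := by
    fin_cases s <;> fin_cases t
    · exact isHomogeneous_zero _
    · exact isHomogeneous_zero _
    · exact isHomogeneous_zero _
    · exact (isGraded_calculusR zero_ne_one).h₃₁₁
  fourth_degree s t := by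
    fin_cases s <;> fin_cases t
    · exact (isGraded_calculusR zero_ne_one).h₄₁₂
    · exact (isGraded_calculusR zero_ne_one).h₄₁₁
    · exact isHomogeneous_zero _
    · exact (isGraded_calculusR zero_ne_one).h₄₂₁
  fifth_degree s t := by
    fin_cases s <;> fin_cases t
    · exact (isGraded_calculusR zero_ne_one).h₅₁₁
    · exact isHomogeneous_zero _
    · exact isHomogeneous_zero _
    · exact isHomogeneous_zero _

/-- The contraction of the third projector above the turnback `e 1`. -/
noncomputable def contractionROne : Contraction (Cob.tensorRight ⟨0, gen 1⟩) where
  first s := match s with | 0 => 0 | 1 => (calculusR one_ne_zero).δ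
  second s t := match s, t with | 0, 0 => (calculusR one_ne_zero).h₂₁₂ | 0, 1 => (calculusR one_ne_zero).h₂₁₁ | 1, 0 => 0 | 1, 1 => (calculusR one_ne_zero).h₂₂₁
  third s t := match s, t with | 0, 0 => (calculusR one_ne_zero).h₃₁₁ | 0, 1 => 0 | 1, 0 => 0 | 1, 1 => 0
  fourth s t := match s, t with | 0, 0 => (calculusR one_ne_zero).h₄₂₁ | 0, 1 => 0 | 1, 0 => (calculusR one_ne_zero).h₄₁₁ | 1, 1 => (calculusR one_ne_zero).h₄₁₂
  fifth s t := match s, t with | 0, 0 => 0 | 0, 1 => 0 | 1, 0 => 0 | 1, 1 => (calculusR one_ne_zero).h₅₁₁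
  eq_zero := sum_eq_of_first 1 (calculusR one_ne_zero).zeroth
  eq_one s u := by
    fin_cases s <;> fin_cases u
    · exact add_sum_eq_of_first 0 (calculusR one_ne_zero).first₂₂ (idMatrix_self _ 0)
    · exact add_sum_eq_of_first 0 (calculusR one_ne_zero).first₂₁ (idMatrix_of_ne _ zero_ne_one)
    · exact add_sum_eq_of_first 0 (calculusR one_ne_zero).first₁₂ (idMatrix_of_ne _ one_ne_zero)
    · exact add_sum_eq_of_first 0 (calculusR one_ne_zero).first₁₁ (idMatrix_self _ 1)
  eq_two s u := by
    fin_cases s <;> fin_cases u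
    · exact sum_add_sum_eq_of_first 1 0 (calculusR one_ne_zero).second₁₁ (idMatrix_self _ 0)
    · exact sum_add_sum_eq_of_first 1 0 (calculusR one_ne_zero).second₁₂ (idMatrix_of_ne _ zero_ne_one)
    · exact sum_add_sum_eq_of_first 1 0 (calculusR one_ne_zero).second₂₁ (idMatrix_of_ne _ one_ne_zero)
    · exact sum_add_sum_eq_of_first 1 0 (calculusR one_ne_zero).second₂₂ (idMatrix_self _ 1)
  eq_three s u := by
    fin_cases s <;> fin_cases u
    · exact sum_add_sum_eq_of_first 0 1 (calculusR one_ne_zero).third₁₁ (idMatrix_self _ 0)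
    · exact sum_add_sum_eq_of_first 0 1 (calculusR one_ne_zero).third₁₂ (idMatrix_of_ne _ zero_ne_one)
    · exact sum_add_sum_eq_of_first 0 1 (calculusR one_ne_zero).third₂₁ (idMatrix_of_ne _ one_ne_zero)
    · exact sum_add_sum_eq_of_first 0 1 (calculusR one_ne_zero).third₂₂ (idMatrix_self _ 1)
  eq_four s u := by
    fin_cases s <;> fin_cases u
    · exact sum_add_sum_eq_of_first 0 1 (calculusR one_ne_zero).fourth₂₂ (idMatrix_self _ 0)
    · exact sum_add_sum_eq_of_first 0 1 (calculusR one_ne_zero).fourth₂₁ (idMatrix_of_ne _ zero_ne_one)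
    · exact sum_add_sum_eq_of_first 0 1 (calculusR one_ne_zero).fourth₁₂ (idMatrix_of_ne _ one_ne_zero)
    · exact sum_add_sum_eq_of_first 0 1 (calculusR one_ne_zero).fourth₁₁ (idMatrix_self _ 1)
  eq_five s u := by
    fin_cases s <;> fin_cases u
    · exact sum_add_sum_eq_of_first 1 0 (calculusR one_ne_zero).fifth₂₂ (idMatrix_self _ 0)
    · exact sum_add_sum_eq_of_first 1 0 (calculusR one_ne_zero).fifth₂₁ (idMatrix_of_ne _ zero_ne_one)
    · exact sum_add_sum_eq_of_first 1 0 (calculusR one_ne_zero).fifth₁₂ (idMatrix_of_ne _ one_ne_zero)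
    · exact sum_add_sum_eq_of_first 1 0 (calculusR one_ne_zero).fifth₁₁ (idMatrix_self _ 1)
  first_degree s := by
    fin_cases s
    · exact isHomogeneous_zero _
    · exact (isGraded_calculusR one_ne_zero).δ
  second_degree s t := by
    fin_cases s <;> fin_cases t
    · exact (isGraded_calculusR one_ne_zero).h₂₁₂
    · exact (isGraded_calculusR one_ne_zero).h₂₁₁
    · exact isHomogeneous_zero _
    · exact (isGraded_calculusR one_ne_zero).h₂₂₁
  third_degree s t := by
    fin_cases s <;> fin_cases t
    · exact (isGraded_calculusR one_ne_zero).h₃₁₁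
    · exact isHomogeneous_zero _
    · exact isHomogeneous_zero _
    · exact isHomogeneous_zero _
  fourth_degree s t := by
    fin_cases s <;> fin_cases t
    · exact (isGraded_calculusR one_ne_zero).h₄₂₁
    · exact isHomogeneous_zero _
    · exact (isGraded_calculusR one_ne_zero).h₄₁₁
    · exact (isGraded_calculusR one_ne_zero).h₄₁₂
  fifth_degree s t := by
    fin_cases s <;> fin_cases t
    · exact isHomogeneous_zero _
    · exact isHomogeneous_zero _
    · exact isHomogeneous_zero _
    · exact (isGraded_calculusR one_ne_zero).h₅₁₁

theorem isHomogeneous_tensorLeft_id (z : TLDiagram 3) (s t : ℤ) (a : TLDiagram 3) :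
    IsHomogeneous (t - s) ((Cob.tensorLeft ⟨0, z⟩).map (Cob.single s t (Cobordism.id a))) := by
  rw [tensorLeft_single, Cobordism.id_tensor_id]
  have h := isHomogeneous_single (0 + s) (0 + t) (Cobordism.id (z.stack a))
  rwa [Cobordism.degree_id, show 0 + (0 + t - (0 + s)) = t - s by ring] at h

theorem isHomogeneous_tensorRight_id (z : TLDiagram 3) (s t : ℤ) (a : TLDiagram 3) :
    IsHomogeneous (t - s) ((Cob.tensorRight ⟨0, z⟩).map (Cob.single s t (Cobordism.id a))) := by
  rw [tensorRight_single, Cobordism.id_tensor_id]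
  have h := isHomogeneous_single (s + 0) (t + 0) (Cobordism.id (a.stack z))
  rwa [Cobordism.degree_id, show 0 + (t + 0 - (s + 0)) = t - s by ring] at h

theorem isContractible_tensorLeft (i : Fin 2) :
    ((thirdProjector d_comp_d).tensorLeft (.e i)).IsContractible := by
  fin_cases i
  · exact contractionLZero.isContractible (isHomogeneous_tensorLeft_id _)
  · exact contractionLOne.isContractible (isHomogeneous_tensorLeft_id _)

theorem isContractible_tensorRight (i : Fin 2) :
    ((thirdProjector d_comp_d).tensorRight (.e i)).IsContractible := by
  fin_cases i
  · exact contractionRZero.isContractible (isHomogeneous_tensorRight_id _)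
  · exact contractionROne.isContractible (isHomogeneous_tensorRight_id _)

end ThirdProjector

/-! ## A state sum -/

/-- The field in which the state sum takes its values. -/
abbrev StateField : Type := ZMod 17

/-- The contribution of the topological degree: a square root of `1 / 2` or of `-1 / 2`. -/
def stateUnit : Bool → StateFieldˣ
  -- In `ZMod 17`, `3 ^ 2 = 1 / 2` and `5 ^ 2 = -1 / 2`, with inverses `6` and `7`. These squares
  -- are the traces of the two idempotents of the circle algebra at `α = 1`. Seventeen is the least
  -- prime modulo which both square roots exist.
  | true => ⟨3, 6, by decide, by decide⟩
  | false => ⟨5, 7, by decide, by decide⟩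

/-- The contribution of a dot. -/
def stateSign : Bool → StateField
  | true => 1
  | false => -1

namespace PreSurface

variable {n : ℕ} {a b c d : TLDiagram n}

/-- The weight of a labelling of the components of a surface. -/
noncomputable def weight (S : PreSurface a b) (σ : S.X → Bool) : StateField :=
  (S.chi.prod fun x m => ((stateUnit (σ x) ^ m : StateFieldˣ) : StateField)) *
    S.dots.prod fun x k => stateSign (σ x) ^ k

/-- The labellings of the components that extend given labellings of the two boundary diagrams. -/
abbrev State (S : PreSurface a b) (p : a.Site → Bool) (q : b.Site → Bool) : Type :=
  {σ : S.X → Bool // (∀ x, σ (S.src x) = p x) ∧ ∀ y, σ (S.tgt y) = q y}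

/-- The sum of the weights of all states. -/
noncomputable def amplitude (S : PreSurface a b) (p : a.Site → Bool) (q : b.Site → Bool) :
    StateField :=
  ∑ᶠ σ : S.State p q, S.weight σ.1

theorem amplitude_congr {S T : PreSurface a b} (h : Equivalent S T) :
    S.amplitude = T.amplitude := by
  obtain ⟨φ, h1, h2, h3, h4⟩ := h
  funext p q
  let e : S.State p q ≃ T.State p q :=
    { toFun := fun σ => ⟨fun x => σ.1 (φ.symm x), fun x => by rw [← h1]; simpa using σ.2.1 x,
        fun x => by rw [← h2]; simpa using σ.2.2 x⟩
      invFun := fun σ => ⟨fun x => σ.1 (φ x), fun x => (congrArg σ.1 (h1 x)).trans (σ.2.1 x),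
        fun x => (congrArg σ.1 (h2 x)).trans (σ.2.2 x)⟩
      left_inv := fun σ => Subtype.ext (funext fun x => congrArg σ.1 (φ.symm_apply_apply x))
      right_inv := fun σ => Subtype.ext (funext fun x => congrArg σ.1 (φ.apply_symm_apply x)) }
  refine (finsum_comp_equiv e.symm (f := fun σ : S.State p q => S.weight σ.1)).symm.trans ?_
  refine finsum_congr fun σ => ?_
  change S.weight (fun x => σ.1 (φ x)) = T.weight σ.1
  rw [weight, weight, ← h3, ← h4, Finsupp.prod_mapDomain_index (by simp) (by simp [zpow_add]),
    Finsupp.prod_mapDomain_index (by simp) (by simp [pow_add])]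

/-- Degrees and dots enter as exponents and add up when components are glued, so the weight is
multiplicative. -/
theorem weight_of_mapDomain {X Y Z : Type} (u : X → Z) (v : Y → Z) (p : X →₀ ℤ) (q : Y →₀ ℤ)
    (p' : X →₀ ℕ) (q' : Y →₀ ℕ) (σ : Z → Bool) :
    ((p.mapDomain u + q.mapDomain v).prod fun x m =>
        ((stateUnit (σ x) ^ m : StateFieldˣ) : StateField)) *
      ((p'.mapDomain u + q'.mapDomain v).prod fun x k => stateSign (σ x) ^ k) =
    ((p.prod fun x m => ((stateUnit (σ (u x)) ^ m : StateFieldˣ) : StateField)) *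
      p'.prod fun x k => stateSign (σ (u x)) ^ k) *
    ((q.prod fun x m => ((stateUnit (σ (v x)) ^ m : StateFieldˣ) : StateField)) *
      q'.prod fun x k => stateSign (σ (v x)) ^ k) := by
  rw [Finsupp.prod_add_index' (by simp) (by simp [zpow_add]),
    Finsupp.prod_add_index' (by simp) (by simp [pow_add]),
    Finsupp.prod_mapDomain_index (by simp) (by simp [zpow_add]),
    Finsupp.prod_mapDomain_index (by simp) (by simp [zpow_add]),
    Finsupp.prod_mapDomain_index (by simp) (by simp [pow_add]),
    Finsupp.prod_mapDomain_index (by simp) (by simp [pow_add])]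
  ring

theorem weight_comp (S : PreSurface a b) (T : PreSurface b c) (σ : (S.comp T).X → Bool) :
    (S.comp T).weight σ = S.weight (fun x => σ (Quot.mk _ (Sum.inl x))) *
      T.weight (fun x => σ (Quot.mk _ (Sum.inr x))) :=
  weight_of_mapDomain _ _ S.chi T.chi S.dots T.dots σ

theorem weight_tensor (S : PreSurface a b) (T : PreSurface c d) (σ : (S.tensor T).X → Bool) :
    (S.tensor T).weight σ = S.weight (fun x => σ (Quot.mk _ (Sum.inl x))) *
      T.weight (fun x => σ (Quot.mk _ (Sum.inr x))) :=
  weight_of_mapDomain _ _ S.chi T.chi S.dots T.dots σ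

/-- A state of a composition is a pair of states that agree in the middle. -/
def stateComp (S : PreSurface a b) (T : PreSurface b c) (p : a.Site → Bool) (r : c.Site → Bool) :
    (S.comp T).State p r ≃ Σ q : b.Site → Bool, S.State p q × T.State q r where
  toFun τ := ⟨fun x => τ.1 (Quot.mk _ (Sum.inl (S.tgt x))),
    ⟨fun x => τ.1 (Quot.mk _ (Sum.inl x)), τ.2.1, fun _ => rfl⟩,
    ⟨fun y => τ.1 (Quot.mk _ (Sum.inr y)),
      fun x => congrArg τ.1 (Quot.sound (CompGlue.glue x)).symm, τ.2.2⟩⟩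
  invFun z := ⟨Quot.lift (Sum.elim z.2.1.1 z.2.2.1) (by
      rintro _ _ ⟨x⟩
      exact (z.2.1.2.2 x).trans (z.2.2.2.1 x).symm), z.2.1.2.1, z.2.2.2.2⟩
  left_inv τ := Subtype.ext (funext (by rintro ⟨x | x⟩ <;> rfl))
  right_inv := by
    rintro ⟨q, ⟨σ, h, h'⟩, ⟨ρ, k, k'⟩⟩
    obtain rfl : (fun x => σ (S.tgt x)) = q := funext h'
    rfl

-- A state of the glued surface determines the labels on the middle diagram, so summing over these
-- labels is a matrix product. Finiteness turns the `finsum` into a genuine sum over all states.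
open Classical in
theorem amplitude_comp (S : PreSurface a b) (T : PreSurface b c) [Finite S.X] [Finite T.X]
    (p : a.Site → Bool) (r : c.Site → Bool) :
    (S.comp T).amplitude p r = ∑ q, S.amplitude p q * T.amplitude q r := by
  have : Finite (S.comp T).X := inferInstanceAs (Finite (Quot _))
  have (S' : PreSurface a b) [Finite S'.X] (q) : Fintype (S'.State p q) := Fintype.ofFinite _
  have (T' : PreSurface b c) [Finite T'.X] (q) : Fintype (T'.State q r) := Fintype.ofFinite _
  have : Fintype ((S.comp T).State p r) := Fintype.ofFinite _
  simp only [amplitude, finsum_eq_sum_of_fintype, Finset.sum_mul_sum]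
  rw [Fintype.sum_equiv (stateComp S T p r) _ (fun z => S.weight z.2.1.1 * T.weight z.2.2.1)
    fun τ => weight_comp S T τ.1, Fintype.sum_sigma]
  exact Finset.sum_congr rfl fun q _ => Fintype.sum_prod_type _

/-- A state of a tensor product is a pair of states, if the labels match. -/
def stateTensor (S : PreSurface a b) (T : PreSurface c d) (p : (a.stack c).Site → Bool)
    (q : (b.stack d).Site → Bool) (h : ∀ j, p (Sum.inl (a.bot j)) = p (Sum.inr (c.top j))) :
    (S.tensor T).State p q ≃ S.State (fun x => p (Sum.inl x)) (fun x => q (Sum.inl x)) ×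
      T.State (fun x => p (Sum.inr x)) (fun x => q (Sum.inr x)) where
  toFun τ := ⟨⟨fun x => τ.1 (Quot.mk _ (Sum.inl x)), fun x => τ.2.1 (Sum.inl x),
      fun x => τ.2.2 (Sum.inl x)⟩,
    ⟨fun x => τ.1 (Quot.mk _ (Sum.inr x)), fun x => τ.2.1 (Sum.inr x),
      fun x => τ.2.2 (Sum.inr x)⟩⟩
  invFun z := ⟨Quot.lift (Sum.elim z.1.1 z.2.1) (by
      rintro _ _ ⟨j⟩
      exact (z.1.2.1 _).trans ((h j).trans (z.2.2.1 _).symm)),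
    Sum.rec z.1.2.1 z.2.2.1, Sum.rec z.1.2.2 z.2.2.2⟩
  left_inv τ := Subtype.ext (funext (by rintro ⟨x | x⟩ <;> rfl))
  right_inv _ := rfl

/-- Compatibility is required only along the line where the sources are glued: `TensorGlue`
identifies exactly the components over these points. Otherwise there is no state at all, as
`amplitude_tensor_of_ne` records. -/
theorem amplitude_tensor (S : PreSurface a b) (T : PreSurface c d) [Finite S.X] [Finite T.X]
    (p : (a.stack c).Site → Bool) (q : (b.stack d).Site → Bool)
    (h : ∀ j, p (Sum.inl (a.bot j)) = p (Sum.inr (c.top j))) :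
    (S.tensor T).amplitude p q =
      S.amplitude (fun x => p (Sum.inl x)) (fun x => q (Sum.inl x)) *
        T.amplitude (fun x => p (Sum.inr x)) (fun x => q (Sum.inr x)) := by
  classical
  have : Finite (S.tensor T).X := inferInstanceAs (Finite (Quot _))
  have (p : a.Site → Bool) (q : b.Site → Bool) : Fintype (S.State p q) := Fintype.ofFinite _
  have (p : c.Site → Bool) (q : d.Site → Bool) : Fintype (T.State p q) := Fintype.ofFinite _
  have : Fintype ((S.tensor T).State p q) := Fintype.ofFinite _
  simp only [amplitude, finsum_eq_sum_of_fintype, Finset.sum_mul_sum]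
  rw [Fintype.sum_equiv (stateTensor S T p q h) _ (fun z => S.weight z.1.1 * T.weight z.2.1)
    fun τ => weight_tensor S T τ.1]
  exact Fintype.sum_prod_type _

theorem amplitude_eq_zero (S : PreSurface a b) {p : a.Site → Bool} {q : b.Site → Bool}
    (h : S.State p q → False) : S.amplitude p q = 0 := by
  have : IsEmpty (S.State p q) := ⟨h⟩
  exact finsum_of_isEmpty _

theorem amplitude_tensor_of_ne (S : PreSurface a b) (T : PreSurface c d)
    {p : (a.stack c).Site → Bool} (q : (b.stack d).Site → Bool)
    (h : ¬∀ j, p (Sum.inl (a.bot j)) = p (Sum.inr (c.top j))) :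
    (S.tensor T).amplitude p q = 0 := by
  refine amplitude_eq_zero _ fun τ => h fun j => ?_
  refine (τ.2.1 (Sum.inl (a.bot j))).symm.trans (Eq.trans ?_ (τ.2.1 (Sum.inr (c.top j))))
  exact congrArg τ.1 (Quot.sound (TensorGlue.glue j))

/-- The vertical intervals at `j` and `k` belong to one component, because `b` joins their ends.
Every state therefore gives both points the same label. -/
theorem amplitude_eq_zero_of_adj (S : PreSurface a b) {p : a.Site → Bool} (q : b.Site → Bool)
    (j k : Fin n) (h : b.Adj (b.top j) (b.top k)) (hp : p (a.top j) ≠ p (a.top k)) :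
    S.amplitude p q = 0 := by
  refine amplitude_eq_zero _ fun τ => hp ?_
  rw [← τ.2.1, ← τ.2.1, S.top_eq, S.top_eq, S.tgt_adj _ _ h]

/-- The state sum if the components are in bijection with the sites of the source. -/
theorem amplitude_of_src (S : PreSurface a b) (f : S.X → a.Site) (hf : ∀ x, S.src (f x) = x)
    (p : a.Site → Bool) (q : b.Site → Bool) (hp : ∀ x, p (f (S.src x)) = p x) {w : StateField}
    (hw : S.weight (fun x => p (f x)) = w) {P : Prop} [Decidable P]
    (hP : (∀ y, p (f (S.tgt y)) = q y) ↔ P) :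
    S.amplitude p q = if P then w else 0 := by
  split_ifs with h
  · let : Unique (S.State p q) :=
      { default := ⟨fun x => p (f x), hp, hP.2 h⟩
        uniq := fun τ => Subtype.ext (funext fun x =>
          (congrArg τ.1 (hf x)).symm.trans (τ.2.1 (f x))) }
    exact (finsum_unique _).trans hw
  · refine amplitude_eq_zero _ fun τ => h (hP.1 fun y => ?_)
    rw [← τ.2.1, hf, τ.2.2]

theorem amplitude_reverse (S : PreSurface a b) (p : a.Site → Bool) (q : b.Site → Bool) :
    S.reverse.amplitude q p = S.amplitude p q := by
  let e : S.reverse.State q p ≃ S.State p q :=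
    { toFun := fun σ => ⟨σ.1, σ.2.2, σ.2.1⟩
      invFun := fun σ => ⟨σ.1, σ.2.2, σ.2.1⟩
      left_inv := fun _ => rfl
      right_inv := fun _ => rfl }
  exact finsum_comp_equiv e (f := fun σ : S.State p q => S.weight σ.1)

end PreSurface

namespace Surface

variable {n : ℕ} {a b c d : TLDiagram n}

/-- The state sum of a surface. -/
noncomputable def amplitude (S : Surface a b) : (a.Site → Bool) → (b.Site → Bool) → StateField :=
  _root_.Quotient.lift PreSurface.amplitude (fun _ _ h => PreSurface.amplitude_congr h) S

theorem finite_comp (a : TLDiagram n) : Finite a.Comp :=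
  Quot.finite _

/-- An arbitrary `PreSurface` may have infinitely many components, but those built from elementary
pieces have finitely many, as the gluing formula requires. -/
theorem IsCobordism.exists_finite {S : Surface a b} (h : S.IsCobordism) :
    ∃ S' : PreSurface a b, Finite S'.X ∧ mk S' = S := by
  induction h with
  | cylinder φ h h' => exact ⟨_, finite_comp _, rfl⟩
  | dot a p => exact ⟨_, finite_comp _, rfl⟩
  | saddle i => exact ⟨_, inferInstanceAs (Finite (Quot _)), rfl⟩
  | saddle_reverse i => exact ⟨_, inferInstanceAs (Finite (Quot _)), rfl⟩
  | birth => exact ⟨_, inferInstanceAs (Finite (Fin n ⊕ Unit)), rfl⟩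
  | death => exact ⟨_, inferInstanceAs (Finite (Fin n ⊕ Unit)), rfl⟩
  | merge a p => exact ⟨_, finite_comp _, rfl⟩
  | split a p => exact ⟨_, finite_comp _, rfl⟩
  | comp _ _ h h' =>
    obtain ⟨S, _, rfl⟩ := h
    obtain ⟨T, _, rfl⟩ := h'
    exact ⟨S.comp T, inferInstanceAs (Finite (Quot _)), rfl⟩
  | tensor _ _ h h' =>
    obtain ⟨S, _, rfl⟩ := h
    obtain ⟨T, _, rfl⟩ := h'
    exact ⟨S.tensor T, inferInstanceAs (Finite (Quot _)), rfl⟩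

end Surface

/-! ### State sums of cobordisms. -/

namespace Cobordism

variable {n : ℕ} {a b c d : TLDiagram n}

/-- The state sum of a cobordism. -/
noncomputable def amplitude (S : Cobordism a b) (p : a.Site → Bool) (q : b.Site → Bool) :
    StateField :=
  S.1.amplitude p q

open Classical in
theorem amplitude_comp (S : Cobordism a b) (T : Cobordism b c) (p : a.Site → Bool)
    (r : c.Site → Bool) :
    (S.comp T).amplitude p r = ∑ q, S.amplitude p q * T.amplitude q r := by
  obtain ⟨S', _, hS⟩ := S.2.exists_finite
  obtain ⟨T', _, hT⟩ := T.2.exists_finite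
  obtain ⟨S, _⟩ := S
  obtain ⟨T, _⟩ := T
  subst hS
  subst hT
  exact PreSurface.amplitude_comp S' T' p r

theorem amplitude_tensor (S : Cobordism a b) (T : Cobordism c d)
    (p : (a.stack c).Site → Bool) (q : (b.stack d).Site → Bool)
    (h : ∀ j, p (Sum.inl (a.bot j)) = p (Sum.inr (c.top j))) :
    (S.tensor T).amplitude p q =
      S.amplitude (fun x => p (Sum.inl x)) (fun x => q (Sum.inl x)) *
        T.amplitude (fun x => p (Sum.inr x)) (fun x => q (Sum.inr x)) := by
  obtain ⟨S', _, hS⟩ := S.2.exists_finite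
  obtain ⟨T', _, hT⟩ := T.2.exists_finite
  obtain ⟨S, _⟩ := S
  obtain ⟨T, _⟩ := T
  subst hS
  subst hT
  exact PreSurface.amplitude_tensor S' T' p q h

theorem amplitude_tensor_of_ne (S : Cobordism a b) (T : Cobordism c d)
    {p : (a.stack c).Site → Bool} (q : (b.stack d).Site → Bool)
    (h : ¬∀ j, p (Sum.inl (a.bot j)) = p (Sum.inr (c.top j))) :
    (S.tensor T).amplitude p q = 0 := by
  obtain ⟨⟨S⟩, _⟩ := S
  obtain ⟨⟨T⟩, _⟩ := T
  exact PreSurface.amplitude_tensor_of_ne S T q h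

theorem amplitude_eq_zero_of_adj (S : Cobordism a b) {p : a.Site → Bool} (q : b.Site → Bool)
    (j k : Fin n) (h : b.Adj (b.top j) (b.top k)) (hp : p (a.top j) ≠ p (a.top k)) :
    S.amplitude p q = 0 := by
  obtain ⟨⟨S⟩, _⟩ := S
  exact PreSurface.amplitude_eq_zero_of_adj S q j k h hp

/-! ### The state sums of a sphere and of a cylinder -/

theorem amplitude_id_one (p q : Fin n → Bool) :
    (id (.one : TLDiagram n)).amplitude p q = if p = q then 1 else 0 := by
  refine (PreSurface.amplitude_of_src (PreSurface.id (.one : TLDiagram n))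
    (Quot.lift (fun x => x) fun _ _ h => h.elim) (by rintro ⟨x⟩; rfl) p q (fun _ => rfl) ?_ funext_iff.symm)
  simp [PreSurface.weight, PreSurface.id, PreSurface.cylinder]

theorem amplitude_id_circle (p q : Fin n ⊕ Unit → Bool) :
    (id (.circle : TLDiagram n)).amplitude p q = if p = q then 1 else 0 := by
  refine (PreSurface.amplitude_of_src (PreSurface.id (.circle : TLDiagram n))
    (Quot.lift (fun x => x) fun _ _ h => h.elim) (by rintro ⟨x⟩; rfl) p q (fun _ => rfl) ?_ funext_iff.symm)
  simp [PreSurface.weight, PreSurface.id, PreSurface.cylinder]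

theorem amplitude_dotCircle (p q : Fin n ⊕ Unit → Bool) :
    (dotCircle n).amplitude p q = if p = q then stateSign (p (Sum.inr ())) else 0 := by
  refine (PreSurface.amplitude_of_src
    (PreSurface.dot (.circle : TLDiagram n) (Sum.inr () : Fin n ⊕ Unit))
    (Quot.lift (fun x => x) fun _ _ h => h.elim) (by rintro ⟨x⟩; rfl) p q (fun _ => rfl) ?_ funext_iff.symm)
  simp [PreSurface.weight, PreSurface.dot, PreSurface.id, PreSurface.cylinder]

theorem amplitude_death (p : Fin n ⊕ Unit → Bool) (q : Fin n → Bool) :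
    (death n).amplitude p q =
      if p ∘ Sum.inl = q then (stateUnit (p (Sum.inr ())) : StateField) else 0 := by
  refine (PreSurface.amplitude_of_src (PreSurface.birth n).reverse (fun x => x) (fun _ => rfl)
    p q (fun _ => rfl) ?_ funext_iff.symm)
  simp [PreSurface.weight, PreSurface.birth, PreSurface.reverse]

theorem amplitude_birth (p : Fin n → Bool) (q : Fin n ⊕ Unit → Bool) :
    (birth n).amplitude p q =
      if q ∘ Sum.inl = p then (stateUnit (q (Sum.inr ())) : StateField) else 0 :=
  (PreSurface.amplitude_reverse (PreSurface.birth n) p q).symm.trans (amplitude_death q p)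

end Cobordism

namespace Cobordism

variable {n : ℕ} {a b c d : TLDiagram n}

/-- A labelling of the sample points of a circle, restricted to the strands. -/
def strandLabels (p : (.circle : TLDiagram n).Site → Bool) : (.one : TLDiagram n).Site → Bool :=
  fun j => p (Sum.inl j : Fin n ⊕ Unit)

/-- The label of the circle. -/
def circleLabel (p : (.circle : TLDiagram n).Site → Bool) : Bool :=
  p (Sum.inr () : Fin n ⊕ Unit)

theorem ext_labels {p q : (.circle : TLDiagram n).Site → Bool}
    (h : strandLabels p = strandLabels q) (h' : circleLabel p = circleLabel q) : p = q :=
  funext (Sum.rec (congrFun h) fun _ => h')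

/-- The cobordism acts on the circle by a function of the label of the circle. -/
structure IsDiagonal (A : Cobordism (.circle : TLDiagram n) .circle) (g : Bool → StateField) :
    Prop where
  diag : ∀ p, A.amplitude p p = g (circleLabel p)
  off_diag : ∀ p q, p ≠ q → A.amplitude p q = 0

theorem isDiagonal_dotCircle : IsDiagonal (dotCircle n) stateSign where
  diag p := (amplitude_dotCircle p p).trans (if_pos rfl)
  off_diag p q h := (amplitude_dotCircle p q).trans (if_neg h)

theorem amplitude_diagonal_comp {A : Cobordism (.circle : TLDiagram n) .circle}
    {g : Bool → StateField} (hA : IsDiagonal A g) (S : Cobordism .circle b)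
    (p : (.circle : TLDiagram n).Site → Bool) (q : b.Site → Bool) :
    (A.comp S).amplitude p q = g (circleLabel p) * S.amplitude p q := by
  classical
  rw [amplitude_comp, Finset.sum_eq_single p, hA.diag]
  · intro r _ h
    rw [hA.off_diag p r (Ne.symm h), zero_mul]
  · intro h
    exact absurd (Finset.mem_univ p) h

theorem amplitude_comp_diagonal {A : Cobordism (.circle : TLDiagram n) .circle}
    {g : Bool → StateField} (hA : IsDiagonal A g) (S : Cobordism a .circle)
    (p : a.Site → Bool) (q : (.circle : TLDiagram n).Site → Bool) :
    (S.comp A).amplitude p q = S.amplitude p q * g (circleLabel q) := by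
  classical
  rw [amplitude_comp, Finset.sum_eq_single q, hA.diag]
  · intro r _ h
    rw [hA.off_diag r q h, mul_zero]
  · intro h
    exact absurd (Finset.mem_univ q) h

theorem amplitude_birth_of_eq (p : (.circle : TLDiagram n).Site → Bool) :
    (birth n).amplitude (strandLabels p) p = stateUnit (circleLabel p) :=
  (amplitude_birth (strandLabels p) p).trans (if_pos rfl)

theorem amplitude_birth_of_ne {p : (.one : TLDiagram n).Site → Bool}
    {q : (.circle : TLDiagram n).Site → Bool} (h : strandLabels q ≠ p) :
    (birth n).amplitude p q = 0 :=
  (amplitude_birth p q).trans (if_neg h)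

theorem amplitude_death_of_eq (p : (.circle : TLDiagram n).Site → Bool) :
    (death n).amplitude p (strandLabels p) = stateUnit (circleLabel p) :=
  (amplitude_death p (strandLabels p)).trans (if_pos rfl)

theorem amplitude_death_of_ne {p : (.circle : TLDiagram n).Site → Bool}
    {q : (.one : TLDiagram n).Site → Bool} (h : strandLabels p ≠ q) :
    (death n).amplitude p q = 0 :=
  (amplitude_death p q).trans (if_neg h)

/-- The labelling with given restrictions to the strands and to the circle. -/
def extendLabels (p : (.one : TLDiagram n).Site → Bool) (x : Bool) :
    (.circle : TLDiagram n).Site → Bool :=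
  Sum.elim p fun _ => x

theorem sum_circle_labels [Fintype ((.circle : TLDiagram n).Site → Bool)]
    [Fintype ((.one : TLDiagram n).Site → Bool)]
    (F : ((.circle : TLDiagram n).Site → Bool) → StateField) :
    ∑ q, F q = ∑ u, ∑ x, F (extendLabels u x) := by
  rw [← Fintype.sum_prod_type']
  let e : ((.circle : TLDiagram n).Site → Bool) ≃ ((.one : TLDiagram n).Site → Bool) × Bool :=
    { toFun := fun q => (strandLabels q, circleLabel q)
      invFun := fun u => extendLabels u.1 u.2
      left_inv := fun _ => ext_labels rfl rfl
      right_inv := fun _ => rfl }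
  exact Fintype.sum_equiv e _ _ fun q => congrArg F (e.left_inv q).symm

/-- A sphere, cut along a circle. -/
theorem amplitude_sphere {S : Cobordism (.one : TLDiagram n) .circle} {g : Bool → StateField}
    (hS : ∀ p q, S.amplitude p q = (birth n).amplitude p q * g (circleLabel q))
    (p q : (.one : TLDiagram n).Site → Bool) :
    (S.comp (death n)).amplitude p q =
      (∑ x, (stateUnit x : StateField) ^ 2 * g x) * (id (.one : TLDiagram n)).amplitude p q := by
  classical
  rw [amplitude_comp, sum_circle_labels, Finset.sum_eq_single p]
  · by_cases h : p = q
    · subst h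
      rw [(amplitude_id_one p p).trans (if_pos rfl), mul_one]
      refine Finset.sum_congr rfl fun x _ => ?_
      have h1 : (birth n).amplitude p (extendLabels p x) = stateUnit x :=
        amplitude_birth_of_eq (extendLabels p x)
      have h2 : (death n).amplitude (extendLabels p x) p = stateUnit x :=
        amplitude_death_of_eq (extendLabels p x)
      have h3 : circleLabel (extendLabels p x) = x := rfl
      rw [hS, h1, h2, h3]
      ring
    · rw [(amplitude_id_one p q).trans (if_neg h), mul_zero]
      refine Finset.sum_eq_zero fun x _ => ?_
      rw [amplitude_death_of_ne (p := extendLabels p x) h, mul_zero]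
  · intro r _ h
    refine Finset.sum_eq_zero fun x _ => ?_
    rw [hS, amplitude_birth_of_ne (q := extendLabels r x) h, zero_mul, zero_mul]
  · intro h
    exact absurd (Finset.mem_univ p) h

theorem amplitude_death_birth_of_eq {p q : (.circle : TLDiagram n).Site → Bool}
    (h : strandLabels p = strandLabels q) :
    ((death n).comp (birth n)).amplitude p q =
      (stateUnit (circleLabel p) : StateField) * stateUnit (circleLabel q) := by
  classical
  rw [amplitude_comp, Finset.sum_eq_single (strandLabels p)]
  · rw [amplitude_death_of_eq, h, amplitude_birth_of_eq]
  · intro r _ h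
    rw [amplitude_death_of_ne (Ne.symm h), zero_mul]
  · intro h
    exact absurd (Finset.mem_univ _) h

theorem amplitude_death_birth_of_ne {p q : (.circle : TLDiagram n).Site → Bool}
    (h : strandLabels p ≠ strandLabels q) :
    ((death n).comp (birth n)).amplitude p q = 0 := by
  classical
  rw [amplitude_comp]
  refine Finset.sum_eq_zero fun r _ => ?_
  by_cases hr : strandLabels p = r
  · rw [amplitude_birth_of_ne (hr ▸ h.symm), mul_zero]
  · rw [amplitude_death_of_ne hr, zero_mul]

/-- Labels `x` and `y` on the two halves give `stateUnit x * stateUnit y * (stateSign x + stateSign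
y)`. This vanishes for different labels and equals `2 * (1 / 2) = (-2) * (-1 / 2) = 1` for equal
ones. -/
theorem amplitude_neck (p q : (.circle : TLDiagram n).Site → Bool) :
    (id (.circle : TLDiagram n)).amplitude p q =
      ((dotCircle n).comp ((death n).comp (birth n))).amplitude p q +
        (((death n).comp (birth n)).comp (dotCircle n)).amplitude p q := by
  rw [amplitude_diagonal_comp isDiagonal_dotCircle, amplitude_comp_diagonal isDiagonal_dotCircle]
  by_cases h : strandLabels p = strandLabels q
  · rw [amplitude_death_birth_of_eq h]
    by_cases h' : circleLabel p = circleLabel q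
    · rw [(amplitude_id_circle p q).trans (if_pos (ext_labels h h')), h']
      cases circleLabel q <;> decide
    · rw [(amplitude_id_circle p q).trans (if_neg fun e => h' (congrArg circleLabel e))]
      revert h'
      cases circleLabel p <;> cases circleLabel q <;> decide
  · rw [amplitude_death_birth_of_ne h,
      (amplitude_id_circle p q).trans (if_neg fun e => h (congrArg strandLabels e))]
    simp

end Cobordism

/-! ### Linear extension and invariance under the local relations. -/

namespace PreCob

variable {n : ℕ} {X Y Z : GradedDiagram n}

/-- The evaluation of the coefficients. -/
noncomputable def evalCoeff : BaseRing →+* StateField :=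
  Polynomial.eval₂RingHom (Int.castRingHom StateField) 1

theorem evalCoeff_alpha : evalCoeff alpha = 1 :=
  Polynomial.eval₂_X _ _

/-- The state sum of a linear combination of cobordisms. -/
noncomputable def amplitude (p : X.diagram.Site → Bool) (q : Y.diagram.Site → Bool) :
    ((incl n).obj X ⟶ (incl n).obj Y) →+ StateField :=
  Finsupp.liftAddHom (α := Cobordism X.diagram Y.diagram) fun S =>
    (AddMonoidHom.mulRight (S.amplitude p q)).comp evalCoeff.toAddMonoidHom

theorem amplitude_smul_single (p : X.diagram.Site → Bool) (q : Y.diagram.Site → Bool)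
    (r : BaseRing) (S : Cobordism X.diagram Y.diagram) :
    amplitude p q (r • single X.shift Y.shift S) = evalCoeff r * S.amplitude p q := by
  have e : r • single X.shift Y.shift S = Finsupp.single (α := Cobordism X.diagram Y.diagram) S r :=
    (Finsupp.smul_single r S 1).trans (congrArg _ (mul_one r))
  rw [e]
  exact Finsupp.liftAddHom_apply_single _ _ _

theorem amplitude_single (p : X.diagram.Site → Bool) (q : Y.diagram.Site → Bool)
    (S : Cobordism X.diagram Y.diagram) :
    amplitude p q (single X.shift Y.shift S) = S.amplitude p q := by
  have h := amplitude_smul_single p q 1 S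
  rwa [one_smul, map_one, one_mul] at h

theorem hom_induction {P : ((incl n).obj X ⟶ (incl n).obj Y) → Prop}
    (f : (incl n).obj X ⟶ (incl n).obj Y) (zero : P 0) (add : ∀ f g, P f → P g → P (f + g))
    (smul : ∀ (r : BaseRing) (S : Cobordism X.diagram Y.diagram),
      P (r • single X.shift Y.shift S)) : P f := by
  refine Finsupp.induction_linear (motive := P) f zero add fun S r => ?_
  have e : r • single X.shift Y.shift S = Finsupp.single (α := Cobordism X.diagram Y.diagram) S r :=
    (Finsupp.smul_single r S 1).trans (congrArg _ (mul_one r))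
  exact e ▸ smul r S

end PreCob

namespace PreCob

variable {n : ℕ} {X Y Z : GradedDiagram n}

open Classical in
theorem amplitude_comp (f : (incl n).obj X ⟶ (incl n).obj Y) (g : (incl n).obj Y ⟶ (incl n).obj Z)
    (p : X.diagram.Site → Bool) (r : Z.diagram.Site → Bool) :
    amplitude p r (f ≫ g) = ∑ q, amplitude p q f * amplitude q r g := by
  induction f using hom_induction with
  | zero => rw [zero_comp, map_zero]; simp
  | add f f' h h' =>
    rw [Preadditive.add_comp, map_add, h, h', ← Finset.sum_add_distrib]
    simp only [map_add, add_mul]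
  | smul x S =>
    induction g using hom_induction with
    | zero => rw [comp_zero, map_zero]; simp
    | add g g' h h' =>
      rw [Preadditive.comp_add, map_add, h, h', ← Finset.sum_add_distrib]
      simp only [map_add, mul_add]
    | smul y T =>
      have e : (x • single X.shift Y.shift S) ≫ (y • single Y.shift Z.shift T) =
          (x * y) • single X.shift Z.shift (S.comp T) := by
        rw [Linear.smul_comp, Linear.comp_smul, smul_smul]
        exact congrArg _ ((incl n).map_comp (X := X) (Y := Y) (Z := Z) S T).symm
      refine (congrArg (amplitude p r) e).trans ?_
      rw [amplitude_smul_single, Cobordism.amplitude_comp, map_mul, Finset.mul_sum]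
      refine Finset.sum_congr rfl fun q _ => ?_
      rw [amplitude_smul_single, amplitude_smul_single]
      ring

theorem amplitude_smul (x : BaseRing) (f : (incl n).obj X ⟶ (incl n).obj Y)
    (p : X.diagram.Site → Bool) (q : Y.diagram.Site → Bool) :
    amplitude p q (x • f) = evalCoeff x * amplitude p q f := by
  induction f using hom_induction with
  | zero => rw [smul_zero, map_zero, mul_zero]
  | add f f' h h' => rw [smul_add, map_add, h, h', map_add, mul_add]
  | smul y S => rw [smul_smul, amplitude_smul_single, amplitude_smul_single, map_mul, mul_assoc]

theorem amplitude_id (p q : X.diagram.Site → Bool) :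
    amplitude p q (𝟙 ((incl n).obj X)) = (Cobordism.id X.diagram).amplitude p q := by
  have e : single X.shift X.shift (Cobordism.id X.diagram) = 𝟙 ((incl n).obj X) :=
    (incl n).map_id X
  rw [← e, amplitude_single]

instance (Z : GradedDiagram n) : (tensorLeft Z).Linear BaseRing :=
  inferInstanceAs ((Free.lift BaseRing (Z.tensorLeft ⋙ incl n)).Linear BaseRing)

theorem tensorLeft_smul_single (Z : GradedDiagram n) (r : BaseRing)
    (S : Cobordism X.diagram Y.diagram) :
    (tensorLeft Z).map (r • single X.shift Y.shift S) =
      r • single (Z.stack X).shift (Z.stack Y).shift ((Cobordism.id Z.diagram).tensor S) := by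
  rw [Functor.map_smul]
  exact congrArg (r • ·) ((Free.lift_map_single BaseRing (Z.tensorLeft ⋙ incl n)
    (X := X) (Y := Y) S 1).trans (one_smul _ _))

/-- Together with the vanishing for incompatible labels, this shows that the state sum of `Z ⊗ f`
depends on `f` only through its state sums, as needed for the tensor clauses of `Rel`. -/
theorem amplitude_tensorLeft (Z : GradedDiagram n) (f : (incl n).obj X ⟶ (incl n).obj Y)
    (p : (Z.stack X).diagram.Site → Bool) (q : (Z.stack Y).diagram.Site → Bool)
    (h : ∀ j, p (Sum.inl (Z.diagram.bot j)) = p (Sum.inr (X.diagram.top j))) :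
    amplitude (X := Z.stack X) (Y := Z.stack Y) p q ((tensorLeft Z).map f) =
      (Cobordism.id Z.diagram).amplitude (fun x => p (Sum.inl x)) (fun x => q (Sum.inl x)) *
        amplitude (fun x => p (Sum.inr x)) (fun x => q (Sum.inr x)) f := by
  induction f using hom_induction with
  | zero =>
    refine ((congrArg (amplitude (X := Z.stack X) (Y := Z.stack Y) p q) ((tensorLeft Z).map_zero _ _)).trans (map_zero _)).trans ?_
    rw [map_zero, mul_zero]
  | add f f' hf hf' =>
    refine (congrArg (amplitude (X := Z.stack X) (Y := Z.stack Y) p q) (Functor.map_add (tensorLeft Z) (f := f) (g := f'))).trans ?_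
    refine (map_add _ _ _).trans ((congrArg₂ (· + ·) hf hf').trans ?_)
    rw [map_add, mul_add]
  | smul y S =>
    refine (congrArg (amplitude (X := Z.stack X) (Y := Z.stack Y) p q)
      (tensorLeft_smul_single Z y S)).trans ?_
    refine (amplitude_smul_single _ _ _ _).trans ?_
    refine (congrArg (evalCoeff y * ·) (Cobordism.amplitude_tensor _ _ p q h)).trans ?_
    rw [amplitude_smul_single]
    ring

theorem amplitude_tensorLeft_of_ne (Z : GradedDiagram n) (f : (incl n).obj X ⟶ (incl n).obj Y)
    {p : (Z.stack X).diagram.Site → Bool} (q : (Z.stack Y).diagram.Site → Bool)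
    (h : ¬∀ j, p (Sum.inl (Z.diagram.bot j)) = p (Sum.inr (X.diagram.top j))) :
    amplitude (X := Z.stack X) (Y := Z.stack Y) p q ((tensorLeft Z).map f) = 0 := by
  induction f using hom_induction with
  | zero => exact (congrArg (amplitude (X := Z.stack X) (Y := Z.stack Y) p q) ((tensorLeft Z).map_zero _ _)).trans (map_zero _)
  | add f f' hf hf' =>
    refine (congrArg (amplitude (X := Z.stack X) (Y := Z.stack Y) p q) (Functor.map_add (tensorLeft Z) (f := f) (g := f'))).trans ?_
    refine (map_add _ _ _).trans ((congrArg₂ (· + ·) hf hf').trans ?_)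
    exact add_zero 0
  | smul y S =>
    refine (congrArg (amplitude (X := Z.stack X) (Y := Z.stack Y) p q)
      (tensorLeft_smul_single Z y S)).trans ?_
    refine (amplitude_smul_single _ _ _ _).trans ?_
    exact (congrArg (evalCoeff y * ·) (Cobordism.amplitude_tensor_of_ne _ _ q h)).trans (mul_zero _)

instance (Z : GradedDiagram n) : (tensorRight Z).Linear BaseRing :=
  inferInstanceAs ((Free.lift BaseRing (Z.tensorRight ⋙ incl n)).Linear BaseRing)

theorem tensorRight_smul_single (Z : GradedDiagram n) (r : BaseRing)
    (S : Cobordism X.diagram Y.diagram) :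
    (tensorRight Z).map (r • single X.shift Y.shift S) =
      r • single (X.stack Z).shift (Y.stack Z).shift (Cobordism.tensor S (Cobordism.id Z.diagram)) := by
  rw [Functor.map_smul]
  exact congrArg (r • ·) ((Free.lift_map_single BaseRing (Z.tensorRight ⋙ incl n)
    (X := X) (Y := Y) S 1).trans (one_smul _ _))

theorem amplitude_tensorRight (Z : GradedDiagram n) (f : (incl n).obj X ⟶ (incl n).obj Y)
    (p : (X.stack Z).diagram.Site → Bool) (q : (Y.stack Z).diagram.Site → Bool)
    (h : ∀ j, p (Sum.inl (X.diagram.bot j)) = p (Sum.inr (Z.diagram.top j))) :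
    amplitude (X := X.stack Z) (Y := Y.stack Z) p q ((tensorRight Z).map f) =
      (Cobordism.id Z.diagram).amplitude (fun x => p (Sum.inr x)) (fun x => q (Sum.inr x)) *
        amplitude (fun x => p (Sum.inl x)) (fun x => q (Sum.inl x)) f := by
  induction f using hom_induction with
  | zero =>
    refine ((congrArg (amplitude (X := X.stack Z) (Y := Y.stack Z) p q) ((tensorRight Z).map_zero _ _)).trans (map_zero _)).trans ?_
    rw [map_zero, mul_zero]
  | add f f' hf hf' =>
    refine (congrArg (amplitude (X := X.stack Z) (Y := Y.stack Z) p q) (Functor.map_add (tensorRight Z) (f := f) (g := f'))).trans ?_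
    refine (map_add _ _ _).trans ((congrArg₂ (· + ·) hf hf').trans ?_)
    rw [map_add, mul_add]
  | smul y S =>
    refine (congrArg (amplitude (X := X.stack Z) (Y := Y.stack Z) p q)
      (tensorRight_smul_single Z y S)).trans ?_
    refine (amplitude_smul_single _ _ _ _).trans ?_
    refine (congrArg (evalCoeff y * ·) (Cobordism.amplitude_tensor _ _ p q h)).trans ?_
    rw [amplitude_smul_single]
    ring

theorem amplitude_tensorRight_of_ne (Z : GradedDiagram n) (f : (incl n).obj X ⟶ (incl n).obj Y)
    {p : (X.stack Z).diagram.Site → Bool} (q : (Y.stack Z).diagram.Site → Bool)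
    (h : ¬∀ j, p (Sum.inl (X.diagram.bot j)) = p (Sum.inr (Z.diagram.top j))) :
    amplitude (X := X.stack Z) (Y := Y.stack Z) p q ((tensorRight Z).map f) = 0 := by
  induction f using hom_induction with
  | zero => exact (congrArg (amplitude (X := X.stack Z) (Y := Y.stack Z) p q) ((tensorRight Z).map_zero _ _)).trans (map_zero _)
  | add f f' hf hf' =>
    refine (congrArg (amplitude (X := X.stack Z) (Y := Y.stack Z) p q) (Functor.map_add (tensorRight Z) (f := f) (g := f'))).trans ?_
    refine (map_add _ _ _).trans ((congrArg₂ (· + ·) hf hf').trans ?_)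
    exact add_zero 0
  | smul y S =>
    refine (congrArg (amplitude (X := X.stack Z) (Y := Y.stack Z) p q)
      (tensorRight_smul_single Z y S)).trans ?_
    refine (amplitude_smul_single _ _ _ _).trans ?_
    exact (congrArg (evalCoeff y * ·) (Cobordism.amplitude_tensor_of_ne _ _ q h)).trans (mul_zero _)

/-- The state sums of `S` and `T` differ by a factor that depends on the label of the circle. -/
def _root_.Cobordism.IsMultiple {a : TLDiagram n} (S T : Cobordism a .circle)
    (g : Bool → StateField) : Prop :=
  ∀ p q, S.amplitude p q = T.amplitude p q * g (Cobordism.circleLabel q)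

theorem _root_.Cobordism.IsMultiple.comp_dotCircle {a : TLDiagram n} {S T : Cobordism a .circle}
    {g : Bool → StateField} (h : S.IsMultiple T g) :
    (S.comp (Cobordism.dotCircle n)).IsMultiple T fun x => g x * stateSign x := by
  intro p q
  rw [Cobordism.amplitude_comp_diagonal Cobordism.isDiagonal_dotCircle, h, mul_assoc]

theorem amplitude_single_sphere (s : ℤ) {S : Cobordism (.one : TLDiagram n) .circle}
    {g : Bool → StateField}
    (hS : S.IsMultiple (Cobordism.birth n) g) {x : StateField}
    (hx : ∑ y, (stateUnit y : StateField) ^ 2 * g y = x)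
    (p q : (.one : TLDiagram n).Site → Bool) :
    amplitude (X := ⟨s, .one⟩) (Y := ⟨s, .one⟩) p q
      (single s s (S.comp (Cobordism.death n))) =
      x * amplitude (X := ⟨s, .one⟩) (Y := ⟨s, .one⟩) p q (𝟙 _) := by
  refine (amplitude_single (X := ⟨s, .one⟩) (Y := ⟨s, .one⟩) p q _).trans ?_
  rw [Cobordism.amplitude_sphere hS, hx, amplitude_id]

/-- The state sums are invariant under the local relations. -/
theorem Rel.amplitude_eq {A B : PreCob n} {f g : A ⟶ B} (h : Rel n f g) :
    ∀ p q, amplitude (X := A) (Y := B) p q f = amplitude (X := A) (Y := B) p q g := by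
  -- A disc with `k` dots acquires the factor `stateSign ^ k`. The sphere with `k` dots then has the
  -- value `1 / 2 + (-1) ^ k * (-1 / 2)`, that is `0, 1, 0, 1`, in agreement with `α = 1`.
  have h0 : (Cobordism.birth n).IsMultiple (Cobordism.birth n) fun _ => 1 :=
    fun _ _ => (mul_one _).symm
  have h1 := h0.comp_dotCircle
  have h2 := h1.comp_dotCircle
  have h3 := h2.comp_dotCircle
  induction h with
  | sphere s =>
    intro p q
    refine (amplitude_single_sphere s h0 (x := 0) (by decide) p q).trans
      ((zero_mul _).trans (map_zero _).symm)
  | sphere_dot s =>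
    intro p q
    exact (amplitude_single_sphere s h1 (x := 1) (by decide) p q).trans (one_mul _)
  | sphere_dot_dot s =>
    intro p q
    refine (amplitude_single_sphere s h2 (x := 0) (by decide) p q).trans
      ((zero_mul _).trans (map_zero _).symm)
  | sphere_dot_dot_dot s =>
    intro p q
    refine (amplitude_single_sphere s h3 (x := 1) (by decide) p q).trans ?_
    refine Eq.trans ?_ (amplitude_smul (X := ⟨s, .one⟩) (Y := ⟨s, .one⟩) alpha _ p q).symm
    rw [evalCoeff_alpha]
  | neck s =>
    intro p q
    refine Eq.trans ?_ (map_add _ _ _).symm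
    refine (amplitude_single (X := ⟨s, .circle⟩) (Y := ⟨s, .circle⟩) p q _).trans
      ((Cobordism.amplitude_neck p q).trans ?_)
    exact (congrArg₂ (· + ·) (amplitude_single (X := ⟨s, .circle⟩) (Y := ⟨s, .circle⟩) p q _)
      (amplitude_single (X := ⟨s, .circle⟩) (Y := ⟨s, .circle⟩) p q _)).symm
  | refl f => exact fun _ _ => rfl
  | symm _ h => exact fun p q => (h p q).symm
  | trans _ _ h h' => exact fun p q => (h p q).trans (h' p q)
  | add _ _ h h' =>
    intro p q
    exact (map_add _ _ _).trans ((congrArg₂ (· + ·) (h p q) (h' p q)).trans (map_add _ _ _).symm)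
  | smul r _ h =>
    intro p q
    refine (amplitude_smul _ _ p q).trans (Eq.trans ?_ (amplitude_smul _ _ p q).symm)
    rw [h]
  | @comp_left A B C f g g' _ h =>
    intro p q
    refine (amplitude_comp (X := A) (Y := B) (Z := C) f g p q).trans
      (Eq.trans ?_ (amplitude_comp (X := A) (Y := B) (Z := C) f g' p q).symm)
    exact Finset.sum_congr rfl fun r _ => congrArg _ (h r q)
  | @comp_right A B C f f' g _ h =>
    intro p q
    refine (amplitude_comp (X := A) (Y := B) (Z := C) f g p q).trans
      (Eq.trans ?_ (amplitude_comp (X := A) (Y := B) (Z := C) f' g p q).symm)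
    exact Finset.sum_congr rfl fun r _ => congrArg (· * _) (h p r)
  | @tensorLeft Z A B f g _ h =>
    intro p q
    by_cases hp : ∀ j, p (Sum.inl (Z.diagram.bot j)) = p (Sum.inr (GradedDiagram.diagram A |>.top j))
    · refine (amplitude_tensorLeft (X := A) (Y := B) Z f p q hp).trans
        (Eq.trans ?_ (amplitude_tensorLeft (X := A) (Y := B) Z g p q hp).symm)
      exact congrArg _ (h _ _)
    · exact (amplitude_tensorLeft_of_ne (X := A) (Y := B) Z f q hp).trans
        (amplitude_tensorLeft_of_ne (X := A) (Y := B) Z g q hp).symm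
  | @tensorRight Z A B f g _ h =>
    intro p q
    by_cases hp : ∀ j, p (Sum.inl (GradedDiagram.diagram A |>.bot j)) = p (Sum.inr (Z.diagram.top j))
    · refine (amplitude_tensorRight (X := A) (Y := B) Z f p q hp).trans
        (Eq.trans ?_ (amplitude_tensorRight (X := A) (Y := B) Z g p q hp).symm)
      exact congrArg _ (h _ _)
    · exact (amplitude_tensorRight_of_ne (X := A) (Y := B) Z f q hp).trans
        (amplitude_tensorRight_of_ne (X := A) (Y := B) Z g q hp).symm

end PreCob

namespace Cob

variable {n : ℕ} {A B C : Cob n}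

/-- The state sum of a morphism. -/
noncomputable def amplitude (p : A.diagram.Site → Bool) (q : B.diagram.Site → Bool) :
    (A ⟶ B) →+ StateField where
  toFun := Quot.lift (fun f => PreCob.amplitude (X := A.graded) (Y := B.graded) p q f) fun f g h =>
    -- Morphisms of the quotient category are classes for the closure of `Rel` under composition,
    -- which is `Rel` itself since it is a congruence.
    PreCob.Rel.amplitude_eq ((HomRel.compClosure_iff_self (PreCob.Rel n) f g).1 h) p q
  map_zero' := map_zero (PreCob.amplitude (X := A.graded) (Y := B.graded) p q)
  map_add' := by
    rintro ⟨f⟩ ⟨g⟩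
    exact map_add (PreCob.amplitude (X := A.graded) (Y := B.graded) p q) f g

theorem amplitude_id_one (s : ℤ) (p : (.one : TLDiagram n).Site → Bool) :
    amplitude (A := of s .one) (B := of s .one) p p (𝟙 _) = 1 := by
  refine (PreCob.amplitude_id (X := ⟨s, .one⟩) p p).trans ?_
  exact (Cobordism.amplitude_id_one p p).trans (if_pos rfl)

/-- A morphism has vanishing state sum if it factors through a diagram with an upper turnback
between two points with different labels. -/
theorem amplitude_comp_eq_zero (f : A ⟶ B) (g : B ⟶ C) {p : A.diagram.Site → Bool}
    (q : C.diagram.Site → Bool) (j k : Fin n)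
    (h : B.diagram.Adj (B.diagram.top j) (B.diagram.top k))
    (hp : p (A.diagram.top j) ≠ p (A.diagram.top k)) : amplitude p q (f ≫ g) = 0 := by
  classical
  obtain ⟨f⟩ := f
  obtain ⟨g⟩ := g
  refine (PreCob.amplitude_comp (X := A.graded) (Y := B.graded) (Z := C.graded) f g p q).trans ?_
  refine Finset.sum_eq_zero fun r _ => ?_
  have hf : PreCob.amplitude (X := A.graded) (Y := B.graded) p r f = 0 := by
    refine PreCob.hom_induction (X := A.graded) (Y := B.graded)
      (P := fun f => PreCob.amplitude (X := A.graded) (Y := B.graded) p r f = 0) f ?_ ?_ ?_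
    · exact map_zero _
    · intro f f' hf hf'
      rw [map_add, hf, hf', add_zero]
    · intro x S
      refine (PreCob.amplitude_smul_single (X := A.graded) (Y := B.graded) p r x S).trans ?_
      exact (congrArg _ (S.amplitude_eq_zero_of_adj r j k h hp)).trans (mul_zero _)
  exact (congrArg (· * _) hf).trans (zero_mul _)

end Cob

/-! ### The identity diagram is not a summand in positive degree. -/

namespace ThirdProjector

/-- Each diagram in positive degree begins at the top with `e₁` or `e₂`, whose upper turnback joins
two neighbouring points. -/
theorem exists_adj_diagram : ∀ (m : ℕ) (s : Fin 2),
    ∃ i : Fin 2, (diagram m s).Adj ((diagram m s).top (TLDiagram.left (n := 3) i))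
      ((diagram m s).top (TLDiagram.right (n := 3) i))
  | 0, 0 => ⟨0, .inr (.inl ⟨rfl, rfl⟩)⟩
  | 0, 1 => ⟨1, .inr (.inl ⟨rfl, rfl⟩)⟩
  | 1, 0 => ⟨0, .inr (.inl ⟨rfl, rfl⟩)⟩
  | 1, 1 => ⟨1, .inr (.inl ⟨rfl, rfl⟩)⟩
  | 2, 0 => ⟨0, .inr (.inl ⟨rfl, rfl⟩)⟩
  | 2, 1 => ⟨1, .inr (.inl ⟨rfl, rfl⟩)⟩
  | 3, 0 => ⟨0, .inr (.inl ⟨rfl, rfl⟩)⟩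
  | 3, 1 => ⟨1, .inr (.inl ⟨rfl, rfl⟩)⟩
  | m + 4, s => exists_adj_diagram m s

/-- Alternating labels of the three strands. -/
def alternatingLabels : (.one : TLDiagram 3).Site → Bool :=
  fun j : Fin 3 => decide (j ≠ 1)

theorem alternatingLabels_ne : ∀ i : Fin 2,
    alternatingLabels (TLDiagram.left (n := 3) i) ≠ alternatingLabels (TLDiagram.right (n := 3) i) := by
  decide

theorem amplitude_factor_eq_zero (s : ℤ) (m : ℕ) (t : Fin 2)
    (f : Cob.of s (.one : TLDiagram 3) ⟶ Cob.of (shift m) (diagram m t))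
    (g : Cob.of (shift m) (diagram m t) ⟶ Cob.of s .one) :
    Cob.amplitude (A := Cob.of s .one) (B := Cob.of s .one) alternatingLabels alternatingLabels
      (f ≫ g) = 0 := by
  obtain ⟨i, h⟩ := exists_adj_diagram m t
  exact Cob.amplitude_comp_eq_zero f g _ _ _ h (alternatingLabels_ne i)

/-- An isomorphism would write the identity of `1` as a sum of two maps factoring through diagrams
with an upper turnback. For alternating labels the state sum of each is zero, while that of the
identity is one. Gradings play no role, so isomorphisms of any degree are excluded. -/
theorem isEmpty_iso (m : ℕ) (D : MatCob 3) : IsEmpty (term (m + 1) ≅ MatCob.of 0 .one ⊞ D) := by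
  refine ⟨fun φ => ?_⟩
  have e : ((biprod.inl : MatCob.of 0 .one ⟶ MatCob.of 0 .one ⊞ D) ≫ φ.inv) ≫
      (φ.hom ≫ biprod.fst) = 𝟙 (MatCob.of 0 .one) := by simp
  generalize (biprod.inl : MatCob.of 0 .one ⟶ MatCob.of 0 .one ⊞ D) ≫ φ.inv = f at e
  generalize φ.hom ≫ (biprod.fst : MatCob.of 0 .one ⊞ D ⟶ _) = g at e
  have h : ∑ t : Fin 2, (f PUnit.unit t ≫ g t PUnit.unit :
      Cob.of 0 (.one : TLDiagram 3) ⟶ Cob.of 0 .one) = 𝟙 _ :=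
    (congrFun (congrFun e PUnit.unit) PUnit.unit).trans (Mat_.id_apply_self _ _)
  have h' := congrArg (Cob.amplitude (A := Cob.of 0 .one) (B := Cob.of 0 .one)
    alternatingLabels alternatingLabels) h
  rw [map_sum] at h'
  have h0 : (0 : StateField) = 1 :=
    (Finset.sum_eq_zero fun t _ => amplitude_factor_eq_zero 0 m t _ _).symm.trans
      (h'.trans (Cob.amplitude_id_one 0 _))
  exact absurd h0 (by decide)

theorem isDegreeZero_id_one : MatCob.IsDegreeZero (𝟙 (MatCob.of 0 (.one : TLDiagram 3))) := by
  intro i j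
  obtain rfl : i = j := Subsingleton.elim (α := PUnit) i j
  rw [Mat_.id_apply_self]
  exact Cob.isHomogeneous_id 0 .one

theorem isUniversalProjector : (thirdProjector d_comp_d).IsUniversalProjector where
  isZero k hk := by
    obtain ⟨k, rfl⟩ := Int.eq_negSucc_of_lt_zero hk
    refine (IsZero.iff_id_eq_zero _).2 ?_
    exact funext fun i : Empty => i.elim
  shift_nonneg k hk := by
    obtain ⟨m, rfl⟩ : ∃ m : ℕ, k = Int.ofNat (m + 1) :=
      ⟨k.toNat - 1, by simp only [Int.ofNat_eq_natCast]; omega⟩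
    exact fun _ => shift_nonneg m
  degree_zero k := by
    have e : (thirdProjector d_comp_d).d k (k + 1) = d k := CochainComplex.of_d X d k
    rw [e]
    exact isDegreeZero_d k
  one := ⟨Iso.refl _, isDegreeZero_id_one, isDegreeZero_id_one⟩
  not_one k hk D := by
    obtain ⟨m, rfl⟩ : ∃ m : ℕ, k = Int.ofNat (m + 1) :=
      ⟨k.toNat - 1, by simp only [Int.ofNat_eq_natCast]; omega⟩
    exact isEmpty_iso m D
  tensor_e := isContractible_tensorRight
  e_tensor := isContractible_tensorLeft

end ThirdProjector

theorem theorem4p3 :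
    ∃ h : ∀ k : ℤ, ThirdProjector.d k ≫ ThirdProjector.d (k + 1) = 0,
      (thirdProjector h).IsUniversalProjector ∧
      ∀ i : Fin 2, ((thirdProjector h).tensorLeft (.e i)).IsContractible ∧
        ((thirdProjector h).tensorRight (.e i)).IsContractible :=
  ⟨ThirdProjector.d_comp_d, ThirdProjector.isUniversalProjector, fun i =>
    ⟨ThirdProjector.isContractible_tensorLeft i, ThirdProjector.isContractible_tensorRight i⟩⟩
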